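/- Let $\alpha$ be a real number with $-1<\alpha<0$. Let $\mathscr T\subset\mathbf{CP}^4$ be the quartic surface defined, in homogeneous coordinates $(y_0:y_1:y_2:y_3:y_4)$, by $$y_1y_2=y_0^2,\qquad y_3y_4=y_0\{y_1-\alpha y_2+(\alpha-1)y_0\},$$ let $\Lambda=\{y_1y_2=y_0^2\}\subset\mathbf{CP}^2$, and let $\pi:\mathscr T\dashrightarrow\Lambda$ be the rational map $(y_0:y_1:y_2:y_3:y_4)\mapsto(y_0:y_1:y_2)$. Then the following hold. (i) The set of indeterminacy of $\pi$ consists of two points and coincides with the singular locus of $\mathscr T$. Both singularities are ordinary double points, i.e. the completed local ring of $\mathscr T$ there is isomorphic to $\mathbf C[[x,y,z]]/(xy-z^2)$. (ii) $\mathscr T$ has a minimal resolution $\rho:\tilde{\mathscr T}\to\mathscr T$ (a proper birational morphism from a smooth surface through which every other such morphism factors uniquely). The composition $\tilde\pi=\pi\circ\rho:\tilde{\mathscr T}\to\Lambda$ is a morphism, and its general fibres are irreducible smooth rational curves (isomorphic to $\mathbf{CP}^1$). Moreover $\tilde\pi$ has precisely four singular fibres, and each of them is reduced and consists of two rational curves,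 i.e. it has exactly two irreducible components, each of which is birational to $\mathbf{CP}^1$. -/

import Mathlib

open CategoryTheory AlgebraicGeometry
open scoped DirectSum

noncomputable section

namespace Minitwistor

/-! ### Projective schemes cut out by homogeneous equations -/

section Quotient

variable {R A : Type} [CommRing R] [CommRing A] [Algebra R A]
  {𝒜 : ℕ → Submodule R A} [GradedAlgebra 𝒜]

/-- The grading of `A ⧸ I` induced by the grading of `A`, for a homogeneous ideal `I`. -/
def quotGrading (I : HomogeneousIdeal 𝒜) (i : ℕ) : Submodule R (A ⧸ I.toIdeal) :=
  (𝒜 i).map (Ideal.Quotient.mkₐ R I.toIdeal).toLinearMap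

theorem mk_mem_quotGrading (I : HomogeneousIdeal 𝒜) {i : ℕ} {a : A} (ha : a ∈ 𝒜 i) :
    Ideal.Quotient.mk I.toIdeal a ∈ quotGrading I i :=
  ⟨a, ha, rfl⟩

instance (I : HomogeneousIdeal 𝒜) : SetLike.GradedMonoid (quotGrading I) where
  one_mem := ⟨1, SetLike.GradedOne.one_mem, map_one (Ideal.Quotient.mk I.toIdeal)⟩
  mul_mem := by
    rintro i j _ _ ⟨a, ha, rfl⟩ ⟨b, hb, rfl⟩
    exact ⟨a * b, SetLike.GradedMul.mul_mem ha hb, map_mul (Ideal.Quotient.mk I.toIdeal) a b⟩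

/-- The homogeneous components of an element of `A`, reduced modulo `I`. -/
def quotDecomposeAux (I : HomogeneousIdeal 𝒜) : A →ₐ[R] ⨁ i, quotGrading I i :=
  (DirectSum.toAlgebra R (fun i => 𝒜 i)
    (fun i => (DirectSum.lof R ℕ (fun i => quotGrading I i) i).comp
      ((Ideal.Quotient.mkₐ R I.toIdeal).toLinearMap.restrict
        (p := 𝒜 i) (q := quotGrading I i) fun _ ha => mk_mem_quotGrading I ha))
    (by rfl)
    (by
      intro i j a b
      simp only [LinearMap.comp_apply, DirectSum.lof_eq_of, DirectSum.of_mul_of]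
      congr 1)).comp (DirectSum.decomposeAlgEquiv 𝒜).toAlgHom

theorem quotDecomposeAux_of_mem (I : HomogeneousIdeal 𝒜) {i : ℕ} {a : A} (ha : a ∈ 𝒜 i) :
    quotDecomposeAux I a =
      DirectSum.of (fun i => quotGrading I i) i ⟨_, mk_mem_quotGrading I ha⟩ := by
  have : DirectSum.decompose 𝒜 a = DirectSum.of (fun i => 𝒜 i) i ⟨a, ha⟩ :=
    DirectSum.decompose_of_mem 𝒜 ha
  simp only [quotDecomposeAux, AlgHom.comp_apply]
  erw [DirectSum.decomposeAlgEquiv_apply, this]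
  erw [DirectSum.toAlgebra_apply, DirectSum.toAddMonoid_of]
  rfl

open Classical in
theorem quotDecomposeAux_eq (I : HomogeneousIdeal 𝒜) (a : A) :
    quotDecomposeAux I a = ∑ i ∈ (DirectSum.decompose 𝒜 a).support,
      DirectSum.of (fun i => quotGrading I i) i
        ⟨_, mk_mem_quotGrading I (DirectSum.decompose 𝒜 a i).2⟩ := by
  conv_lhs => rw [← DirectSum.sum_support_decompose 𝒜 a, map_sum]
  exact Finset.sum_congr rfl fun i _ => quotDecomposeAux_of_mem I (DirectSum.decompose 𝒜 a i).2

open Classical in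
instance (I : HomogeneousIdeal 𝒜) : GradedAlgebra (quotGrading I) :=
  GradedAlgebra.ofAlgHom _
    (Ideal.Quotient.liftₐ I.toIdeal (quotDecomposeAux I) (by
      intro a ha
      rw [quotDecomposeAux_eq]
      refine Finset.sum_eq_zero fun i _ => ?_
      have h : Ideal.Quotient.mk I.toIdeal (DirectSum.decompose 𝒜 a i : A) = 0 :=
        Ideal.Quotient.eq_zero_iff_mem.mpr (I.is_homogeneous' i ha)
      have h' : (⟨_, mk_mem_quotGrading I (DirectSum.decompose 𝒜 a i).2⟩ : quotGrading I i) = 0 :=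
        Subtype.ext h
      rw [h', map_zero]))
    (by
      apply AlgHom.ext
      intro x
      obtain ⟨a, rfl⟩ := Ideal.Quotient.mk_surjective x
      change (DirectSum.coeAlgHom (quotGrading I)) (quotDecomposeAux I a) = _
      rw [quotDecomposeAux_eq, map_sum]
      conv_rhs => rw [← DirectSum.sum_support_decompose 𝒜 a]
      simp only [DirectSum.coeAlgHom_of, AlgHom.id_apply, map_sum])
    (by
      rintro i ⟨_, a, ha, rfl⟩
      exact quotDecomposeAux_of_mem I ha)

end Quotient

/-- The structure morphism of the projective scheme of a graded `ℂ`-algebra. -/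
def projStr {A : Type} [CommRing A] [Algebra ℂ A] (𝒜 : ℕ → Submodule ℂ A) [GradedAlgebra 𝒜] :
    Proj 𝒜 ⟶ Spec (.of ℂ) :=
  Proj.toSpecZero 𝒜 ≫ Spec.map (CommRingCat.ofHom (algebraMap ℂ (𝒜 0)))

/-- The homogeneous coordinate ring of projective `n`-space over `ℂ`, for `n + 1 = m`. -/
abbrev coordGrading (m : ℕ) : ℕ → Submodule ℂ (MvPolynomial (Fin m) ℂ) :=
  MvPolynomial.homogeneousSubmodule (Fin m) ℂ

instance (m : ℕ) : GradedAlgebra (coordGrading m) := MvPolynomial.gradedAlgebra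

open MvPolynomial in
/-- The conic `y₁ y₂ - y₀ ^ 2` in the first three of `m` homogeneous coordinates. -/
def conicPoly (m : ℕ) (h : 3 ≤ m) : MvPolynomial (Fin m) ℂ :=
  X (Fin.castLE h 1) * X (Fin.castLE h 2) - X (Fin.castLE h 0) ^ 2

open MvPolynomial in
/-- The quadric `y₃ y₄ - y₀ (y₁ - α y₂ + (α - 1) y₀)`. -/
def quadricPoly (α : ℝ) : MvPolynomial (Fin 5) ℂ :=
  X 3 * X 4 - X 0 * (X 1 - C (α : ℂ) * X 2 + C ((α : ℂ) - 1) * X 0)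

theorem conicPoly_isHomogeneous (m : ℕ) (h : 3 ≤ m) : (conicPoly m h).IsHomogeneous 2 :=
  ((MvPolynomial.isHomogeneous_X _ _).mul (MvPolynomial.isHomogeneous_X _ _)).sub
    ((MvPolynomial.isHomogeneous_X _ _).pow 2)

theorem quadricPoly_isHomogeneous (α : ℝ) : (quadricPoly α).IsHomogeneous 2 := by
  have hX : ∀ i : Fin 5, (MvPolynomial.X i : MvPolynomial (Fin 5) ℂ).IsHomogeneous 1 :=
    fun i => MvPolynomial.isHomogeneous_X _ i
  have hC : ∀ c : ℂ, (MvPolynomial.C c : MvPolynomial (Fin 5) ℂ).IsHomogeneous 0 :=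
    fun c => MvPolynomial.isHomogeneous_C _ c
  have h2 : (MvPolynomial.C (α : ℂ) * MvPolynomial.X 2 : MvPolynomial (Fin 5) ℂ).IsHomogeneous 1 :=
    (zero_add 1) ▸ (hC _).mul (hX 2)
  have h0 : (MvPolynomial.C ((α : ℂ) - 1) * MvPolynomial.X 0 :
      MvPolynomial (Fin 5) ℂ).IsHomogeneous 1 :=
    (zero_add 1) ▸ (hC _).mul (hX 0)
  exact ((hX 3).mul (hX 4)).sub ((hX 0).mul (((hX 1).sub h2).add h0))

/-- The homogeneous ideal of the conic in the plane. -/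
def conicIdeal : HomogeneousIdeal (coordGrading 3) where
  toSubmodule := Ideal.span {conicPoly 3 le_rfl}
  is_homogeneous' := Ideal.homogeneous_span _ _ (by
    rintro _ rfl
    exact ⟨2, conicPoly_isHomogeneous _ _⟩)

/-- The homogeneous ideal of the quartic surface in four-space. -/
def quarticIdeal (α : ℝ) : HomogeneousIdeal (coordGrading 5) where
  toSubmodule := Ideal.span {conicPoly 5 (by norm_num), quadricPoly α}
  is_homogeneous' := Ideal.homogeneous_span _ _ (by
    rintro _ (rfl | rfl)
    · exact ⟨2, conicPoly_isHomogeneous _ _⟩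
    · exact ⟨2, quadricPoly_isHomogeneous α⟩)

/-- The projective line over `ℂ`. -/
abbrev P1 : Scheme.{0} := Proj (coordGrading 2)

/-- The conic `Λ : y₁ y₂ = y₀ ^ 2` in the projective plane. -/
abbrev Conic : Scheme.{0} := Proj (quotGrading conicIdeal)

/-- The surface `T : y₁ y₂ = y₀ ^ 2, y₃ y₄ = y₀ (y₁ - α y₂ + (α - 1) y₀)` in projective
four-space. -/
abbrev Quartic (α : ℝ) : Scheme.{0} := Proj (quotGrading (quarticIdeal α))

/-- The structure morphism of `T`. -/
abbrev Quartic.str (α : ℝ) : Quartic α ⟶ Spec (.of ℂ) := projStr (quotGrading (quarticIdeal α))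

/-! ### The projection `(y₀ : y₁ : y₂ : y₃ : y₄) ↦ (y₀ : y₁ : y₂)` -/

/-- The inclusion of homogeneous coordinate rings `yᵢ ↦ yᵢ` for `i = 0, 1, 2`. -/
def coordHom (α : ℝ) : quotGrading conicIdeal →+*ᵍ quotGrading (quarticIdeal α) where
  __ := Ideal.quotientMap (quarticIdeal α).toIdeal
    (MvPolynomial.rename (R := ℂ) (Fin.castLE (show 3 ≤ 5 by norm_num))).toRingHom (by
      change Ideal.span _ ≤ _
      rw [Ideal.span_le, Set.singleton_subset_iff]
      refine Ideal.subset_span (Or.inl ?_)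
      simp [conicPoly])
  map_mem := by
    rintro i _ ⟨a, ha, rfl⟩
    exact mk_mem_quotGrading _ (MvPolynomial.IsHomogeneous.rename_isHomogeneous ha)

/-- The homogeneous coordinate `y₁` on the conic. -/
def conicY1 : MvPolynomial (Fin 3) ℂ ⧸ conicIdeal.toIdeal := Ideal.Quotient.mk _ (MvPolynomial.X 1)

theorem conicY1_mem : conicY1 ∈ quotGrading conicIdeal 1 :=
  mk_mem_quotGrading _ (MvPolynomial.isHomogeneous_X ℂ 1)

/-- The affine chart `y₁ ≠ 0` of `T`. -/
def chart (α : ℝ) : (Quartic α).Opens :=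
  Proj.basicOpen (quotGrading (quarticIdeal α)) (coordHom α conicY1)

/-- The projection `(y₀ : y₁ : y₂ : y₃ : y₄) ↦ (y₀ : y₁ : y₂)` on the chart `y₁ ≠ 0` of `T`. -/
def chartProj (α : ℝ) : (chart α).toScheme ⟶ Conic :=
  Proj.basicOpenToSpec (quotGrading (quarticIdeal α)) (coordHom α conicY1) ≫
    Spec.map (CommRingCat.ofHom (HomogeneousLocalization.Away.map (coordHom α) conicY1)) ≫
      Proj.awayι (quotGrading conicIdeal) conicY1 conicY1_mem one_pos

/-- The rational map `π : T ⤏ Λ` represented by `chartProj`. -/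
def ratProj (α : ℝ) (h : Dense (chart α : Set (Quartic α))) : Quartic α ⤏ Conic :=
  Scheme.PartialMap.toRationalMap ⟨chart α, h, chartProj α⟩

/-! ### Singularities and resolutions -/

/-- The set of points where a scheme over `ℂ` is not smooth. -/
def singularLocus {X : Scheme.{0}} (s : X ⟶ Spec (.of ℂ)) : Set X :=
  {x | ¬ ∃ U : X.Opens, x ∈ U ∧ Smooth (U.ι ≫ s)}

/-- A surface has an ordinary double point at `t` if its completed local ring there is isomorphic
to `ℂ⟦x, y, z⟧ / (x y - z ^ 2)`. -/
def IsOrdinaryDoublePoint {S : Scheme.{0}} (t : S) : Prop :=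
  Nonempty (AdicCompletion (IsLocalRing.maximalIdeal (S.presheaf.stalk t)) (S.presheaf.stalk t) ≃+*
    (MvPowerSeries (Fin 3) ℂ ⧸
      Ideal.span {(MvPowerSeries.X 0 * MvPowerSeries.X 1 - MvPowerSeries.X 2 ^ 2 :
        MvPowerSeries (Fin 3) ℂ)}))

/-- A resolution of singularities: a proper birational morphism from a smooth scheme. -/
structure IsResolution {T : Scheme.{0}} (s : T ⟶ Spec (.of ℂ)) {X : Scheme.{0}} (ρ : X ⟶ T) :
    Prop where
  smooth : Smooth (ρ ≫ s)
  proper : IsProper ρ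
  birational : ∃ V : T.Opens, Dense (V : Set T) ∧ Dense (ρ ⁻¹ᵁ V : Set X) ∧ IsIso (ρ ∣_ V)

/-- A minimal resolution: a resolution through which every resolution factors uniquely. -/
structure IsMinimalResolution {T : Scheme.{0}} (s : T ⟶ Spec (.of ℂ)) {X : Scheme.{0}}
    (ρ : X ⟶ T) : Prop extends IsResolution s ρ where
  factors : ∀ (Y : Scheme.{0}) (σ : Y ⟶ T), IsResolution s σ → ∃! h : Y ⟶ X, h ≫ ρ = σ

/-! ### Rational curves -/

/-- An irreducible smooth (complete) rational curve is a curve isomorphic to the projective line. -/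
def IsSmoothRationalCurve {C : Scheme.{0}} (s : C ⟶ Spec (.of ℂ)) : Prop :=
  ∃ e : C ≅ P1, e.hom ≫ projStr (coordGrading 2) = s

/-- A (complete, possibly singular) rational curve is an integral proper scheme birational to the
projective line. -/
structure IsRationalCurve {C : Scheme.{0}} (s : C ⟶ Spec (.of ℂ)) : Prop where
  integral : IsIntegral C
  proper : IsProper s
  birational : Scheme.BirationalOver s (projStr (coordGrading 2))

/-- A closed subset with its reduced induced scheme structure. -/
def reducedι {F : Scheme.{0}} (Z : TopologicalSpace.Closeds F) :
    (Scheme.IdealSheafData.vanishingIdeal Z).subscheme ⟶ F :=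
  (Scheme.IdealSheafData.vanishingIdeal Z).subschemeι

/-- A scheme over `ℂ` that is the union of two rational curves: it is reduced, it has exactly two
irreducible components, and both are rational curves. -/
structure IsPairOfRationalCurves {F : Scheme.{0}} (s : F ⟶ Spec (.of ℂ)) : Prop where
  reduced : IsReduced F
  ncard_components : (irreducibleComponents F).ncard = 2
  rational : ∀ Z : TopologicalSpace.Closeds F, (Z : Set F) ∈ irreducibleComponents F →
    IsRationalCurve (reducedι Z ≫ s)

/-- The fibre of `g : X ⟶ Y` over `y`, as a scheme over `ℂ` through `X`. -/
abbrev fiberStr {X Y : Scheme.{0}} (s : X ⟶ Spec (.of ℂ)) (g : X ⟶ Y) (y : Y) :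
    g.fiber y ⟶ Spec (.of ℂ) :=
  g.fiberι y ≫ s

/-- The closed points of `Y` over which the fibre of `g : X ⟶ Y` is not smooth. -/
def singularValues {X Y : Scheme.{0}} (s : X ⟶ Spec (.of ℂ)) (g : X ⟶ Y) : Set Y :=
  {y | IsClosed {y} ∧ ¬ Smooth (fiberStr s g y)}

end Minitwistor

end

open Minitwistor

/-! ### Fractions in a unique factorization domain -/

namespace Minitwistor

/-! Parametrize the conic by t = y₀/y₁ or t = y₀/y₂ and put p = y₃, q = y₄, normalized in the same
chart. Where y₁ ≠ 0 or y₂ ≠ 0 the quartic is the affine surface p q = h(t), with h = t(1 - t)(1 +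
αt) or h = t(t - 1)(t + α). For -1 < α < 0 these cubics have distinct roots, so both charts are
smooth (`Hyp.smooth`), and t extends π to them. The remaining points are (0:0:0:1:0) and
(0:0:0:0:1). Where y₃ or y₄ is invertible, the second equation eliminates the other one and leaves
the cone p q = t², where p, q, t now stand for y₁, y₂, y₀. Its vertex is an ordinary double point
(`Cone.nonempty_adicCompletion_equiv`), it is not smooth (`Cone.not_smooth`), and π does not extend
to it because neither t/p nor t/q is regular there (`Cone.no_fraction`).

The resolution is the closure of the graph of π in T × Λ, built as the scheme-theoretic image of the
generic point. It leaves the charts p q = h(t) unchanged and replaces each cone by two planes with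
coordinates (t, x), mapped to the cone by x·(t, 1, t²) and x·(t, t², 1) (`isModel_image`). All later
arguments use only these charts, collected in `IsModel`.

Minimality rests on factoriality. A resolution Y of T is locally étale over an affine space, which
is a plane because the function field is ℂ(t, p); hence its local rings at closed points are
factorial (`uniqueFactorizationMonoid_of_etale_plane`). Given x y = z² in such a ring, write z/x =
a/b in lowest terms. If neither a nor b were a unit, b² would divide x; but b has positive order
along the exceptional curve x = 0 of the (z/x, x)-plane, while x has order one. So z/x or x/z is
regular (`exists_mul_eq_of_uniqueFactorizationMonoid`), and Y lifts locally to one of the planes.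
Lifts are determined at the generic point, so they glue (`IsModel.existsUnique_lift`). Every minimal
resolution is therefore isomorphic to the model and inherits its morphism to Λ.

The fibre over t = c is the affine conic p q = h(c) completed by two lines with coordinates 1/p and
1/q (`IsModel.exists_isConicFibre`). It is a projective line if h(c) ≠ 0, and a pair of lines
meeting in a node if h(c) = 0. The zeros are t = 0, 1, -1/α and ∞. -/

open Polynomial in
-- Gauss's lemma: coprimality of a and b makes bX - a primitive, so its divisibility over the
-- fraction field descends to R.
theorem linear_dvd_of_aeval_div_eq_zero {R K : Type*} [CommRing R] [IsDomain R]
    [UniqueFactorizationMonoid R] [Field K] [Algebra R K] [IsFractionRing R K] {a b : R}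
    (hab : IsRelPrime a b) (hb : b ≠ 0) {P : R[X]}
    (h : aeval (algebraMap R K a / algebraMap R K b) P = 0) : C b * X - C a ∣ P := by
  have hb' : algebraMap R K b ≠ 0 := by
    simpa using hb
  have hprim : (C b * X - C a).IsPrimitive := by
    intro r hr
    rw [C_dvd_iff_dvd_coeff] at hr
    have h0 := hr 0
    have h1 := hr 1
    simp at h0 h1
    exact hab h0 h1
  apply hprim.dvd_of_fraction_map_dvd_fraction_map (K := K)
  have h1 : (C b * X - C a).map (algebraMap R K) =
      C (algebraMap R K b) * (X - C (algebraMap R K a / algebraMap R K b)) := by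
    simp only [Polynomial.map_sub, Polynomial.map_mul, map_C, map_X, mul_sub, ← C_mul]
    rw [mul_div_cancel₀ _ hb']
  rw [h1, (isUnit_C.mpr hb'.isUnit).mul_left_dvd, dvd_iff_isRoot, IsRoot, eval_map_algebraMap, h]

/-! ### Factoriality of two-dimensional regular local rings -/

/-- A Noetherian local domain of dimension two whose maximal ideal has two generators. -/
theorem mem_span_or_exists_unit_mul_pow {O : Type*} [CommRing O] [IsNoetherianRing O]
    [IsLocalRing O] {u v : O} (hm : IsLocalRing.maximalIdeal O = Ideal.span {u, v}) (a : O) :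
    a ∈ Ideal.span {u} ∨ ∃ (k : ℕ) (e : O), IsUnit e ∧ a - e * v ^ k ∈ Ideal.span {u} := by
  classical
  -- The v-adic order of a modulo u: the least k that fails gives the order k - 1, and if no k fails
  -- then a vanishes modulo u.
  by_cases ha : ∃ k, a ∉ Ideal.span {u} ⊔ Ideal.span {v ^ k}
  · right
    let k := Nat.find ha
    have hk : a ∉ Ideal.span {u} ⊔ Ideal.span {v ^ k} := Nat.find_spec ha
    have hk0 : k ≠ 0 := by
      intro h
      apply hk
      rw [h, pow_zero, Ideal.span_singleton_one, sup_top_eq]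
      trivial
    obtain ⟨l, hl⟩ := Nat.exists_eq_succ_of_ne_zero hk0
    have hal : a ∈ Ideal.span {u} ⊔ Ideal.span {v ^ l} := by
      by_contra h
      exact Nat.find_min ha (m := l) (by change l < k; omega) h
    obtain ⟨x, hx, y, hy, rfl⟩ := Submodule.mem_sup.mp hal
    obtain ⟨e, rfl⟩ := Ideal.mem_span_singleton'.mp hy
    refine ⟨l, e, ?_, by simpa using hx⟩
    -- A nonunit e is a combination of u and v, which would put a into (u) + (v^k), against the
    -- choice of k.
    by_contra he
    have he' : e ∈ IsLocalRing.maximalIdeal O := he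
    rw [hm, Ideal.mem_span_pair] at he'
    obtain ⟨r, s, rfl⟩ := he'
    apply hk
    rw [hl, Submodule.mem_sup]
    refine ⟨x + r * u * v ^ l, ?_, s * v ^ (l + 1), ?_, by ring⟩
    · refine add_mem hx ?_
      rw [Ideal.mem_span_singleton]
      exact ⟨r * v ^ l, by ring⟩
    · exact Ideal.mul_mem_left _ _ (Ideal.mem_span_singleton_self _)
  · left
    push Not at ha
    by_contra hau
    have hu : u ∈ IsLocalRing.maximalIdeal O := hm ▸ Ideal.subset_span (by simp)
    have hv : v ∈ IsLocalRing.maximalIdeal O := hm ▸ Ideal.subset_span (by simp)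
    have hne : Ideal.span {u} ≠ ⊤ := fun h => by
      have := (Ideal.span_singleton_le_iff_mem _).mpr hu
      rw [h] at this
      exact IsLocalRing.maximalIdeal.isMaximal O |>.ne_top (top_le_iff.mp this)
    have : Nontrivial (O ⧸ Ideal.span {u}) := Ideal.Quotient.nontrivial_iff.mpr hne
    have : IsLocalRing (O ⧸ Ideal.span {u}) :=
      .of_surjective' (Ideal.Quotient.mk (Ideal.span {u})) Ideal.Quotient.mk_surjective
    have hvn : Ideal.span {Ideal.Quotient.mk (Ideal.span {u}) v} ≠ ⊤ := by
      rw [Ne, Ideal.span_singleton_eq_top]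
      intro h
      obtain ⟨w, hw⟩ := isUnit_iff_exists_inv.mp h
      obtain ⟨w, rfl⟩ := Ideal.Quotient.mk_surjective w
      rw [← map_mul, ← map_one (Ideal.Quotient.mk (Ideal.span {u})), Ideal.Quotient.eq] at hw
      have h1 : v * w - 1 ∈ IsLocalRing.maximalIdeal O :=
        (Ideal.span_singleton_le_iff_mem _).mpr hu hw
      have h2 := sub_mem (Ideal.mul_mem_right w _ hv) h1
      simp at h2
    -- Krull's intersection theorem in O/(u).
    have hinf := Ideal.iInf_pow_eq_bot_of_isLocalRing _ hvn
    apply hau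
    rw [← Ideal.Quotient.eq_zero_iff_mem, ← Ideal.mem_bot, ← hinf, Submodule.mem_iInf]
    intro k
    obtain ⟨x, hx, y, hy, hxy⟩ := Submodule.mem_sup.mp (ha k)
    rw [← hxy, map_add, Ideal.Quotient.eq_zero_iff_mem.mpr hx, zero_add, Ideal.span_singleton_pow,
      Ideal.mem_span_singleton, ← map_pow]
    exact map_dvd _ (Ideal.mem_span_singleton.mp hy)

/-- Modulo u the ring is like a discrete valuation ring with uniformizer v. By Kaplansky's criterion
every nonzero prime q must contain a prime element. If u ∈ q, take u. Otherwise let b ∈ q have least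
v-order modulo u; then q = (b) + uq because u ∉ q, and Nakayama gives q = (b). -/
theorem uniqueFactorizationMonoid_of_maximalIdeal_eq_span_pair {O : Type*} [CommRing O]
    [IsDomain O] [IsNoetherianRing O] [IsLocalRing O] {u v : O}
    (hm : IsLocalRing.maximalIdeal O = Ideal.span {u, v})
    (huv : ∀ n, v ^ n ∉ Ideal.span {u}) (hu0 : u ≠ 0) : UniqueFactorizationMonoid O := by
  have hu : u ∈ IsLocalRing.maximalIdeal O := hm ▸ Ideal.subset_span (by simp)
  have hunit : ∀ {e : O} {k : ℕ}, IsUnit e → e * v ^ k ∉ Ideal.span {u} := by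
    intro e k he h
    exact huv k ((Ideal.unit_mul_mem_iff_mem _ he).mp h)
  have hup : Prime u := by
    rw [← Ideal.span_singleton_prime hu0]
    refine ⟨fun h => huv 0 (h ▸ Submodule.mem_top), ?_⟩
    intro a b hab
    by_contra! h
    obtain ⟨k, e, he, hk⟩ := (mem_span_or_exists_unit_mul_pow hm a).resolve_left h.1
    obtain ⟨l, f, hf, hl⟩ := (mem_span_or_exists_unit_mul_pow hm b).resolve_left h.2
    apply hunit (k := k + l) (he.mul hf)
    have : e * f * v ^ (k + l) = a * b - (a - e * v ^ k) * b - e * v ^ k * (b - f * v ^ l) := by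
      ring
    rw [this]
    exact sub_mem (sub_mem hab (Ideal.mul_mem_right _ _ hk)) (Ideal.mul_mem_left _ _ hl)
  rw [UniqueFactorizationMonoid.iff_exists_prime_mem_of_isPrime]
  intro q hq0 hq
  by_cases huq : u ∈ q
  · exact ⟨u, huq, hup⟩
  classical
  have hex : ∃ k : ℕ, ∃ b ∈ q, ∃ e : O, IsUnit e ∧ b - e * v ^ k ∈ Ideal.span {u} := by
    by_contra! h
    -- If every element of q were divisible by u, the quotients would again lie in q, and Nakayama
    -- would force q = 0.
    have hle : q ≤ IsLocalRing.maximalIdeal O • q := by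
      intro a ha
      rcases mem_span_or_exists_unit_mul_pow hm a with h' | ⟨k, e, he, hk⟩
      · obtain ⟨c, rfl⟩ := Ideal.mem_span_singleton'.mp h'
        rw [mul_comm]
        exact Submodule.smul_mem_smul hu ((hq.mem_or_mem ha).resolve_right huq)
      · exact (h k a ha e he hk).elim
    exact hq0 (Submodule.eq_bot_of_le_smul_of_le_jacobson_bot _ q (IsNoetherian.noetherian q) hle
      (IsLocalRing.maximalIdeal_le_jacobson _))
  obtain ⟨b, hbq, e, he, hbe⟩ := Nat.find_spec hex
  set k := Nat.find hex
  have hqb : q = Ideal.span {b} := by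
    refine le_antisymm ?_ ((Ideal.span_singleton_le_iff_mem _).mpr hbq)
    refine Submodule.le_of_le_smul_of_le_jacobson_bot (I := IsLocalRing.maximalIdeal O)
      (IsNoetherian.noetherian q) (IsLocalRing.maximalIdeal_le_jacobson _) ?_
    intro a ha
    have key : ∃ c, a - c * b ∈ Ideal.span {u} := by
      rcases mem_span_or_exists_unit_mul_pow hm a with h' | ⟨l, f, hf, hl⟩
      · exact ⟨0, by simpa using h'⟩
      · have hkl : k ≤ l := Nat.find_min' hex ⟨a, ha, f, hf, hl⟩
        obtain ⟨e', he'⟩ := isUnit_iff_exists_inv.mp he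
        obtain ⟨j, rfl⟩ := Nat.exists_eq_add_of_le hkl
        refine ⟨f * e' * v ^ j, ?_⟩
        have : a - f * e' * v ^ j * b =
            (a - f * v ^ (k + j)) - f * e' * v ^ j * (b - e * v ^ k) +
              f * v ^ (k + j) * (1 - e * e') := by ring
        rw [this, he', sub_self, mul_zero, add_zero]
        exact sub_mem hl (Ideal.mul_mem_left _ _ hbe)
    obtain ⟨c, hc⟩ := key
    obtain ⟨d, hd⟩ := Ideal.mem_span_singleton'.mp hc
    have hdq : d ∈ q := by
      have : d * u ∈ q := hd ▸ sub_mem ha (Ideal.mul_mem_left _ _ hbq)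
      exact (hq.mem_or_mem this).resolve_right huq
    have : a = c * b + u * d := by rw [mul_comm u, hd]; ring
    rw [this]
    exact Submodule.add_mem_sup (Ideal.mem_span_singleton'.mpr ⟨c, rfl⟩)
      (Submodule.smul_mem_smul hu hdq)
  refine ⟨b, hbq, ?_⟩
  have hb0 : b ≠ 0 := by
    rintro rfl
    exact hq0 (by simpa using hqb)
  rw [← Ideal.span_singleton_prime hb0, ← hqb]
  exact hq

end Minitwistor

/-! ### Étale algebras over the plane -/

namespace Minitwistor

/-- The coordinate ring of the affine plane. -/
abbrev Plane : Type := MvPolynomial (Fin 2) ℂ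

/-- Bounds the kernel of an evaluation map: σ need only invert φ modulo I. -/
theorem ker_le_of_section {A B : Type*} [CommRing A] [CommRing B] {φ : A →+* B} (σ : B →+* A)
    {I : Ideal A} (h : ((Ideal.Quotient.mk I).comp σ).comp φ = Ideal.Quotient.mk I) :
    RingHom.ker φ ≤ I := by
  intro a ha
  rw [← Ideal.Quotient.eq_zero_iff_mem, ← h, RingHom.comp_apply, RingHom.mem_ker.mp ha, map_zero]

section Etale

variable {B : Type*} [CommRing B] [IsDomain B] [Algebra ℂ B] [Algebra Plane B]
  [IsScalarTower ℂ Plane B]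

open MvPolynomial in
theorem sub_C_eval_mem_span (a : Fin 2 → ℂ) (P : Plane) :
    P - C (eval a P) ∈ Ideal.span {X 0 - C (a 0), X 1 - C (a 1)} := by
  rw [← Ideal.Quotient.eq]
  have : (Ideal.Quotient.mk (Ideal.span {X 0 - C (a 0), X 1 - C (a 1)} : Ideal Plane)) =
      ((Ideal.Quotient.mk _).comp C).comp (eval a) := by
    refine MvPolynomial.ringHom_ext (fun r => by simp) fun i => ?_
    simp only [RingHom.comp_apply, eval_X, Ideal.Quotient.eq]
    fin_cases i <;> exact Ideal.subset_span (by simp)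
  exact DFunLike.congr_fun this P

open MvPolynomial in
-- The point of the plane below q has an ideal generated by two shifted coordinates. Unramifiedness
-- turns them into generators u, v of the maximal ideal of the local ring at q, and faithful
-- flatness reduces the condition that no power of v lies in (u) to the plane itself.
theorem uniqueFactorizationMonoid_of_etale_plane [Algebra.Etale Plane B] (q : Ideal B)
    [hq : q.IsMaximal] : UniqueFactorizationMonoid (Localization.AtPrime q) := by
  have : Algebra.FiniteType ℂ B := .trans (inferInstance : Algebra.FiniteType ℂ Plane) inferInstance
  have : IsNoetherianRing B := Algebra.FiniteType.isNoetherianRing ℂ B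
  have : IsNoetherianRing (Localization.AtPrime q) :=
    IsLocalization.isNoetherianRing q.primeCompl _ inferInstance
  let : Field (B ⧸ q) := Ideal.Quotient.field q
  have : Module.Finite ℂ (B ⧸ q) := finite_of_finite_type_of_isJacobsonRing ℂ (B ⧸ q)
  have hbij := IsAlgClosed.algebraMap_bijective_of_isIntegral (k := ℂ) (K := B ⧸ q)
  -- Nullstellensatz: the residue field at q is ℂ.
  have hex : ∀ b : B, ∃ c : ℂ, b - algebraMap ℂ B c ∈ q := fun b => by
    obtain ⟨c, hc⟩ := hbij.2 (Ideal.Quotient.mk q b)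
    exact ⟨c, Ideal.Quotient.eq.mp hc.symm⟩
  choose a ha using fun i : Fin 2 => hex (algebraMap Plane B (X i))
  have ha' : ∀ i, (X i - C (a i) : Plane) ∈ q.under Plane := fun i => by
    rw [Ideal.under, Ideal.mem_comap, map_sub]
    convert ha i using 2
    exact (IsScalarTower.algebraMap_apply ℂ Plane B (a i)).symm
  have hp : q.under Plane = Ideal.span {X 0 - C (a 0), X 1 - C (a 1)} := by
    refine le_antisymm (fun P hP => ?_) (Ideal.span_le.mpr ?_)
    · have h1 := sub_C_eval_mem_span a P
      have h2 : (C (eval a P) : Plane) ∈ q.under Plane := by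
        have := sub_mem hP (show P - C (eval a P) ∈ q.under Plane from
          (Ideal.span_le.mpr (by rintro _ (rfl | rfl); exacts [ha' 0, ha' 1])) h1)
        simpa using this
      have h3 : eval a P = 0 := by
        by_contra h
        exact (inferInstance : (q.under Plane).IsPrime).ne_top
          (Ideal.eq_top_of_isUnit_mem _ h2 ((isUnit_iff_ne_zero.mpr h).map C))
      simpa [h3] using h1
    · rintro _ (rfl | rfl)
      exacts [ha' 0, ha' 1]
  let : Algebra (Localization.AtPrime (q.under Plane)) (Localization.AtPrime q) :=
    Localization.AtPrime.algebraOfLiesOver (q.under Plane) q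
  have hm := ((Algebra.isUnramifiedAt_iff_map_eq Plane (q.under Plane) q).mp inferInstance).2
  set u := algebraMap Plane (Localization.AtPrime q) (X 0 - C (a 0)) with hu
  set v := algebraMap Plane (Localization.AtPrime q) (X 1 - C (a 1)) with hv
  have hm' : IsLocalRing.maximalIdeal (Localization.AtPrime q) = Ideal.span {u, v} := by
    rw [← hm, hp, Ideal.map_span, Set.image_pair]
  have hloc : IsLocalHom (algebraMap (Localization.AtPrime (q.under Plane))
      (Localization.AtPrime q)) := by
    rw [Localization.AtPrime.IsLiesOverAlgebra.algebraMap_eq (p := q.under Plane) (P := q)]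
    infer_instance
  have : Module.FaithfullyFlat (Localization.AtPrime (q.under Plane)) (Localization.AtPrime q) :=
    Module.FaithfullyFlat.of_flat_of_isLocalHom
  have htow : ∀ P : Plane, algebraMap Plane (Localization.AtPrime q) P =
      algebraMap (Localization.AtPrime (q.under Plane)) _ (algebraMap Plane _ P) :=
    fun P => IsScalarTower.algebraMap_apply _ _ _ P
  have huv : ∀ n, v ^ n ∉ Ideal.span {u} := by
    intro n h
    rw [hv, hu, htow, htow, ← map_pow, ← Set.image_singleton, ← Ideal.map_span, ← Ideal.mem_comap,
      Ideal.comap_map_eq_self_of_faithfullyFlat, Ideal.mem_span_singleton', ← map_pow] at h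
    obtain ⟨w, hw⟩ := h
    obtain ⟨⟨r, s⟩, hrs⟩ := IsLocalization.surj (q.under Plane).primeCompl w
    have h2 : r * (X 0 - C (a 0)) = (X 1 - C (a 1)) ^ n * (s : Plane) := by
      apply IsLocalization.injective (Localization.AtPrime (q.under Plane))
        (Ideal.primeCompl_le_nonZeroDivisors (q.under Plane))
      rw [map_mul, map_mul, ← hrs, ← hw]
      ring
    -- On the line X₀ = a₀ the left side vanishes but the power of X₁ - a₁ does not, so the
    -- denominator s vanishes on the whole line, in particular at the point a, where it must be
    -- invertible.
    have h3 := congr_arg (aeval (R := ℂ) ![Polynomial.C (a 0), Polynomial.X]) h2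
    simp only [map_mul, map_sub, aeval_X, map_pow] at h3
    simp only [Matrix.cons_val_zero, Matrix.cons_val_one, algHom_C, Polynomial.algebraMap_apply,
      Algebra.algebraMap_self, RingHom.id_apply, sub_self, mul_zero] at h3
    have h4 : aeval (R := ℂ) ![Polynomial.C (a 0), Polynomial.X] (s : Plane) = 0 :=
      (mul_eq_zero.mp h3.symm).resolve_left (pow_ne_zero _ (Polynomial.X_sub_C_ne_zero _))
    apply s.2
    have h5 : eval a (s : Plane) = 0 := by
      have : eval a (s : Plane) = Polynomial.eval (a 1)
          (aeval (R := ℂ) ![Polynomial.C (a 0), Polynomial.X] (s : Plane)) := by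
        have : eval a = (Polynomial.evalRingHom (a 1)).comp
            (aeval (R := ℂ) ![Polynomial.C (a 0), Polynomial.X]).toRingHom := by
          refine MvPolynomial.ringHom_ext (fun r => by simp) fun i => ?_
          fin_cases i <;> simp
        exact DFunLike.congr_fun this (s : Plane)
      rw [this, h4, Polynomial.eval_zero]
    refine hp.ge ?_
    simpa [h5] using sub_C_eval_mem_span a (s : Plane)
  refine uniqueFactorizationMonoid_of_maximalIdeal_eq_span_pair hm' huv ?_
  have h0 : (X 0 - C (a 0) : Plane) ≠ 0 := fun h => by
    simpa using congr_arg (eval fun _ => a 0 + 1) h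
  have hinj : Function.Injective (algebraMap (Localization.AtPrime (q.under Plane))
      (Localization.AtPrime q)) := FaithfulSMul.algebraMap_injective _ _
  rw [hu, htow, Ne, map_eq_zero_iff _ hinj, IsLocalization.to_map_eq_zero_iff _
    (Ideal.primeCompl_le_nonZeroDivisors (q.under Plane))]
  exact h0

end Etale

open TensorProduct in
/-- A variety with the function field of the plane is étale only over affine planes. -/
theorem eq_two_of_etale_of_isFractionRing {n : ℕ} {B K : Type} [CommRing B] [Field K]
    [Algebra ℂ K] [Algebra (MvPolynomial (Fin n) ℂ) B] [Algebra B K]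
    [Algebra.FormallyEtale (MvPolynomial (Fin n) ℂ) B] [IsFractionRing B K]
    [Algebra (MvPolynomial (Fin n) ℂ) K] [IsScalarTower (MvPolynomial (Fin n) ℂ) B K]
    [IsScalarTower ℂ (MvPolynomial (Fin n) ℂ) K]
    [Algebra Plane K] [IsFractionRing Plane K] [IsScalarTower ℂ Plane K] : n = 2 := by
  have : Algebra.FormallyEtale B K := .of_isLocalization (nonZeroDivisors B)
  have : Algebra.FormallyEtale (MvPolynomial (Fin n) ℂ) K := .comp _ B _
  have : Algebra.FormallyEtale Plane K := .of_isLocalization (nonZeroDivisors Plane)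
  -- K is formally étale over both polynomial rings, so the dimension of its differentials over ℂ is
  -- both n and 2.
  have e1 := KaehlerDifferential.tensorKaehlerEquivOfFormallyEtale ℂ (MvPolynomial (Fin n) ℂ) K
  have e2 := KaehlerDifferential.tensorKaehlerEquivOfFormallyEtale ℂ Plane K
  have h1 := (e1.trans e2.symm).finrank_eq
  rw [Module.finrank_baseChange, Module.finrank_baseChange,
    Module.finrank_eq_card_basis (KaehlerDifferential.mvPolynomialBasis ℂ (Fin n)),
    Module.finrank_eq_card_basis (KaehlerDifferential.mvPolynomialBasis ℂ (Fin 2))] at h1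
  simpa using h1

open TensorProduct in
-- Flatness embeds B into its base change to the fraction field of A, and an unramified algebra over
-- a field is reduced.
theorem isReduced_of_etale {A B : Type} [CommRing A] [IsDomain A] [CommRing B] [Algebra A B]
    [Algebra.Etale A B] : IsReduced B := by
  have : IsReduced (FractionRing A ⊗[A] B) :=
    Algebra.FormallyUnramified.isReduced_of_field (FractionRing A) _
  refine isReduced_of_injective (Algebra.TensorProduct.includeRight : B →ₐ[A] FractionRing A ⊗[A] B)
    ?_
  exact Algebra.TensorProduct.includeRight_injective (IsFractionRing.injective A (FractionRing A))

/-! ### Uniqueness of the small resolution direction -/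

open MvPolynomial in
/-- Restriction of a polynomial to the first coordinate axis. -/
noncomputable def axisHom : Plane →ₐ[ℂ] Polynomial ℂ := aeval ![Polynomial.X, 0]

open MvPolynomial in
theorem dvd_of_axisHom_eq_zero {P : Plane} (h : axisHom P = 0) : X 1 ∣ P := by
  rw [← Ideal.mem_span_singleton]
  refine ker_le_of_section (φ := axisHom.toRingHom)
    (Polynomial.aeval (X 0 : Plane)).toRingHom ?_ h
  refine MvPolynomial.ringHom_ext (fun r => by simp [axisHom]) fun i => ?_
  fin_cases i
  · simp [axisHom]
  · have : (Ideal.Quotient.mk (Ideal.span {(X 1 : Plane)})) (X 1) = 0 :=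
      Ideal.Quotient.eq_zero_iff_mem.mpr (Ideal.mem_span_singleton_self _)
    simp [axisHom, this]

open MvPolynomial in
/-- Let `x y = z ^ 2` in a factorial local ring `O` whose fraction field is the field of rational
functions in `x` and `z / x`. Then `z / x` or its inverse lies in `O`. -/
theorem exists_mul_eq_of_uniqueFactorizationMonoid {O K : Type*} [CommRing O] [IsDomain O]
    [IsLocalRing O] [UniqueFactorizationMonoid O] [Algebra ℂ O] [Field K] [Algebra O K]
    [IsFractionRing O K] [Algebra ℂ K] [IsScalarTower ℂ O K] {x y z : O} (hxyz : x * y = z ^ 2)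
    (hx0 : x ≠ 0) {τ : K} (hτ : algebraMap O K x * τ = algebraMap O K z)
    (hinj : Function.Injective (aeval ![τ, algebraMap O K x] : Plane →ₐ[ℂ] K))
    (hgen : ∀ k : K, ∃ P Q : Plane, Q ≠ 0 ∧
      k * aeval ![τ, algebraMap O K x] Q = aeval ![τ, algebraMap O K x] P) :
    (∃ t, x * t = z ∧ z * t = y) ∨ ∃ s, y * s = z ∧ z * s = x := by
  obtain ⟨a, b, hab, hτab⟩ := IsFractionRing.exists_reduced_fraction O τ
  have hKinj := IsFractionRing.injective O K
  have hb0 : (b : O) ≠ 0 := nonZeroDivisors.ne_zero b.2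
  have hτ' : τ = algebraMap O K a / algebraMap O K b := by
    rw [← hτab, IsFractionRing.mk'_eq_div]
  have hbK : algebraMap O K b ≠ 0 := by simp [hb0]
  have hxb : x * a = z * b := by
    apply hKinj
    rw [map_mul, map_mul, ← hτ, hτ']
    field_simp
  by_cases hbu : IsUnit (b : O)
  · left
    obtain ⟨c, hc⟩ := isUnit_iff_exists_inv.mp hbu
    have h1 : x * (a * c) = z := by rw [← mul_assoc, hxb, mul_assoc, hc, mul_one]
    refine ⟨a * c, h1, mul_left_cancel₀ hx0 ?_⟩
    rw [hxyz, mul_left_comm, h1, sq]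
  by_cases hau : IsUnit a
  · right
    obtain ⟨c, hc⟩ := isUnit_iff_exists_inv.mp hau
    have h1 : z * (b * c) = x := by rw [← mul_assoc, ← hxb, mul_assoc, hc, mul_one]
    refine ⟨b * c, mul_left_cancel₀ hx0 ?_, h1⟩
    rw [← mul_assoc, hxyz, sq, mul_assoc, h1, mul_comm]
  -- Now a and b both lie in the maximal ideal. The contradiction comes from the order along x = 0
  -- in the (τ, x)-plane: x has order one, yet x = b²g where b has positive and g nonnegative order.
  exfalso
  have ham : IsLocalRing.residue O a = 0 := by
    rwa [IsLocalRing.residue_eq_zero_iff]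
  have hbm : IsLocalRing.residue O b = 0 := by
    rwa [IsLocalRing.residue_eq_zero_iff]
  have hbx : (b : O) ^ 2 ∣ x := by
    have h1 : x * a ^ 2 = y * (b : O) ^ 2 := by
      apply mul_left_cancel₀ hx0
      calc x * (x * a ^ 2) = (x * a) ^ 2 := by ring
        _ = z ^ 2 * (b : O) ^ 2 := by rw [hxb]; ring
        _ = x * (y * (b : O) ^ 2) := by rw [← hxyz]; ring
    exact (hab.symm.pow (m := 2) (n := 2)).dvd_of_dvd_mul_right ⟨y, by rw [h1]; ring⟩
  obtain ⟨g, hg⟩ := hbx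
  have hxm : IsLocalRing.residue O x = 0 := by rw [hg, map_mul, map_pow, hbm]; ring
  let ev : Plane →ₐ[ℂ] Polynomial O := aeval ![Polynomial.X, Polynomial.C x]
  have hev : ∀ P, Polynomial.aeval τ (ev P) = aeval ![τ, algebraMap O K x] P := by
    intro P
    have : ((Polynomial.aeval τ : Polynomial O →ₐ[O] K).restrictScalars ℂ).comp ev =
        aeval ![τ, algebraMap O K x] := by
      apply MvPolynomial.algHom_ext
      intro i
      fin_cases i <;> simp [ev]
    exact DFunLike.congr_fun this P
  let res : Polynomial O →+* Polynomial (IsLocalRing.ResidueField O) :=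
    Polynomial.mapRingHom (IsLocalRing.residue O)
  have hres : ∀ P, res (ev P) =
      (axisHom P).map ((IsLocalRing.residue O).comp (algebraMap ℂ O)) := by
    intro P
    have : res.comp ev.toRingHom = (Polynomial.mapRingHom
        ((IsLocalRing.residue O).comp (algebraMap ℂ O))).comp axisHom.toRingHom := by
      refine MvPolynomial.ringHom_ext (fun r => ?_) fun i => ?_
      · simp [ev, res, axisHom, Polynomial.algebraMap_apply]
      · fin_cases i <;> simp [ev, res, axisHom, hxm]
    exact DFunLike.congr_fun this P
  -- A relation satisfied by τ over O is divisible by bX - a, both of whose coefficients vanish in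
  -- the residue field.
  have hvan : ∀ P : Polynomial O, Polynomial.aeval τ P = 0 → res P = 0 := by
    intro P hP
    rw [hτ'] at hP
    obtain ⟨R, rfl⟩ := linear_dvd_of_aeval_div_eq_zero hab hb0 hP
    rw [map_mul]
    simp [res, ham, hbm]
  have haxis : ∀ P : Plane, res (ev P) = 0 → axisHom P = 0 := by
    intro P hP
    rw [hres] at hP
    exact (Polynomial.map_eq_zero _).mp hP
  -- every element of `O` has nonnegative order along the axis
  have hord : ∀ u : O, ∃ P Q : Plane, axisHom Q ≠ 0 ∧
      algebraMap O K u * aeval ![τ, algebraMap O K x] Q = aeval ![τ, algebraMap O K x] P := by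
    intro u
    obtain ⟨P, Q, hQ, h⟩ := hgen (algebraMap O K u)
    -- If the denominator is divisible by X₁, reducing the relation u·Q = P modulo the maximal ideal
    -- shows that the numerator is too; cancelling x lowers the degree of Q.
    have main : ∀ (n : ℕ) (P Q : Plane), Q.totalDegree ≤ n → Q ≠ 0 →
        algebraMap O K u * aeval ![τ, algebraMap O K x] Q = aeval ![τ, algebraMap O K x] P →
        ∃ P Q : Plane, axisHom Q ≠ 0 ∧
          algebraMap O K u * aeval ![τ, algebraMap O K x] Q =
            aeval ![τ, algebraMap O K x] P := by
      intro n
      induction n with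
      | zero =>
        intro P Q hn hQ h
        refine ⟨P, Q, fun h0 => ?_, h⟩
        obtain ⟨Q', rfl⟩ := dvd_of_axisHom_eq_zero h0
        rw [totalDegree_mul_of_isDomain (X_ne_zero _) (right_ne_zero_of_mul hQ), totalDegree_X] at hn
        omega
      | succ n ih =>
        intro P Q hn hQ h
        by_cases h0 : axisHom Q = 0
        · obtain ⟨Q', rfl⟩ := dvd_of_axisHom_eq_zero h0
          have hP : axisHom P = 0 := by
            apply haxis
            have := hvan (Polynomial.C u * ev (X 1 * Q') - ev P) (by
              rw [map_sub, map_mul, Polynomial.aeval_C, hev, hev, h, sub_self])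
            rw [map_sub, map_mul, hres, h0, Polynomial.map_zero, mul_zero, zero_sub,
              neg_eq_zero] at this
            exact this
          obtain ⟨P', rfl⟩ := dvd_of_axisHom_eq_zero hP
          refine ih P' Q' ?_ (right_ne_zero_of_mul hQ) ?_
          · rw [totalDegree_mul_of_isDomain (X_ne_zero _) (right_ne_zero_of_mul hQ),
              totalDegree_X] at hn
            omega
          · have hx : algebraMap O K x ≠ 0 := by simpa using hx0
            simp only [map_mul, aeval_X, Matrix.cons_val_one] at h
            apply mul_left_cancel₀ hx
            rw [mul_left_comm]
            exact h
        · exact ⟨P, Q, h0, h⟩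
    exact main _ P Q le_rfl hQ h
  obtain ⟨P₁, Q₁, hQ₁, h₁⟩ := hord g
  obtain ⟨P₂, Q₂, hQ₂, h₂⟩ := hord b
  -- Since b is zero in the residue field, its numerator vanishes on the axis.
  have hP₂ : axisHom P₂ = 0 := by
    apply haxis
    have := hvan (Polynomial.C (b : O) * ev Q₂ - ev P₂) (by
      rw [map_sub, map_mul, Polynomial.aeval_C, hev, hev, h₂, sub_self])
    have hb : res (Polynomial.C (b : O)) = 0 := by simp [res, hbm]
    rwa [map_sub, map_mul, hb, zero_mul, zero_sub, neg_eq_zero] at this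
  obtain ⟨P₃, rfl⟩ := dvd_of_axisHom_eq_zero hP₂
  -- The identity x = b²g with denominators cleared and one factor x cancelled. On the axis the
  -- right side vanishes while Q₁ and Q₂ do not.
  have hfin : Q₁ * Q₂ ^ 2 = X 1 * (P₁ * P₃ ^ 2) := by
    apply hinj
    have hx : algebraMap O K x ≠ 0 := by simpa using hx0
    apply mul_left_cancel₀ hx
    simp only [map_mul, map_pow, aeval_X, Matrix.cons_val_one] at h₁ h₂ ⊢
    simp only [Matrix.cons_val_fin_one] at h₁ h₂ ⊢
    have hgK : algebraMap O K x = algebraMap O K b ^ 2 * algebraMap O K g := by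
      rw [hg, map_mul, map_pow]
    calc algebraMap O K x * _ = (algebraMap O K g * aeval ![τ, algebraMap O K x] Q₁) *
          (algebraMap O K b * aeval ![τ, algebraMap O K x] Q₂) ^ 2 := by
            nth_rewrite 1 [hgK]; ring
      _ = _ := by rw [h₁, h₂]; ring
  have := congr_arg axisHom hfin
  simp [axisHom] at this
  exact (this.elim hQ₁ hQ₂)

end Minitwistor

namespace Minitwistor

/-! ### Points of projective schemes given by homogeneous coordinates -/

section ProjPoint

variable {A : Type} [CommRing A] [Algebra ℂ A] (𝒜 : ℕ → Submodule ℂ A) [GradedAlgebra 𝒜]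
  {B : Type} [CommRing B] [Algebra ℂ B] {B' : Type} [CommRing B'] [Algebra ℂ B']

/-- The evaluation of degree zero fractions under a homomorphism inverting the denominator. -/
noncomputable def awayEval (ψ : A →ₐ[ℂ] B) {f : A} (hu : IsUnit (ψ f)) :
    HomogeneousLocalization.Away 𝒜 f →+* B :=
  (IsLocalization.Away.lift (S := Localization.Away f) (g := ψ.toRingHom) f hu).comp
    (algebraMap (HomogeneousLocalization.Away 𝒜 f) (Localization.Away f))

/-- The point of `Proj 𝒜` with values in `B` given by a homomorphism `ψ` for which `ψ f` is
invertible. -/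
noncomputable def projPt (ψ : A →ₐ[ℂ] B) {f : A} {d : ℕ} (hf : f ∈ 𝒜 d) (hd : 0 < d)
    (hu : IsUnit (ψ f)) : Spec (.of B) ⟶ Proj 𝒜 :=
  Spec.map (CommRingCat.ofHom (awayEval 𝒜 ψ hu)) ≫ Proj.awayι 𝒜 f hf hd

variable {𝒜}

theorem awayEval_mk_mul (ψ : A →ₐ[ℂ] B) {f : A} {d : ℕ} (hf : f ∈ 𝒜 d) (hu : IsUnit (ψ f))
    (n : ℕ) (a : A) (ha : a ∈ 𝒜 (n • d)) :
    awayEval 𝒜 ψ hu (.mk 𝒜 hf n a ha) * ψ f ^ n = ψ a := by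
  have h1 : ψ f ^ n = IsLocalization.Away.lift (S := Localization.Away f) (g := ψ.toRingHom) f hu
      (algebraMap A _ (f ^ n)) := by
    rw [IsLocalization.Away.lift_eq]; simp
  rw [h1, awayEval, RingHom.comp_apply, ← map_mul, HomogeneousLocalization.algebraMap_apply,
    HomogeneousLocalization.Away.val_mk, Localization.mk_eq_mk']
  have h2 := IsLocalization.mk'_spec (Localization.Away f) a
    (⟨f ^ n, n, rfl⟩ : Submonoid.powers f)
  rw [h2, IsLocalization.Away.lift_eq]
  rfl

theorem awayEval_eq_of (ψ : A →ₐ[ℂ] B) {f : A} {d : ℕ} (hf : f ∈ 𝒜 d) (hu : IsUnit (ψ f))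
    (χ : HomogeneousLocalization.Away 𝒜 f →+* B)
    (h : ∀ n a ha, χ (.mk 𝒜 hf n a ha) * ψ f ^ n = ψ a) : awayEval 𝒜 ψ hu = χ := by
  ext z
  obtain ⟨n, a, ha, rfl⟩ := HomogeneousLocalization.Away.mk_surjective 𝒜 hf z
  refine (hu.pow n).mul_left_injective ?_
  change _ * _ = _ * _
  rw [awayEval_mk_mul, h]

theorem SpecMap_projPt (φ : B →ₐ[ℂ] B') (ψ : A →ₐ[ℂ] B) {f : A} {d : ℕ} (hf : f ∈ 𝒜 d)
    (hd : 0 < d) (hu : IsUnit (ψ f)) :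
    Spec.map (CommRingCat.ofHom φ.toRingHom) ≫ projPt 𝒜 ψ hf hd hu =
      projPt 𝒜 (φ.comp ψ) hf hd (hu.map φ) := by
  simp only [projPt]
  rw [← Spec.map_comp_assoc, ← CommRingCat.ofHom_comp]
  congr 3
  refine (awayEval_eq_of _ hf _ _ fun n a ha => ?_).symm
  have := congrArg φ (awayEval_mk_mul ψ hf hu n a ha)
  rw [map_mul, map_pow] at this
  exact this

theorem projPt_mul (ψ : A →ₐ[ℂ] B) {f g : A} {d e : ℕ} (hf : f ∈ 𝒜 d)
    (hd : 0 < d) (hu : IsUnit (ψ f)) (hg : g ∈ 𝒜 e) (hu' : IsUnit (ψ g)) :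
    projPt 𝒜 ψ hf hd hu = projPt 𝒜 ψ (SetLike.mul_mem_graded hf hg) (hd.trans_le (d.le_add_right e))
      ((map_mul ψ f g).symm ▸ hu.mul hu') := by
  rw [projPt, projPt, ← Proj.SpecMap_awayMap_awayι 𝒜 hf hd hg rfl, ← Spec.map_comp_assoc,
    ← CommRingCat.ofHom_comp]
  congr 3
  refine awayEval_eq_of _ hf _ _ fun n a ha => ?_
  rw [RingHom.comp_apply, HomogeneousLocalization.awayMap_mk _ _ _ _ hf]
  refine (hu'.pow n).mul_left_injective ?_
  have h := awayEval_mk_mul ψ (SetLike.mul_mem_graded hf hg)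
    ((map_mul ψ f g).symm ▸ hu.mul hu') n (a * g ^ n) (by
      rw [smul_add]; exact SetLike.mul_mem_graded ha (SetLike.pow_mem_graded n hg))
  have h' : ψ (f * g) ^ n = ψ f ^ n * ψ g ^ n := by rw [map_mul, mul_pow]
  have h'' : ψ (a * g ^ n) = ψ a * ψ g ^ n := by rw [map_mul, map_pow]
  rw [h', h'', ← mul_assoc] at h
  exact h

/-- In a degree-zero fraction the powers of the unit c cancel. Different denominators f and g are
compared through fg, by `projPt_mul`. -/
theorem projPt_congr (ψ ψ' : A →ₐ[ℂ] B) (c : B) (hc : IsUnit c)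
    (h : ∀ d, ∀ a ∈ 𝒜 d, ψ' a = c ^ d * ψ a) {f g : A} {d e : ℕ} (hf : f ∈ 𝒜 d)
    (hd : 0 < d) (hu : IsUnit (ψ f)) (hg : g ∈ 𝒜 e) (he : 0 < e) (hu' : IsUnit (ψ' g)) :
    projPt 𝒜 ψ hf hd hu = projPt 𝒜 ψ' hg he hu' := by
  have key : ∀ {f : A} {d : ℕ} (hf : f ∈ 𝒜 d) (hd : 0 < d) (hu : IsUnit (ψ f))
      (hu' : IsUnit (ψ' f)), projPt 𝒜 ψ hf hd hu = projPt 𝒜 ψ' hf hd hu' := by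
    intro f d hf hd hu hu'
    rw [projPt, projPt]
    congr 3
    refine awayEval_eq_of _ hf _ _ fun n a ha => ?_
    have h1 := awayEval_mk_mul ψ' hf hu' n a ha
    rw [h _ _ hf, h _ _ ha, mul_pow, ← pow_mul, smul_eq_mul, mul_comm d n] at h1
    refine (hc.pow (n * d)).mul_right_injective ?_
    change _ * _ = _ * _
    rw [← h1]; ring
  have hg' : IsUnit (ψ g) := by
    rw [h _ _ hg] at hu'; exact isUnit_of_mul_isUnit_right hu'
  have h1 := projPt_mul ψ hf hd hu hg hg'
  have h2 := projPt_mul ψ hg he hg' hf hu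
  rw [← key hg he hg' hu', h1, h2]
  congr 1
  · exact mul_comm _ _
  · exact add_comm _ _

theorem projPt_projStr (ψ : A →ₐ[ℂ] B) {f : A} {d : ℕ} (hf : f ∈ 𝒜 d)
    (hd : 0 < d) (hu : IsUnit (ψ f)) :
    projPt 𝒜 ψ hf hd hu ≫ projStr 𝒜 = Spec.map (CommRingCat.ofHom (algebraMap ℂ B)) := by
  rw [projPt, projStr, Category.assoc, Proj.awayι_toSpecZero_assoc, ← Spec.map_comp,
    ← Spec.map_comp, ← CommRingCat.ofHom_comp, ← CommRingCat.ofHom_comp]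
  congr 2
  ext c
  have h := awayEval_mk_mul ψ hf hu 0 (algebraMap ℂ A c)
    (by rw [zero_smul]; exact (algebraMap ℂ (𝒜 0) c).2)
  rw [pow_zero, mul_one, AlgHom.commutes] at h
  rw [← h]
  simp only [RingHom.comp_apply]
  congr 1
  ext
  rw [HomogeneousLocalization.Away.val_mk]
  exact congrArg (Localization.mk _) (Subtype.ext (pow_zero f).symm)

theorem projPt_preimage_basicOpen (ψ : A →ₐ[ℂ] B) {f g : A} {d e : ℕ} (hf : f ∈ 𝒜 d)
    (hd : 0 < d) (hu : IsUnit (ψ f)) (hg : g ∈ 𝒜 e) (he : 0 < e) :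
    projPt 𝒜 ψ hf hd hu ⁻¹ᵁ Proj.basicOpen 𝒜 g = PrimeSpectrum.basicOpen (ψ g) := by
  rw [projPt, Scheme.Hom.comp_preimage, Proj.awayι_preimage_basicOpen 𝒜 hf hd hg he]
  have h := awayEval_mk_mul ψ hf hu e (g ^ d) (by
    convert! SetLike.pow_mem_graded d hg using 2; exact mul_comm _ _)
  ext x
  change awayEval 𝒜 ψ hu (HomogeneousLocalization.Away.isLocalizationElem hf hg) ∉ x.asIdeal ↔
    ψ g ∉ x.asIdeal
  rw [not_iff_not, HomogeneousLocalization.Away.isLocalizationElem]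
  rw [map_pow] at h
  constructor
  · intro hx
    exact x.2.mem_of_pow_mem d (h ▸ Ideal.mul_mem_right _ _ hx)
  · intro hx
    have := Ideal.pow_mem_of_mem _ hx d hd
    rw [← h] at this
    refine (x.2.mem_or_mem this).resolve_right fun h' => ?_
    exact x.2.ne_top (Ideal.eq_top_of_isUnit_mem _ h' (hu.pow e))

theorem isIso_of_awayEval_bijective (ψ : A →ₐ[ℂ] B) {f : A} {d : ℕ} (hf : f ∈ 𝒜 d)
    (hd : 0 < d) (hu : IsUnit (ψ f)) (h : Function.Bijective (awayEval 𝒜 ψ hu)) :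
    IsOpenImmersion (projPt 𝒜 ψ hf hd hu) ∧
      Set.range (projPt 𝒜 ψ hf hd hu) = Proj.basicOpen 𝒜 f := by
  have : IsIso (CommRingCat.ofHom (awayEval 𝒜 ψ hu)) :=
    (ConcreteCategory.isIso_iff_bijective _).mpr h
  refine ⟨by rw [projPt]; infer_instance, ?_⟩
  rw [← Proj.opensRange_awayι 𝒜 f hf hd, ← Scheme.Hom.opensRange_comp_of_isIso
    (Spec.map (CommRingCat.ofHom (awayEval 𝒜 ψ hu)))]
  rfl

end ProjPoint

end Minitwistor

/-! ### Points of Proj in terms of degree-one generators -/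

namespace Minitwistor

section Coordinates

open MvPolynomial

/-- Elements `y` of degree one generating a graded `ℂ`-algebra. -/
structure IsCoordSystem {A : Type} [CommRing A] [Algebra ℂ A] (𝒜 : ℕ → Submodule ℂ A)
    {m : ℕ} (y : Fin m → A) : Prop where
  mem : ∀ i, y i ∈ 𝒜 1
  exists_aeval : ∀ d, ∀ a ∈ 𝒜 d, ∃ P : MvPolynomial (Fin m) ℂ, P.IsHomogeneous d ∧ aeval y P = a

/-- The tuple `c` satisfies the relations between the coordinates `y`. -/
def IsPt {A : Type} [CommRing A] [Algebra ℂ A] {m : ℕ} (y : Fin m → A)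
    {B : Type} [CommRing B] [Algebra ℂ B] (c : Fin m → B) : Prop :=
  ∃ ψ : A →ₐ[ℂ] B, ∀ i, ψ (y i) = c i

variable {A : Type} [CommRing A] [Algebra ℂ A] {𝒜 : ℕ → Submodule ℂ A}
  {m : ℕ} {y : Fin m → A}
  {B : Type} [CommRing B] [Algebra ℂ B] {B' : Type} [CommRing B'] [Algebra ℂ B']

theorem aeval_mul_of_isHomogeneous {P : MvPolynomial (Fin m) ℂ} {d : ℕ} (hP : P.IsHomogeneous d)
    (u : B) (c : Fin m → B) : aeval (fun i => u * c i) P = u ^ d * aeval c P := by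
  rw [aeval_def, aeval_def, eval₂_eq', eval₂_eq', Finset.mul_sum]
  refine Finset.sum_congr rfl fun s hs => ?_
  have h1 : ∑ i, s i = d := by
    rw [← hP (mem_support_iff.mp hs), Finsupp.weight_apply, Finsupp.sum_fintype]
    · simp
    · simp
  simp only [mul_pow, Finset.prod_mul_distrib, Finset.prod_pow_eq_pow_sum, h1]
  ring

theorem IsCoordSystem.map_eq_mul (hy : IsCoordSystem 𝒜 y) (ψ ψ' : A →ₐ[ℂ] B) (u : B)
    (h : ∀ i, ψ' (y i) = u * ψ (y i)) (d : ℕ) (a : A) (ha : a ∈ 𝒜 d) : ψ' a = u ^ d * ψ a := by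
  obtain ⟨P, hP, rfl⟩ := hy.exists_aeval d a ha
  rw [comp_aeval_apply, comp_aeval_apply, ← aeval_mul_of_isHomogeneous hP]
  simp only [h]

variable [GradedAlgebra 𝒜]

/-- The point of `Proj 𝒜` with homogeneous coordinates `c`. -/
noncomputable def coordPt (hy : IsCoordSystem 𝒜 y) {c : Fin m → B} (hc : IsPt y c) (i : Fin m)
    (hu : IsUnit (c i)) : Spec (.of B) ⟶ Proj 𝒜 :=
  projPt 𝒜 hc.choose (hy.mem i) one_pos ((hc.choose_spec i).symm ▸ hu)

theorem coordPt_eq_projPt (hy : IsCoordSystem 𝒜 y) {c : Fin m → B} (hc : IsPt y c) (i : Fin m)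
    (hu : IsUnit (c i)) (ψ : A →ₐ[ℂ] B) (h : ∀ i, ψ (y i) = c i) :
    coordPt hy hc i hu = projPt 𝒜 ψ (hy.mem i) one_pos (by rwa [h]) :=
  projPt_congr _ _ 1 isUnit_one (hy.map_eq_mul _ _ 1 fun i => by
    rw [h, hc.choose_spec, one_mul]) _ _ _ _ _ _

theorem SpecMap_coordPt (hy : IsCoordSystem 𝒜 y) (φ : B →ₐ[ℂ] B') {c : Fin m → B} (hc : IsPt y c)
    (i : Fin m) (hu : IsUnit (c i)) {c' : Fin m → B'} (hc' : IsPt y c')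
    (i' : Fin m) (hu' : IsUnit (c' i')) (u : B') (h : ∀ k, c' k = u * φ (c k)) :
    Spec.map (CommRingCat.ofHom φ.toRingHom) ≫ coordPt hy hc i hu = coordPt hy hc' i' hu' := by
  rw [coordPt, SpecMap_projPt]
  refine projPt_congr _ _ u ?_ (hy.map_eq_mul _ _ u fun k => ?_) _ _ _ _ _ _
  · rw [h] at hu'
    exact isUnit_of_mul_isUnit_left hu'
  · rw [hc'.choose_spec, AlgHom.comp_apply, hc.choose_spec, h]

theorem coordPt_congr (hy : IsCoordSystem 𝒜 y) {c : Fin m → B} (hc : IsPt y c)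
    (i : Fin m) (hu : IsUnit (c i)) {c' : Fin m → B} (hc' : IsPt y c')
    (i' : Fin m) (hu' : IsUnit (c' i')) (u : B) (h : ∀ k, c' k = u * c k) :
    coordPt hy hc i hu = coordPt hy hc' i' hu' := by
  rw [← SpecMap_coordPt hy (AlgHom.id ℂ B) hc i hu hc' i' hu' u h]
  exact (Category.id_comp _).symm.trans
    (congrArg (· ≫ _) (Spec.map_id (CommRingCat.of B)).symm)

theorem coordPt_projStr (hy : IsCoordSystem 𝒜 y) {c : Fin m → B} (hc : IsPt y c) (i : Fin m)
    (hu : IsUnit (c i)) :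
    coordPt hy hc i hu ≫ projStr 𝒜 = Spec.map (CommRingCat.ofHom (algebraMap ℂ B)) :=
  projPt_projStr _ _ _ _

theorem coordPt_preimage (hy : IsCoordSystem 𝒜 y) {c : Fin m → B} (hc : IsPt y c) (i : Fin m)
    (hu : IsUnit (c i)) (k : Fin m) :
    coordPt hy hc i hu ⁻¹ᵁ Proj.basicOpen 𝒜 (y k) = PrimeSpectrum.basicOpen (c k) := by
  rw [coordPt, projPt_preimage_basicOpen _ _ _ _ (hy.mem k) one_pos, hc.choose_spec]

theorem IsCoordSystem.iSup_basicOpen (hy : IsCoordSystem 𝒜 y) :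
    ⨆ i, Proj.basicOpen 𝒜 (y i) = ⊤ := by
  refine Proj.iSup_basicOpen_eq_top' 𝒜 y (fun i => ⟨1, hy.mem i⟩) (top_le_iff.mp fun a _ => ?_)
  classical
  rw [← DirectSum.sum_support_decompose 𝒜 a]
  refine Subalgebra.sum_mem _ fun d _ => ?_
  obtain ⟨P, -, hP⟩ := hy.exists_aeval d _ (DirectSum.decompose 𝒜 a d).2
  rw [← hP]
  have hP' : aeval y P ∈ Algebra.adjoin ℂ (Set.range y) := by
    rw [Algebra.adjoin_range_eq_range_aeval]; exact ⟨P, rfl⟩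
  have : IsScalarTower ℂ (𝒜 0) A := ⟨fun a b c => smul_mul_assoc a (b : A) c⟩
  have h2 : Algebra.adjoin ℂ (Set.range y) ≤
      (Algebra.adjoin (𝒜 0) (Set.range y)).restrictScalars ℂ :=
    Algebra.adjoin_le Algebra.subset_adjoin
  exact h2 hP'

/-- Proj is proper over the spectrum of the degree-zero part, which is a quotient of ℂ since the
generators have degree one. -/
theorem IsCoordSystem.isProper (hy : IsCoordSystem 𝒜 y) : IsProper (projStr 𝒜) := by
  have h1 : Function.Surjective (algebraMap ℂ (𝒜 0)) := by
    rintro ⟨a, ha⟩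
    obtain ⟨P, hP, rfl⟩ := hy.exists_aeval 0 a ha
    have hP := totalDegree_eq_zero_iff_eq_C.mp (Nat.le_zero.mp hP.totalDegree_le)
    refine ⟨coeff 0 P, Subtype.ext ?_⟩
    have h := congrArg (aeval y) hP
    rw [aeval_C] at h
    exact h.symm
  have h2 : IsClosedImmersion (Spec.map (CommRingCat.ofHom (algebraMap ℂ (𝒜 0)))) :=
    IsClosedImmersion.spec_of_surjective _ h1
  have h3 : Algebra.FiniteType ℂ A := by
    refine Algebra.FiniteType.of_surjective (aeval y) fun a => ?_
    classical
    choose P hP using fun d => hy.exists_aeval d _ (DirectSum.decompose 𝒜 a d).2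
    refine ⟨∑ d ∈ (DirectSum.decompose 𝒜 a).support, P d, ?_⟩
    rw [map_sum]
    conv_rhs => rw [← DirectSum.sum_support_decompose 𝒜 a]
    exact Finset.sum_congr rfl fun d _ => (hP d).2
  have : IsScalarTower ℂ (𝒜 0) A := ⟨fun a b c => smul_mul_assoc a (b : A) c⟩
  have h4 : Algebra.FiniteType (𝒜 0) A := Algebra.FiniteType.of_restrictScalars_finiteType ℂ _ _
  rw [projStr]
  infer_instance

/-- A presentation of the affine chart `y i ≠ 0`. -/
theorem IsCoordSystem.isOpenImmersion_coordPt (hy : IsCoordSystem 𝒜 y) {c : Fin m → B}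
    (hc : IsPt y c) (i : Fin m) (hi : c i = 1) (hu : IsUnit (c i))
    (hgen : Algebra.adjoin ℂ (Set.range c) = ⊤) (θ : B →ₐ[ℂ] Localization.Away (y i))
    (hθ : ∀ k, algebraMap A (Localization.Away (y i)) (y k) =
      algebraMap A (Localization.Away (y i)) (y i) * θ (c k)) :
    IsOpenImmersion (coordPt hy hc i hu) ∧
      Set.range (coordPt hy hc i hu) = Proj.basicOpen 𝒜 (y i) := by
  obtain ⟨ψ, hψ⟩ := id hc
  have hui : IsUnit (ψ (y i)) := by rwa [hψ]
  rw [coordPt_eq_projPt hy hc i hu ψ hψ]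
  refine isIso_of_awayEval_bijective _ _ _ _ ⟨?_, ?_⟩
  -- Followed by θ, the evaluation is the inclusion into the full localization: this gives
  -- injectivity. Surjectivity holds because the tuple generates B.
  · have key : ∀ z, θ (awayEval 𝒜 ψ hui z) = z.val := by
      intro z
      obtain ⟨n, a, ha, rfl⟩ := HomogeneousLocalization.Away.mk_surjective 𝒜 (hy.mem i) z
      have h1 := awayEval_mk_mul ψ (hy.mem i) hui n a ha
      rw [hψ, hi, one_pow, mul_one] at h1
      have h2 := hy.map_eq_mul (θ.comp ψ) (Algebra.algHom ℂ A (Localization.Away (y i)))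
        (algebraMap A _ (y i)) (fun k => by
          change algebraMap A (Localization.Away (y i)) (y k) = _
          rw [AlgHom.comp_apply, hψ, ← hθ]) _ a ha
      change algebraMap A (Localization.Away (y i)) a = _ at h2
      rw [AlgHom.comp_apply, smul_eq_mul, mul_one] at h2
      rw [h1, HomogeneousLocalization.Away.val_mk, Localization.mk_eq_mk', eq_comm,
        IsLocalization.mk'_eq_iff_eq_mul, h2, map_pow, mul_comm]
    intro z w hzw
    apply HomogeneousLocalization.val_injective
    rw [← key, ← key, hzw]
  · intro b
    have hb : b ∈ Algebra.adjoin ℂ (Set.range c) := hgen ▸ Algebra.mem_top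
    rw [Algebra.adjoin_range_eq_range_aeval] at hb
    obtain ⟨P, rfl⟩ := hb
    induction P using MvPolynomial.induction_on with
    | C r =>
      refine ⟨.mk 𝒜 (hy.mem i) 0 (algebraMap ℂ A r) (by
        rw [zero_smul]; exact (algebraMap ℂ (𝒜 0) r).2), ?_⟩
      have h := awayEval_mk_mul ψ (hy.mem i) hui 0 (algebraMap ℂ A r)
        (by rw [zero_smul]; exact (algebraMap ℂ (𝒜 0) r).2)
      rw [pow_zero, mul_one] at h
      rw [h]; simp
    | add p q hp hq =>
      obtain ⟨a, ha⟩ := hp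
      obtain ⟨b, hb⟩ := hq
      refine ⟨a + b, ?_⟩
      rw [map_add, ha, hb]; simp
    | mul_X p k hp =>
      obtain ⟨a, ha⟩ := hp
      have h := awayEval_mk_mul ψ (hy.mem i) hui 1 (y k) (by rw [one_smul]; exact hy.mem k)
      rw [hψ, hψ, hi, one_pow, mul_one] at h
      refine ⟨a * .mk 𝒜 (hy.mem i) 1 (y k) (by rw [one_smul]; exact hy.mem k), ?_⟩
      rw [map_mul, ha, h]; simp

end Coordinates

end Minitwistor

namespace Minitwistor

open MvPolynomial

/-! ### The field of rational functions in two variables -/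

/-- The field of rational functions in two variables. -/
abbrev RatField : Type := FractionRing Plane

/-- The first variable of `RatField`. -/
noncomputable def RatField.t : RatField := algebraMap Plane RatField (X 0)

/-- The second variable of `RatField`. -/
noncomputable def RatField.p : RatField := algebraMap Plane RatField (X 1)

theorem RatField.t_ne_zero : RatField.t ≠ 0 := by
  rw [RatField.t, Ne, IsFractionRing.to_map_eq_zero_iff]
  exact X_ne_zero _

theorem RatField.p_ne_zero : RatField.p ≠ 0 := by
  rw [RatField.p, Ne, IsFractionRing.to_map_eq_zero_iff]
  exact X_ne_zero _

theorem RatField.algebraMap_eq (P : Plane) :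
    algebraMap Plane RatField P = aeval ![RatField.t, RatField.p] P := by
  have : (Algebra.algHom ℂ Plane RatField) = aeval ![RatField.t, RatField.p] := by
    apply MvPolynomial.algHom_ext
    intro i
    fin_cases i
    · simp [RatField.t]; rfl
    · simp [RatField.p]; rfl
  exact congrArg (fun f : Plane →ₐ[ℂ] RatField => f P) this

theorem RatField.aeval_t_ne_zero {h : Polynomial ℂ} (hh : h ≠ 0) :
    Polynomial.aeval RatField.t h ≠ 0 := by
  rw [RatField.t, Polynomial.aeval_algebraMap_apply, Ne, IsFractionRing.to_map_eq_zero_iff]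
  intro h0
  have := congrArg axisHom h0
  rw [← Polynomial.aeval_algHom_apply] at this
  simp [axisHom] at this
  exact hh this

/-- All of ℂ(t, p) is algebraic over the subalgebra generated by a and b. As the transcendence
degree is at least two, the pair is a transcendence basis. -/
theorem RatField.aeval_injective {a b : RatField}
    (ht : IsAlgebraic (Algebra.adjoin ℂ (Set.range ![a, b])) RatField.t)
    (hp : IsAlgebraic (Algebra.adjoin ℂ (Set.range ![a, b])) RatField.p) :
    Function.Injective (aeval ![a, b] : Plane →ₐ[ℂ] RatField) := by
  have hP : ∀ P : Plane, IsAlgebraic (Algebra.adjoin ℂ (Set.range ![a, b]))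
      (algebraMap Plane RatField P) := by
    intro P
    induction P using MvPolynomial.induction_on with
    | C r =>
      have : algebraMap Plane RatField (C r) = algebraMap (Algebra.adjoin ℂ (Set.range ![a, b]))
          RatField (algebraMap ℂ _ r) := by
        rw [← IsScalarTower.algebraMap_apply ℂ, IsScalarTower.algebraMap_apply ℂ Plane RatField]
        rfl
      rw [this]
      exact isAlgebraic_algebraMap _
    | add p q hp hq => rw [map_add]; exact hp.add hq
    | mul_X p k hp' =>
      rw [map_mul]
      refine hp'.mul ?_
      fin_cases k
      · exact ht
      · exact hp
  have : Algebra.IsAlgebraic (Algebra.adjoin ℂ (Set.range ![a, b])) RatField := by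
    refine ⟨fun k => ?_⟩
    obtain ⟨P, Q, -, rfl⟩ := IsFractionRing.div_surjective (A := Plane) k
    rw [div_eq_mul_inv]
    exact (hP P).mul (hP Q).inv
  have h2 : AlgebraicIndependent ℂ (fun i => algebraMap Plane RatField (X i)) := by
    have h3 : aeval (fun i => algebraMap Plane RatField (X i)) =
        Algebra.algHom ℂ Plane RatField := by
      apply MvPolynomial.algHom_ext
      intro i
      rw [aeval_X]; rfl
    rw [AlgebraicIndependent, h3]
    exact IsFractionRing.injective Plane RatField
  have h3 := Algebra.IsAlgebraic.isTranscendenceBasis_of_le_trdeg_of_finite ℂ ![a, b] h2.cardinalMk_le_trdeg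
  exact h3.1

/-! ### The affine quadric `p q = h(t)` -/

/-- The coordinate ring of the affine surface `p q = h(t)`. -/
abbrev Hyp (h : Polynomial ℂ) : Type :=
  MvPolynomial (Fin 3) ℂ ⧸
    Ideal.span {(X 1 * X 2 - Polynomial.aeval (X 0) h : MvPolynomial (Fin 3) ℂ)}

namespace Hyp

variable (h : Polynomial ℂ)

/-- The coordinate functions of the affine surface `p q = h(t)`. -/
noncomputable def x (i : Fin 3) : Hyp h := Ideal.Quotient.mk _ (X i)

theorem rel : x h 1 * x h 2 = Polynomial.aeval (x h 0) h := by
  have h1 : Ideal.Quotient.mkₐ ℂ (Ideal.span {(X 1 * X 2 - Polynomial.aeval (X 0) h :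
      MvPolynomial (Fin 3) ℂ)}) (X 1 * X 2 - Polynomial.aeval (X 0) h) = 0 :=
    Ideal.Quotient.eq_zero_iff_mem.mpr (Ideal.subset_span rfl)
  rw [map_sub, sub_eq_zero, ← Polynomial.aeval_algHom_apply, map_mul] at h1
  exact h1

variable {h} {B : Type*} [CommRing B] [Algebra ℂ B]

/-- The homomorphism from the coordinate ring of `p q = h(t)` given by a solution of the
equation. -/
noncomputable def lift (a b c : B) (hbc : b * c = Polynomial.aeval a h) : Hyp h →ₐ[ℂ] B :=
  Ideal.Quotient.liftₐ _ (aeval ![a, b, c]) (by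
    intro P hP
    have : Ideal.span {(X 1 * X 2 - Polynomial.aeval (X 0) h : MvPolynomial (Fin 3) ℂ)} ≤
        RingHom.ker (aeval ![a, b, c] : MvPolynomial (Fin 3) ℂ →ₐ[ℂ] B) := by
      rw [Ideal.span_singleton_le_iff_mem, RingHom.mem_ker, map_sub,
        ← Polynomial.aeval_algHom_apply]
      simp [hbc]
    exact this hP)

theorem lift_x {a b c : B} (hbc : b * c = Polynomial.aeval a h) (i : Fin 3) :
    lift a b c hbc (x h i) = ![a, b, c] i :=
  (Ideal.Quotient.lift_mk _ _ _).trans (aeval_X _ _)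

@[simp] theorem lift_t {a b c : B} (hbc : b * c = Polynomial.aeval a h) :
    lift a b c hbc (x h 0) = a := lift_x hbc 0
@[simp] theorem lift_p {a b c : B} (hbc : b * c = Polynomial.aeval a h) :
    lift a b c hbc (x h 1) = b := lift_x hbc 1
@[simp] theorem lift_q {a b c : B} (hbc : b * c = Polynomial.aeval a h) :
    lift a b c hbc (x h 2) = c := lift_x hbc 2

theorem hom_ext {f g : Hyp h →ₐ[ℂ] B} (h0 : f (x h 0) = g (x h 0)) (h1 : f (x h 1) = g (x h 1))
    (h2 : f (x h 2) = g (x h 2)) : f = g := by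
  apply Ideal.Quotient.algHom_ext
  apply MvPolynomial.algHom_ext
  intro i
  fin_cases i
  · exact h0
  · exact h1
  · exact h2

theorem adjoin_eq_top : Algebra.adjoin ℂ {x h 0, x h 1, x h 2} = ⊤ := by
  rw [eq_top_iff]
  rintro b -
  obtain ⟨P, rfl⟩ := Ideal.Quotient.mk_surjective b
  induction P using MvPolynomial.induction_on with
  | C r => exact Subalgebra.algebraMap_mem _ r
  | add p q hp hq => rw [map_add]; exact add_mem hp hq
  | mul_X p k hp =>
    rw [map_mul]
    refine mul_mem hp (Algebra.subset_adjoin ?_)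
    fin_cases k
    · exact Or.inl rfl
    · exact Or.inr (Or.inl rfl)
    · exact Or.inr (Or.inr rfl)

/-- In ℂ(t, p) the value of q is h(t)/p, a reduced fraction since p does not divide h(t). Gauss's
lemma then makes every relation a multiple of p q - h(t). -/
theorem lift_ratField_injective (hh : h ≠ 0) :
    Function.Injective (lift RatField.t RatField.p (Polynomial.aeval RatField.t h / RatField.p)
      (mul_div_cancel₀ _ RatField.p_ne_zero) : Hyp h →ₐ[ℂ] RatField) := by
  rw [injective_iff_map_eq_zero]
  intro b hb
  obtain ⟨P, rfl⟩ := Ideal.Quotient.mk_surjective b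
  -- Regard ℂ[t, p, q] as polynomials in q over ℂ[t, p].
  let σ : MvPolynomial (Fin 3) ℂ →ₐ[ℂ] Polynomial Plane :=
    aeval ![Polynomial.C (X 0), Polynomial.C (X 1), Polynomial.X]
  let τ : Polynomial Plane →+* Hyp h :=
    Polynomial.eval₂RingHom (aeval ![x h 0, x h 1] : Plane →ₐ[ℂ] Hyp h).toRingHom (x h 2)
  have hτ : ∀ P, τ (σ P) = Ideal.Quotient.mk _ P := by
    intro P
    have : τ.comp σ.toRingHom = Ideal.Quotient.mk _ := by
      apply MvPolynomial.ringHom_ext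
      · intro r
        simp [τ, σ]
        rfl
      · intro i
        fin_cases i <;> simp [τ, σ, x]
    exact congrArg (fun f : MvPolynomial (Fin 3) ℂ →+* Hyp h => f P) this
  have hσ : Polynomial.aeval (algebraMap Plane RatField (Polynomial.aeval (X 0) h) /
      algebraMap Plane RatField (X 1)) (σ P) = 0 := by
    rw [← hb]
    change _ = aeval _ P
    have : ((Polynomial.aeval (R := Plane) (algebraMap Plane RatField (Polynomial.aeval (X 0) h) /
      algebraMap Plane RatField (X 1))).restrictScalars ℂ).comp σ = aeval ![RatField.t, RatField.p,
        Polynomial.aeval RatField.t h / RatField.p] := by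
      apply MvPolynomial.algHom_ext
      intro i
      fin_cases i
      · simp [σ, RatField.t]
      · simp [σ, RatField.p]
      · simp [σ, RatField.t, RatField.p, Polynomial.aeval_algebraMap_apply]
    exact congrArg (fun f : MvPolynomial (Fin 3) ℂ →ₐ[ℂ] RatField => f P) this
  have hprime : Prime (X 1 : Plane) := MvPolynomial.X_prime
  have hrel : IsRelPrime (Polynomial.aeval (X 0 : Plane) h) (X 1) := by
    refine (hprime.irreducible.isRelPrime_iff_not_dvd.mpr fun hd => ?_).symm
    obtain ⟨Q, hQ⟩ := hd
    have := congrArg axisHom hQ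
    rw [← Polynomial.aeval_algHom_apply] at this
    simp [axisHom] at this
    exact hh this
  obtain ⟨Q, hQ⟩ := linear_dvd_of_aeval_div_eq_zero hrel hprime.ne_zero hσ
  rw [← hτ, hQ, map_mul]
  have : τ (Polynomial.C (X 1) * Polynomial.X - Polynomial.C (Polynomial.aeval (X 0) h)) = 0 := by
    have h3 : aeval ![x h 0, x h 1] (Polynomial.aeval (X 0 : Plane) h) =
        Polynomial.aeval (x h 0) h := by
      rw [← Polynomial.aeval_algHom_apply]; simp
    simp [τ, h3, rel]
  rw [this, zero_mul]

theorem lift_injective_of_aeval_injective (hh : h ≠ 0) {L : Type*} [Field L] [Algebra ℂ L]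
    {a b c : L} (hbc : b * c = Polynomial.aeval a h)
    (hab : Function.Injective (aeval ![a, b] : Plane →ₐ[ℂ] L)) :
    Function.Injective (lift a b c hbc : Hyp h →ₐ[ℂ] L) := by
  let ι : RatField →ₐ[ℂ] L := IsFractionRing.liftAlgHom (K := RatField) hab
  have hι : ∀ P : Plane, ι (algebraMap Plane RatField P) = aeval ![a, b] P := fun P =>
    IsFractionRing.lift_algebraMap hab P
  have ht : ι RatField.t = a := by rw [RatField.t, hι]; simp
  have hp : ι RatField.p = b := by rw [RatField.p, hι]; simp
  have hb : b ≠ 0 := by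
    rw [← hp]
    exact (map_ne_zero ι).mpr RatField.p_ne_zero
  have : (lift a b c hbc : Hyp h →ₐ[ℂ] L) = ι.comp (lift RatField.t RatField.p
      (Polynomial.aeval RatField.t h / RatField.p) (mul_div_cancel₀ _ RatField.p_ne_zero)) := by
    apply hom_ext
    · simp [ht]
    · simp [hp]
    · simp [hp, ← Polynomial.aeval_algHom_apply, ht, ← hbc, hb]
  rw [this]
  exact ι.toRingHom.injective.comp (lift_ratField_injective hh)

theorem isDomain (hh : h ≠ 0) : IsDomain (Hyp h) :=
  (lift_ratField_injective hh).isDomain _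

end Hyp

end Minitwistor

namespace Minitwistor

open MvPolynomial

/-! ### Coordinates on the quartic surface, the conic and the line -/

theorem isCoordSystem_coordGrading (m : ℕ) :
    IsCoordSystem (coordGrading m) (X : Fin m → MvPolynomial (Fin m) ℂ) where
  mem i := isHomogeneous_X _ i
  exists_aeval _ a ha := ⟨a, ha, aeval_X_left_apply a⟩

theorem isCoordSystem_quotGrading {m : ℕ} (I : HomogeneousIdeal (coordGrading m)) :
    IsCoordSystem (quotGrading I) (fun i => Ideal.Quotient.mk I.toIdeal (X i)) where
  mem i := mk_mem_quotGrading I (isHomogeneous_X _ i)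
  exists_aeval d a ha := by
    obtain ⟨P, hP, rfl⟩ := ha
    refine ⟨P, hP, ?_⟩
    have : aeval (fun i => Ideal.Quotient.mk I.toIdeal (X i)) = Ideal.Quotient.mkₐ ℂ I.toIdeal := by
      apply MvPolynomial.algHom_ext
      intro i
      rw [aeval_X]
      rfl
    rw [this]
    rfl

theorem isPt_quotGrading {m : ℕ} (I : HomogeneousIdeal (coordGrading m)) {B : Type} [CommRing B]
    [Algebra ℂ B] {s : Set (MvPolynomial (Fin m) ℂ)} (hs : I.toIdeal = Ideal.span s)
    {c : Fin m → B} (hc : ∀ P ∈ s, aeval c P = 0) :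
    IsPt (fun i => Ideal.Quotient.mk I.toIdeal (X i)) c := by
  refine ⟨Ideal.Quotient.liftₐ I.toIdeal (aeval c) fun a ha => ?_, fun i => ?_⟩
  · have h : I.toIdeal ≤ RingHom.ker (aeval c : MvPolynomial (Fin m) ℂ →ₐ[ℂ] B) := by
      rw [hs, Ideal.span_le]
      exact hc
    exact h ha
  · exact (Ideal.Quotient.lift_mk _ _ _).trans (aeval_X _ _)

/-- The homogeneous coordinates on the conic. -/
noncomputable def conicY (i : Fin 3) : MvPolynomial (Fin 3) ℂ ⧸ conicIdeal.toIdeal :=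
  Ideal.Quotient.mk _ (X i)

/-- The homogeneous coordinates on the quartic surface. -/
noncomputable def quarticY (α : ℝ) (i : Fin 5) :
    MvPolynomial (Fin 5) ℂ ⧸ (quarticIdeal α).toIdeal :=
  Ideal.Quotient.mk _ (X i)

theorem isCoordSystem_conicY : IsCoordSystem (quotGrading conicIdeal) conicY :=
  isCoordSystem_quotGrading _

theorem isCoordSystem_quarticY (α : ℝ) :
    IsCoordSystem (quotGrading (quarticIdeal α)) (quarticY α) :=
  isCoordSystem_quotGrading _

theorem conicY_rel : conicY 1 * conicY 2 = conicY 0 ^ 2 := by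
  have h : Ideal.Quotient.mk conicIdeal.toIdeal (X 1 * X 2 - X 0 ^ 2) = 0 :=
    Ideal.Quotient.eq_zero_iff_mem.mpr (Ideal.subset_span rfl)
  rw [map_sub, map_mul, map_pow, sub_eq_zero] at h
  exact h

theorem quarticY_rel (α : ℝ) : quarticY α 1 * quarticY α 2 = quarticY α 0 ^ 2 := by
  have h : Ideal.Quotient.mk (quarticIdeal α).toIdeal (X 1 * X 2 - X 0 ^ 2) = 0 :=
    Ideal.Quotient.eq_zero_iff_mem.mpr (Ideal.subset_span (Or.inl rfl))
  rw [map_sub, map_mul, map_pow, sub_eq_zero] at h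
  exact h

theorem quarticY_rel' (α : ℝ) : quarticY α 3 * quarticY α 4 = quarticY α 0 *
    (quarticY α 1 - algebraMap ℂ _ (α : ℂ) * quarticY α 2 +
      algebraMap ℂ _ ((α : ℂ) - 1) * quarticY α 0) := by
  have h : Ideal.Quotient.mk (quarticIdeal α).toIdeal (quadricPoly α) = 0 :=
    Ideal.Quotient.eq_zero_iff_mem.mpr (Ideal.subset_span (Or.inr rfl))
  rw [quadricPoly, map_sub, map_mul, sub_eq_zero] at h
  exact h

theorem isPt_conicY {B : Type} [CommRing B] [Algebra ℂ B] {c : Fin 3 → B}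
    (hc : c 1 * c 2 = c 0 ^ 2) : IsPt conicY c := by
  refine isPt_quotGrading conicIdeal (s := {conicPoly 3 le_rfl}) rfl ?_
  rintro _ rfl
  simp [conicPoly, hc]

theorem isPt_quarticY (α : ℝ) {B : Type} [CommRing B] [Algebra ℂ B] {c : Fin 5 → B}
    (hc : c 1 * c 2 = c 0 ^ 2) (hc' : c 3 * c 4 = c 0 * (c 1 - algebraMap ℂ B (α : ℂ) * c 2 +
      algebraMap ℂ B ((α : ℂ) - 1) * c 0)) : IsPt (quarticY α) c := by
  refine isPt_quotGrading (quarticIdeal α) (s := {conicPoly 5 (by norm_num), quadricPoly α}) rfl ?_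
  rintro _ (rfl | rfl)
  · simp [conicPoly, hc]
  · rw [quadricPoly]
    simp only [map_sub, map_add, map_mul, aeval_X, aeval_C, hc']
    ring

/-- The standard parametrizations of the conic: `(t : 1 : t²)` and `(t : t² : 1)`. -/
def conicTuple {B : Type*} [CommRing B] (j : Fin 2) (t : B) : Fin 3 → B :=
  if j = 0 then ![t, 1, t ^ 2] else ![t, t ^ 2, 1]

/-- The coordinate of the conic equal to one on the chart `j`. -/
def conicIdx (j : Fin 2) : Fin 3 := if j = 0 then 1 else 2

/-- The polynomial `y₃ y₄` in terms of the parameter of the chart `j` of the conic. -/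
noncomputable def chartPoly (α : ℝ) (j : Fin 2) : Polynomial ℂ :=
  if j = 0 then Polynomial.X * (1 - Polynomial.C (α : ℂ) * Polynomial.X ^ 2 +
    Polynomial.C ((α : ℂ) - 1) * Polynomial.X)
  else Polynomial.X * (Polynomial.X ^ 2 - Polynomial.C (α : ℂ) +
    Polynomial.C ((α : ℂ) - 1) * Polynomial.X)

/-- Homogeneous coordinates `(x e(t) : a : b)` on the quartic surface, where `e(t)` is a point of
the conic. -/
def surfTuple {B : Type*} [CommRing B] (j : Fin 2) (t x a b : B) : Fin 5 → B :=
  ![x * conicTuple j t 0, x * conicTuple j t 1, x * conicTuple j t 2, a, b]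

theorem conicTuple_idx {B : Type} [CommRing B] (j : Fin 2) (t : B) : conicTuple j t (conicIdx j) = 1 := by
  fin_cases j <;> simp [conicTuple, conicIdx]

theorem isUnit_conicTuple {B : Type} [CommRing B] (j : Fin 2) (t : B) : IsUnit (conicTuple j t (conicIdx j)) := by
  rw [conicTuple_idx]; exact isUnit_one

section Tuples

variable {B B' : Type} [CommRing B] [Algebra ℂ B] [CommRing B'] [Algebra ℂ B']

theorem map_conicTuple (φ : B →ₐ[ℂ] B') (j : Fin 2) (t : B) (k : Fin 3) :
    φ (conicTuple j t k) = conicTuple j (φ t) k := by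
  fin_cases j <;> fin_cases k <;> simp [conicTuple]

theorem map_surfTuple (φ : B →ₐ[ℂ] B') (j : Fin 2) (t x a b : B) (k : Fin 5) :
    φ (surfTuple j t x a b k) = surfTuple j (φ t) (φ x) (φ a) (φ b) k := by
  fin_cases k <;> simp [surfTuple, map_conicTuple]

theorem isPt_conicTuple (j : Fin 2) (t : B) : IsPt conicY (conicTuple j t) := by
  apply isPt_conicY
  fin_cases j <;> simp [conicTuple]

theorem isPt_surfTuple (α : ℝ) (j : Fin 2) {t x a b : B}
    (h : a * b = x ^ 2 * Polynomial.aeval t (chartPoly α j)) :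
    IsPt (quarticY α) (surfTuple j t x a b) := by
  apply isPt_quarticY
  · fin_cases j <;> simp [surfTuple, conicTuple] <;> ring
  · fin_cases j
    · simp only [surfTuple, conicTuple, chartPoly] at h ⊢
      simp at h ⊢
      rw [h]; ring
    · simp only [surfTuple, conicTuple, chartPoly] at h ⊢
      simp at h ⊢
      rw [h]; ring

theorem conicTuple_one_inv {F : Type} [Field F] {t : F} (ht : t ≠ 0) (k : Fin 3) :
    t ^ 2 * conicTuple 1 t⁻¹ k = conicTuple 0 t k := by
  fin_cases k <;> simp [conicTuple] <;> field_simp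

/-- The two parametrizations of the conic differ by the factor t², and y₃ y₄ is quadratic in y₀, y₁,
y₂; hence the factor t⁴. -/
theorem aeval_chartPoly_one_inv (α : ℝ) {F : Type} [Field F] [Algebra ℂ F] {t : F} (ht : t ≠ 0) :
    t ^ 4 * Polynomial.aeval t⁻¹ (chartPoly α 1) = Polynomial.aeval t (chartPoly α 0) := by
  simp [chartPoly]
  field_simp

end Tuples

theorem chartPoly_ne_zero (α : ℝ) (j : Fin 2) : chartPoly α j ≠ 0 := by
  intro h
  fin_cases j
  · have := congrArg (Polynomial.coeff · 1) h
    simp [chartPoly, Polynomial.coeff_one] at this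
  · have := congrArg (Polynomial.coeff · 3) h
    simp [chartPoly, show (1 : Polynomial ℂ).coeff 1 = 0 by simp [Polynomial.coeff_one]] at this

theorem adjoin_eq_top_of_subset {B : Type} [CommRing B] [Algebra ℂ B] {s t : Set B}
    (hs : Algebra.adjoin ℂ s = ⊤) (h : s ⊆ t) : Algebra.adjoin ℂ t = ⊤ :=
  top_le_iff.mp (hs ▸ Algebra.adjoin_mono h)

/-! ### Affine charts of the quartic surface and of the conic -/

/-- The chart `z_j ≠ 0` of the conic. -/
noncomputable def conicChart (j : Fin 2) : Spec (.of (Polynomial ℂ)) ⟶ Conic :=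
  coordPt isCoordSystem_conicY (isPt_conicTuple j Polynomial.X) (conicIdx j) (isUnit_conicTuple j _)

theorem eq_mul_conicTuple {R : Type} [CommRing R] {Y : Fin 3 → R} {w : R} (h : Y 1 * Y 2 = Y 0 ^ 2)
    (j : Fin 2) (hw : Y (conicIdx j) * w = 1) (k : Fin 3) :
    Y k = Y (conicIdx j) * conicTuple j (Y 0 * w) k := by
  fin_cases j <;> fin_cases k <;> simp [conicTuple, conicIdx] at hw ⊢
  · linear_combination (-Y 0) * hw
  · linear_combination (-Y 2) * (1 + Y 1 * w) * hw + Y 1 * w ^ 2 * h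
  · linear_combination (-Y 0) * hw
  · linear_combination (-Y 1) * (1 + Y 2 * w) * hw + Y 2 * w ^ 2 * h

theorem isOpenImmersion_conicChart (j : Fin 2) : IsOpenImmersion (conicChart j) ∧
    Set.range (conicChart j) = Proj.basicOpen (quotGrading conicIdeal) (conicY (conicIdx j)) := by
  set w := IsLocalization.Away.invSelf (S := Localization.Away (conicY (conicIdx j)))
    (conicY (conicIdx j)) with hw
  have h1 : algebraMap _ (Localization.Away (conicY (conicIdx j))) (conicY (conicIdx j)) * w = 1 :=
    IsLocalization.Away.mul_invSelf _
  refine isCoordSystem_conicY.isOpenImmersion_coordPt (isPt_conicTuple j Polynomial.X) _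
    (conicTuple_idx j _) _ ?_ (Polynomial.aeval (algebraMap _ _ (conicY 0) * w)) ?_
  · refine adjoin_eq_top_of_subset Polynomial.adjoin_X (Set.singleton_subset_iff.mpr ⟨0, ?_⟩)
    fin_cases j <;> simp [conicTuple]
  · intro k
    rw [map_conicTuple, Polynomial.aeval_X]
    exact eq_mul_conicTuple (Y := fun k => algebraMap _ (Localization.Away (conicY (conicIdx j)))
      (conicY k)) (by rw [← map_mul, conicY_rel, map_pow]) j h1 k

/-- The coordinate of the quartic surface equal to one on the chart `j`. -/
def surfIdx (j : Fin 2) : Fin 5 := if j = 0 then 1 else 2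

theorem surfTuple_idx {B : Type} [CommRing B] (j : Fin 2) (t x a b : B) :
    surfTuple j t x a b (surfIdx j) = x := by
  fin_cases j <;> simp [surfTuple, conicTuple, surfIdx]

theorem isUnit_surfTuple {B : Type} [CommRing B] (j : Fin 2) (t a b : B) :
    IsUnit (surfTuple j t 1 a b (surfIdx j)) := by
  rw [surfTuple_idx]; exact isUnit_one

/-- The chart `y_j ≠ 0` of the quartic surface, for `j = 1, 2`. -/
noncomputable def surfChart (α : ℝ) (j : Fin 2) :
    Spec (.of (Hyp (chartPoly α j))) ⟶ Quartic α :=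
  coordPt (isCoordSystem_quarticY α)
    (isPt_surfTuple α j (t := Hyp.x _ 0) (x := 1) (a := Hyp.x _ 1) (b := Hyp.x _ 2) (by
      rw [one_pow, one_mul]; exact Hyp.rel _)) (surfIdx j) (isUnit_surfTuple j _ _ _)

theorem eq_mul_surfTuple {R : Type} [CommRing R] {Y : Fin 5 → R} {w : R} (h : Y 1 * Y 2 = Y 0 ^ 2)
    (j : Fin 2) (hw : Y (surfIdx j) * w = 1) (k : Fin 5) :
    Y k = Y (surfIdx j) * surfTuple j (Y 0 * w) 1 (Y 3 * w) (Y 4 * w) k := by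
  fin_cases j <;> fin_cases k <;> simp [surfTuple, conicTuple, surfIdx] at hw ⊢
  · linear_combination (-Y 0) * hw
  · linear_combination (-Y 2) * (1 + Y 1 * w) * hw + Y 1 * w ^ 2 * h
  · linear_combination (-Y 3) * hw
  · linear_combination (-Y 4) * hw
  · linear_combination (-Y 0) * hw
  · linear_combination (-Y 1) * (1 + Y 2 * w) * hw + Y 2 * w ^ 2 * h
  · linear_combination (-Y 3) * hw
  · linear_combination (-Y 4) * hw

theorem mul_eq_aeval_chartPoly (α : ℝ) {R : Type} [CommRing R] [Algebra ℂ R] {Y : Fin 5 → R} {w : R}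
    (h : Y 1 * Y 2 = Y 0 ^ 2)
    (h' : Y 3 * Y 4 = Y 0 * (Y 1 - algebraMap ℂ R (α : ℂ) * Y 2 +
      algebraMap ℂ R ((α : ℂ) - 1) * Y 0)) (j : Fin 2) (hw : Y (surfIdx j) * w = 1) :
    (Y 3 * w) * (Y 4 * w) = Polynomial.aeval (Y 0 * w) (chartPoly α j) := by
  fin_cases j <;> simp [chartPoly, surfIdx] at hw ⊢ h'
  · linear_combination w ^ 2 * h' + w * Y 0 * (1 + algebraMap ℂ R (α : ℂ) * w * Y 2) * hw +
      w ^ 3 * Y 0 * algebraMap ℂ R (α : ℂ) * (-h)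
  · linear_combination w ^ 2 * h' + w * Y 0 * (-w * Y 1 - algebraMap ℂ R (α : ℂ)) * hw +
      w ^ 3 * Y 0 * h

theorem map_quarticY_rel (α : ℝ) {R : Type} [CommRing R] [Algebra ℂ R]
    [Algebra (MvPolynomial (Fin 5) ℂ ⧸ (quarticIdeal α).toIdeal) R]
    [IsScalarTower ℂ (MvPolynomial (Fin 5) ℂ ⧸ (quarticIdeal α).toIdeal) R] :
    algebraMap _ R (quarticY α 3) * algebraMap _ R (quarticY α 4) = algebraMap _ R (quarticY α 0) *
      (algebraMap _ R (quarticY α 1) - algebraMap ℂ R (α : ℂ) * algebraMap _ R (quarticY α 2) +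
      algebraMap ℂ R ((α : ℂ) - 1) * algebraMap _ R (quarticY α 0)) := by
  rw [← map_mul, quarticY_rel', IsScalarTower.algebraMap_apply ℂ
    (MvPolynomial (Fin 5) ℂ ⧸ (quarticIdeal α).toIdeal) R, IsScalarTower.algebraMap_apply ℂ
    (MvPolynomial (Fin 5) ℂ ⧸ (quarticIdeal α).toIdeal) R]
  simp only [map_mul, map_add, map_sub]

theorem isOpenImmersion_surfChart (α : ℝ) (j : Fin 2) : IsOpenImmersion (surfChart α j) ∧
    Set.range (surfChart α j) =
      Proj.basicOpen (quotGrading (quarticIdeal α)) (quarticY α (surfIdx j)) := by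
  set L := Localization.Away (quarticY α (surfIdx j))
  set w : L := IsLocalization.Away.invSelf (quarticY α (surfIdx j)) with hw
  have h1 : algebraMap _ L (quarticY α (surfIdx j)) * w = 1 :=
    IsLocalization.Away.mul_invSelf _
  have h2 : algebraMap _ L (quarticY α 1) * algebraMap _ L (quarticY α 2) =
    algebraMap _ L (quarticY α 0) ^ 2 := by rw [← map_mul, quarticY_rel, map_pow]
  refine (isCoordSystem_quarticY α).isOpenImmersion_coordPt _ _
    (surfTuple_idx j _ _ _ _) _ ?_ (Hyp.lift (algebraMap _ L (quarticY α 0) * w)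
      (algebraMap _ L (quarticY α 3) * w) (algebraMap _ L (quarticY α 4) * w)
      (mul_eq_aeval_chartPoly α (Y := fun k => algebraMap _ L (quarticY α k)) h2
        (map_quarticY_rel α) j h1)) ?_
  · refine adjoin_eq_top_of_subset Hyp.adjoin_eq_top ?_
    rintro _ (rfl | rfl | rfl)
    · refine ⟨0, ?_⟩
      fin_cases j <;> simp [surfTuple, conicTuple]
    · exact ⟨3, rfl⟩
    · exact ⟨4, rfl⟩
  · intro k
    rw [map_surfTuple, Hyp.lift_t, Hyp.lift_p, Hyp.lift_q, map_one]
    exact eq_mul_surfTuple (Y := fun k => algebraMap _ L (quarticY α k)) h2 j h1 k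

/-- Coordinates near the vertices `(0 : 0 : 0 : 1 : 0)` and `(0 : 0 : 0 : 0 : 1)` of the quartic
surface. -/
noncomputable def vertTuple (α : ℝ) {B : Type} [CommRing B] [Algebra ℂ B] (k : Fin 2) (t p q : B) :
    Fin 5 → B :=
  if k = 0 then ![t, p, q, 1, t * (p - algebraMap ℂ B (α : ℂ) * q +
    algebraMap ℂ B ((α : ℂ) - 1) * t)]
  else ![t, p, q, t * (p - algebraMap ℂ B (α : ℂ) * q +
    algebraMap ℂ B ((α : ℂ) - 1) * t), 1]

/-- The coordinate equal to one at a vertex. -/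
def vertIdx (k : Fin 2) : Fin 5 := if k = 0 then 3 else 4

section Vertex

variable {B B' : Type} [CommRing B] [Algebra ℂ B] [CommRing B'] [Algebra ℂ B'] (α : ℝ)

theorem vertTuple_idx (k : Fin 2) (t p q : B) : vertTuple α k t p q (vertIdx k) = 1 := by
  fin_cases k <;> simp [vertTuple, vertIdx]

theorem isUnit_vertTuple (k : Fin 2) (t p q : B) : IsUnit (vertTuple α k t p q (vertIdx k)) := by
  rw [vertTuple_idx]; exact isUnit_one

theorem map_vertTuple (φ : B →ₐ[ℂ] B') (k : Fin 2) (t p q : B) (i : Fin 5) :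
    φ (vertTuple α k t p q i) = vertTuple α k (φ t) (φ p) (φ q) i := by
  fin_cases k <;> fin_cases i <;> simp [vertTuple]

theorem isPt_vertTuple (k : Fin 2) {t p q : B} (h : p * q = t ^ 2) :
    IsPt (quarticY α) (vertTuple α k t p q) := by
  apply isPt_quarticY
  · fin_cases k <;> simp [vertTuple, h]
  · fin_cases k <;> simp [vertTuple]

theorem eq_mul_vertTuple {Y : Fin 5 → B} {w : B}
    (h' : Y 3 * Y 4 = Y 0 * (Y 1 - algebraMap ℂ B (α : ℂ) * Y 2 +
      algebraMap ℂ B ((α : ℂ) - 1) * Y 0)) (k : Fin 2) (hw : Y (vertIdx k) * w = 1) (i : Fin 5) :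
    Y i = Y (vertIdx k) * vertTuple α k (Y 0 * w) (Y 1 * w) (Y 2 * w) i := by
  fin_cases k <;> fin_cases i <;> simp [vertTuple, vertIdx] at hw h' ⊢
  · linear_combination (-Y 0) * hw
  · linear_combination (-Y 1) * hw
  · linear_combination (-Y 2) * hw
  · linear_combination (-Y 4) * (1 + Y 3 * w) * hw + Y 3 * w ^ 2 * h'
  · linear_combination (-Y 0) * hw
  · linear_combination (-Y 1) * hw
  · linear_combination (-Y 2) * hw
  · linear_combination (-Y 3) * (1 + Y 4 * w) * hw + Y 4 * w ^ 2 * h'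

/-- The coordinate ring of the quadric cone. -/
abbrev Cone : Type := Hyp (Polynomial.X ^ 2)

theorem Cone.rel : Hyp.x (Polynomial.X ^ 2) 1 * Hyp.x (Polynomial.X ^ 2) 2 =
    (Hyp.x (Polynomial.X ^ 2) 0) ^ 2 := by
  rw [Hyp.rel]; simp

/-- The chart `y_k ≠ 0` of the quartic surface, for `k = 3, 4`. -/
noncomputable def vertChart (k : Fin 2) : Spec (.of Cone) ⟶ Quartic α :=
  coordPt (isCoordSystem_quarticY α) (isPt_vertTuple α k Cone.rel) (vertIdx k)
    (isUnit_vertTuple α k _ _ _)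

theorem isOpenImmersion_vertChart (k : Fin 2) : IsOpenImmersion (vertChart α k) ∧
    Set.range (vertChart α k) =
      Proj.basicOpen (quotGrading (quarticIdeal α)) (quarticY α (vertIdx k)) := by
  set L := Localization.Away (quarticY α (vertIdx k))
  set w : L := IsLocalization.Away.invSelf (quarticY α (vertIdx k)) with hw
  have h1 : algebraMap _ L (quarticY α (vertIdx k)) * w = 1 :=
    IsLocalization.Away.mul_invSelf _
  have h2 : algebraMap _ L (quarticY α 1) * algebraMap _ L (quarticY α 2) =
    algebraMap _ L (quarticY α 0) ^ 2 := by rw [← map_mul, quarticY_rel, map_pow]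
  have h3 : algebraMap _ L (quarticY α 1) * w * (algebraMap _ L (quarticY α 2) * w) =
      Polynomial.aeval (algebraMap _ L (quarticY α 0) * w) (Polynomial.X ^ 2 : Polynomial ℂ) := by
    rw [map_pow, Polynomial.aeval_X]
    linear_combination w ^ 2 * h2
  refine (isCoordSystem_quarticY α).isOpenImmersion_coordPt _ _
    (vertTuple_idx α k _ _ _) _ ?_ (Hyp.lift _ _ _ h3) ?_
  · refine adjoin_eq_top_of_subset Hyp.adjoin_eq_top ?_
    rintro _ (rfl | rfl | rfl)
    · refine ⟨0, ?_⟩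
      fin_cases k <;> simp [vertTuple]
    · refine ⟨1, ?_⟩
      fin_cases k <;> simp [vertTuple]
    · refine ⟨2, ?_⟩
      fin_cases k <;> simp [vertTuple]
  · intro i
    rw [map_vertTuple, Hyp.lift_t, Hyp.lift_p, Hyp.lift_q]
    exact eq_mul_vertTuple α (Y := fun k => algebraMap _ L (quarticY α k)) (map_quarticY_rel α)
      k h1 i

end Vertex

/-- The four charts cover the quartic surface. -/
theorem quartic_cover (α : ℝ) (z : Quartic α) :
    (∃ j, z ∈ Proj.basicOpen (quotGrading (quarticIdeal α)) (quarticY α (surfIdx j))) ∨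
    (∃ k, z ∈ Proj.basicOpen (quotGrading (quarticIdeal α)) (quarticY α (vertIdx k))) := by
  have h : z ∈ ⨆ i, Proj.basicOpen (quotGrading (quarticIdeal α)) (quarticY α i) := by
    rw [(isCoordSystem_quarticY α).iSup_basicOpen]; trivial
  obtain ⟨i, hi⟩ := TopologicalSpace.Opens.mem_iSup.mp h
  fin_cases i
  -- The chart y₀ ≠ 0 is superfluous: y₀² = y₁ y₂, so y₁ ≠ 0 on it.
  · refine Or.inl ⟨0, fun h1 => hi ?_⟩
    have h2 : quarticY α 0 ^ 2 ∈ z.asHomogeneousIdeal.toIdeal := by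
      rw [← quarticY_rel]
      exact Ideal.mul_mem_right _ _ h1
    exact z.isPrime.mem_of_pow_mem 2 h2
  · exact Or.inl ⟨0, hi⟩
  · exact Or.inl ⟨1, hi⟩
  · exact Or.inr ⟨0, hi⟩
  · exact Or.inr ⟨1, hi⟩

theorem conic_cover (z : Conic) :
    ∃ j, z ∈ Proj.basicOpen (quotGrading conicIdeal) (conicY (conicIdx j)) := by
  have h : z ∈ ⨆ i, Proj.basicOpen (quotGrading conicIdeal) (conicY i) := by
    rw [isCoordSystem_conicY.iSup_basicOpen]; trivial
  obtain ⟨i, hi⟩ := TopologicalSpace.Opens.mem_iSup.mp h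
  fin_cases i
  · refine ⟨0, fun h1 => hi ?_⟩
    have h2 : conicY 0 ^ 2 ∈ z.asHomogeneousIdeal.toIdeal := by
      rw [← conicY_rel]
      exact Ideal.mul_mem_right _ _ h1
    exact z.isPrime.mem_of_pow_mem 2 h2
  · exact ⟨0, hi⟩
  · exact ⟨1, hi⟩

end Minitwistor

namespace Minitwistor

/-! ### Charts of scheme-theoretic images -/

/-- A locally closed subscheme in which `ξ` factors through a scheme-theoretically dominant map is
an open subscheme of the scheme-theoretic image of `ξ`. -/
theorem exists_isOpenImmersion_image {S W U Z : Scheme.{0}} (ξ : S ⟶ Z) (η : S ⟶ W) (i : W ⟶ U)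
    (o : U ⟶ Z) [IsClosedImmersion i] [IsOpenImmersion o] [QuasiCompact (i ≫ o)]
    [IsSchemeTheoreticallyDominant η] (h : η ≫ i ≫ o = ξ) :
    ∃ k : W ⟶ ξ.image, k ≫ ξ.imageι = i ≫ o ∧ IsOpenImmersion k ∧ η ≫ k = ξ.toImage ∧
      Set.range k = ξ.imageι ⁻¹' Set.range o := by
  -- Precomposing with a dominant η loses no equations, so ξ and the inclusion of W cut out the same
  -- closed subscheme, in which W is open.
  have hker : ξ.ker = (i ≫ o).ker := by
    rw [← h, Scheme.Hom.ker_comp η, η.ker_eq_bot, Scheme.IdealSheafData.map_bot]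
  have main : ∀ (I : Z.IdealSheafData), I = (i ≫ o).ker → ∃ k : W ⟶ I.subscheme,
      k ≫ I.subschemeι = i ≫ o ∧ IsOpenImmersion k := by
    rintro _ rfl
    exact ⟨(i ≫ o).toImage, (i ≫ o).toImage_imageι, inferInstance⟩
  obtain ⟨k, hk, hk'⟩ := main ξ.ker hker
  refine ⟨k, hk, hk', ?_, ?_⟩
  · refine (cancel_mono ξ.imageι).mp ?_
    rw [ξ.toImage_imageι, Category.assoc]
    exact (congrArg (η ≫ ·) hk).trans h
  · ext x
    constructor
    · rintro ⟨w, rfl⟩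
      refine ⟨i w, ?_⟩
      rw [← Scheme.Hom.comp_apply, ← Scheme.Hom.comp_apply]
      exact congrArg (fun f : W ⟶ Z => f w) hk.symm
    · rintro ⟨u, hu⟩
      have h1 : o u ∈ closure (Set.range (i ≫ o)) := by
        rw [hu, ← Scheme.Hom.support_ker, ← hker, ← Scheme.IdealSheafData.range_subschemeι]
        exact ⟨x, rfl⟩
      have h2 : u ∈ closure (o ⁻¹' Set.range (i ≫ o)) := by
        rw [← o.isOpenEmbedding.isOpenMap.preimage_closure_eq_closure_preimage o.continuous]
        exact h1
      have h3 : o ⁻¹' Set.range (i ≫ o) = Set.range i := by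
        ext v
        constructor
        · rintro ⟨w, hw⟩
          exact ⟨w, o.isOpenEmbedding.injective (by rw [← hw, Scheme.Hom.comp_apply])⟩
        · rintro ⟨w, rfl⟩
          exact ⟨w, by rw [Scheme.Hom.comp_apply]⟩
      rw [h3, i.isClosedEmbedding.isClosed_range.closure_eq] at h2
      obtain ⟨w, rfl⟩ := h2
      refine ⟨w, ξ.imageι.isEmbedding.injective ?_⟩
      rw [← hu, ← Scheme.Hom.comp_apply, ← Scheme.Hom.comp_apply]
      exact congrArg (fun f : W ⟶ Z => f w) hk

theorem isDominant_SpecMap {R S : Type} [CommRing R] [CommRing S] [IsDomain R] (φ : R →+* S)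
    (h : Function.Injective φ) : IsDominant (Spec.map (CommRingCat.ofHom φ)) := by
  refine ⟨?_⟩
  exact (PrimeSpectrum.denseRange_comap_iff_ker_le_nilRadical φ).mpr (by
    rw [(RingHom.injective_iff_ker_eq_bot φ).mp h]; exact bot_le)

theorem isSchemeTheoreticallyDominant_SpecMap {R S : Type} [CommRing R] [CommRing S] [IsDomain R]
    (φ : R →+* S) (h : Function.Injective φ) :
    IsSchemeTheoreticallyDominant (Spec.map (CommRingCat.ofHom φ)) := by
  have := isDominant_SpecMap φ h
  have : IsReduced (Spec (.of R)) := inferInstance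
  exact .of_isDominant _

/-! ### Generic coordinates -/

/-- The polynomial `y₃ y₄` in generic coordinates. -/
noncomputable def RatField.h (α : ℝ) : RatField := Polynomial.aeval RatField.t (chartPoly α 0)

theorem RatField.h_ne_zero (α : ℝ) : RatField.h α ≠ 0 :=
  RatField.aeval_t_ne_zero (chartPoly_ne_zero α 0)

/-- The generic value of the parameter of the chart `j` of the conic. -/
noncomputable def RatField.tau (j : Fin 2) : RatField := if j = 0 then RatField.t else RatField.t⁻¹

/-- The generic factor between the two parametrizations of the conic. -/
noncomputable def RatField.scale (j : Fin 2) : RatField := if j = 0 then 1 else RatField.t ^ 2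

theorem RatField.scale_ne_zero (j : Fin 2) : RatField.scale j ≠ 0 := by
  fin_cases j <;> simp [RatField.scale, RatField.t_ne_zero]

theorem RatField.conicTuple_eq (j : Fin 2) (k : Fin 3) :
    conicTuple 0 RatField.t k = RatField.scale j * conicTuple j (RatField.tau j) k := by
  fin_cases j
  · simp [RatField.scale, RatField.tau]
  · simp only [RatField.scale, RatField.tau]
    exact (conicTuple_one_inv RatField.t_ne_zero k).symm

theorem RatField.h_eq (α : ℝ) (j : Fin 2) :
    RatField.h α = RatField.scale j ^ 2 * Polynomial.aeval (RatField.tau j) (chartPoly α j) := by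
  fin_cases j
  · simp [RatField.scale, RatField.tau, RatField.h]
  · simp only [RatField.scale, RatField.tau, RatField.h]
    rw [← aeval_chartPoly_one_inv α RatField.t_ne_zero]
    simp [← pow_mul]

/-- The generic point of the quartic surface, in coordinates. -/
noncomputable def RatField.tuple (α : ℝ) : Fin 5 → RatField :=
  surfTuple 0 RatField.t 1 RatField.p (RatField.h α / RatField.p)

theorem RatField.tuple_eq (α : ℝ) (j : Fin 2) (u : RatField) (hu : u ≠ 0) (k : Fin 5) :
    RatField.tuple α k = u * surfTuple j (RatField.tau j) (RatField.scale j / u) (RatField.p / u)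
      (RatField.h α / RatField.p / u) k := by
  rw [RatField.tuple]
  fin_cases k
  · simp [surfTuple, RatField.conicTuple_eq j]; field_simp
  · simp [surfTuple, RatField.conicTuple_eq j]; field_simp
  · simp [surfTuple, RatField.conicTuple_eq j]; field_simp
  · simp [surfTuple]; field_simp
  · simp [surfTuple]; field_simp

theorem isPt_tuple (α : ℝ) : IsPt (quarticY α) (RatField.tuple α) := by
  apply isPt_surfTuple
  rw [one_pow, one_mul, mul_div_cancel₀ _ RatField.p_ne_zero, RatField.h]

/-- The generic point of the quartic surface. -/
noncomputable def genPt (α : ℝ) : Spec (.of RatField) ⟶ Quartic α :=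
  coordPt (isCoordSystem_quarticY α) (isPt_tuple α) 1 (isUnit_surfTuple 0 _ _ _)

/-- The image of the generic point of the quartic surface in the conic. -/
noncomputable def genConicPt : Spec (.of RatField) ⟶ Conic :=
  coordPt isCoordSystem_conicY (isPt_conicTuple 0 RatField.t) 1 (isUnit_conicTuple 0 _)

/-- The generic homomorphism of the chart `j`. -/
noncomputable def surfHom (α : ℝ) (j : Fin 2) : Hyp (chartPoly α j) →ₐ[ℂ] RatField :=
  Hyp.lift (RatField.tau j) (RatField.p / RatField.scale j)
    (RatField.h α / RatField.p / RatField.scale j) (by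
      have h1 := RatField.h_eq α j
      have h2 := RatField.scale_ne_zero j
      have h3 := RatField.p_ne_zero
      rw [h1]
      field_simp)

/-- Homogeneous coordinates `(x e(t) : 1 : x² h(t))` and `(x e(t) : x² h(t) : 1)` on the blow-up of
the vertices of the quartic surface. -/
noncomputable def blowTuple (α : ℝ) {B : Type} [CommRing B] [Algebra ℂ B] (k j : Fin 2) (t x : B) :
    Fin 5 → B :=
  if k = 0 then surfTuple j t x 1 (x ^ 2 * Polynomial.aeval t (chartPoly α j))
  else surfTuple j t x (x ^ 2 * Polynomial.aeval t (chartPoly α j)) 1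

section Blow

variable (α : ℝ) {B : Type} [CommRing B] [Algebra ℂ B] {B' : Type} [CommRing B'] [Algebra ℂ B']

theorem blowTuple_idx (k j : Fin 2) (t x : B) : blowTuple α k j t x (vertIdx k) = 1 := by
  fin_cases k <;> simp [blowTuple, vertIdx, surfTuple]

theorem isUnit_blowTuple (k j : Fin 2) (t x : B) : IsUnit (blowTuple α k j t x (vertIdx k)) := by
  rw [blowTuple_idx]; exact isUnit_one

theorem map_blowTuple (φ : B →ₐ[ℂ] B') (k j : Fin 2) (t x : B) (i : Fin 5) :
    φ (blowTuple α k j t x i) = blowTuple α k j (φ t) (φ x) i := by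
  have h : φ (Polynomial.aeval t (chartPoly α j)) = Polynomial.aeval (φ t) (chartPoly α j) :=
    (Polynomial.aeval_algHom_apply _ _ _).symm
  fin_cases k <;> simp [blowTuple, map_surfTuple, h]

theorem isPt_blowTuple (k j : Fin 2) (t x : B) : IsPt (quarticY α) (blowTuple α k j t x) := by
  fin_cases k
  · exact isPt_surfTuple α j (one_mul _)
  · exact isPt_surfTuple α j (mul_one _)

/-- The generic value of the fibre coordinate on the charts of the blow-up. -/
noncomputable def RatField.fib (k j : Fin 2) : RatField :=
  RatField.scale j / (if k = 0 then RatField.p else RatField.h α / RatField.p)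

/-- Normalizing the generic point by y₃ = p or y₄ = h/p scales its conic part to x·e(τ); the other
vertex coordinate must then be x²h(τ). -/
theorem RatField.tuple_eq_blowTuple (k j : Fin 2) (i : Fin 5) :
    RatField.tuple α i = (if k = 0 then RatField.p else RatField.h α / RatField.p) *
      blowTuple α k j (RatField.tau j) (RatField.fib α k j) i := by
  have hp := RatField.p_ne_zero
  have hh := RatField.h_ne_zero α
  have hs := RatField.scale_ne_zero j
  have h1 := RatField.h_eq α j
  have h2 : Polynomial.aeval (RatField.tau j) (chartPoly α j) =
      RatField.h α / RatField.scale j ^ 2 := by rw [h1]; field_simp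
  fin_cases k
  · have e : RatField.h α / RatField.p / RatField.p =
        (RatField.scale j / RatField.p) ^ 2 * (RatField.h α / RatField.scale j ^ 2) := by field_simp
    rw [RatField.tuple_eq α j RatField.p hp, e, div_self hp]
    simp only [blowTuple, RatField.fib, h2]
    rfl
  · have e : RatField.p / (RatField.h α / RatField.p) =
        (RatField.scale j / (RatField.h α / RatField.p)) ^ 2 *
          (RatField.h α / RatField.scale j ^ 2) := by field_simp
    rw [RatField.tuple_eq α j (RatField.h α / RatField.p) (div_ne_zero hh hp), e,
      div_self (div_ne_zero hh hp)]
    simp only [blowTuple, RatField.fib, h2]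
    rfl

theorem RatField.isAlgebraic_h {R : Subalgebra ℂ RatField} (ht : IsAlgebraic R RatField.t) :
    IsAlgebraic R (RatField.h α) := by
  let C := (Subalgebra.algebraicClosure R RatField).restrictScalars ℂ
  have h1 := (Polynomial.aeval (⟨RatField.t, ht⟩ : C) (chartPoly α 0)).2
  have h2 := Polynomial.aeval_algHom_apply C.val (⟨RatField.t, ht⟩ : C) (chartPoly α 0)
  change Polynomial.aeval RatField.t (chartPoly α 0) = _ at h2
  rw [RatField.h, h2]
  exact h1

/-- Both t and p are rational functions of τ and the fibre coordinate, so these two are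
algebraically independent. -/
theorem RatField.aeval_tau_fib_injective (k j : Fin 2) : Function.Injective
    (MvPolynomial.aeval ![RatField.tau j, RatField.fib α k j] : Plane →ₐ[ℂ] RatField) := by
  set R := Algebra.adjoin ℂ (Set.range ![RatField.tau j, RatField.fib α k j])
  have h0 : IsAlgebraic R (RatField.tau j) :=
    isAlgebraic_algebraMap (⟨RatField.tau j, Algebra.subset_adjoin ⟨0, rfl⟩⟩ : R)
  have h1 : IsAlgebraic R (RatField.fib α k j) :=
    isAlgebraic_algebraMap (⟨RatField.fib α k j, Algebra.subset_adjoin ⟨1, rfl⟩⟩ : R)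
  have ht : IsAlgebraic R RatField.t := by
    fin_cases j
    · exact h0
    · simpa [RatField.tau] using h0.inv
  have hs : IsAlgebraic R (RatField.scale j) := by
    fin_cases j
    · exact isAlgebraic_one
    · exact ht.pow 2
  have hh := RatField.isAlgebraic_h α ht
  have hp' := RatField.p_ne_zero
  have hh' := RatField.h_ne_zero α
  have hs' := RatField.scale_ne_zero j
  refine RatField.aeval_injective ht ?_
  fin_cases k
  · have : RatField.p = RatField.scale j * (RatField.fib α 0 j)⁻¹ := by
      simp [RatField.fib]; field_simp
    rw [this]
    exact hs.mul h1.inv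
  · have : RatField.p = RatField.h α * RatField.fib α 1 j * (RatField.scale j)⁻¹ := by
      simp [RatField.fib]; field_simp
    rw [this]
    exact (hh.mul h1).mul hs.inv

theorem surfHom_injective (j : Fin 2) : Function.Injective (surfHom α j) := by
  refine Hyp.lift_injective_of_aeval_injective (chartPoly_ne_zero α j) _ ?_
  set R := Algebra.adjoin ℂ (Set.range ![RatField.tau j, RatField.p / RatField.scale j])
  have h0 : IsAlgebraic R (RatField.tau j) :=
    isAlgebraic_algebraMap (⟨RatField.tau j, Algebra.subset_adjoin ⟨0, rfl⟩⟩ : R)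
  have h1 : IsAlgebraic R (RatField.p / RatField.scale j) :=
    isAlgebraic_algebraMap (⟨_, Algebra.subset_adjoin ⟨1, rfl⟩⟩ : R)
  have ht : IsAlgebraic R RatField.t := by
    fin_cases j
    · exact h0
    · simpa [RatField.tau] using h0.inv
  have hs : IsAlgebraic R (RatField.scale j) := by
    fin_cases j
    · exact isAlgebraic_one
    · exact ht.pow 2
  refine RatField.aeval_injective ht ?_
  have := h1.mul hs
  rwa [div_mul_cancel₀ RatField.p (RatField.scale_ne_zero j)] at this

theorem SpecMap_surfHom_surfChart (j : Fin 2) :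
    Spec.map (CommRingCat.ofHom (surfHom α j).toRingHom) ≫ surfChart α j = genPt α := by
  refine SpecMap_coordPt _ _ _ _ _ _ _ _ (RatField.scale j) fun k => ?_
  rw [map_surfTuple, RatField.tuple_eq α j _ (RatField.scale_ne_zero j), surfHom, Hyp.lift_t,
    Hyp.lift_p, Hyp.lift_q, map_one, div_self (RatField.scale_ne_zero j)]

end Blow

end Minitwistor

namespace Minitwistor

open Limits MvPolynomial

/-! ### The model of the resolution -/

/-- The structure morphism of the conic. -/
noncomputable abbrev Conic.str : Conic ⟶ Spec (.of ℂ) := projStr (quotGrading conicIdeal)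

instance : IsProper Conic.str := isCoordSystem_conicY.isProper

instance (α : ℝ) : IsProper (Quartic.str α) := (isCoordSystem_quarticY α).isProper

instance (j : Fin 2) : IsOpenImmersion (conicChart j) := (isOpenImmersion_conicChart j).1

instance (α : ℝ) (j : Fin 2) : IsOpenImmersion (surfChart α j) := (isOpenImmersion_surfChart α j).1

instance (α : ℝ) (k : Fin 2) : IsOpenImmersion (vertChart α k) := (isOpenImmersion_vertChart α k).1

/-- The open subset `y_i ≠ 0` of the quartic surface. -/
noncomputable abbrev surfOpen (α : ℝ) (i : Fin 5) : (Quartic α).Opens :=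
  Proj.basicOpen (quotGrading (quarticIdeal α)) (quarticY α i)

/-- The open subset `z_i ≠ 0` of the conic. -/
noncomputable abbrev conicOpen (i : Fin 3) : Conic.Opens :=
  Proj.basicOpen (quotGrading conicIdeal) (conicY i)

/-- The `B`-valued point of the conic with parameter `t` in the chart `j`. -/
noncomputable def conicPt {B : Type} [CommRing B] [Algebra ℂ B] (j : Fin 2) (t : B) :
    Spec (.of B) ⟶ Conic :=
  coordPt isCoordSystem_conicY (isPt_conicTuple j t) (conicIdx j) (isUnit_conicTuple j _)

/-- The `B`-valued point of the quartic surface with parameters `t`, `x` in the charts of the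
blow-up. -/
noncomputable def blowPt (α : ℝ) {B : Type} [CommRing B] [Algebra ℂ B] (k j : Fin 2) (t x : B) :
    Spec (.of B) ⟶ Quartic α :=
  coordPt (isCoordSystem_quarticY α) (isPt_blowTuple α k j t x) (vertIdx k)
    (isUnit_blowTuple α k j t x)

section Points

variable {B : Type} [CommRing B] [Algebra ℂ B] {B' : Type} [CommRing B'] [Algebra ℂ B'] (α : ℝ)

theorem SpecMap_conicPt (φ : B →ₐ[ℂ] B') (j : Fin 2) (t : B) :
    Spec.map (CommRingCat.ofHom φ.toRingHom) ≫ conicPt j t = conicPt j (φ t) :=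
  SpecMap_coordPt _ _ _ _ _ _ _ _ 1 fun k => by rw [map_conicTuple, one_mul]

theorem SpecMap_blowPt (φ : B →ₐ[ℂ] B') (k j : Fin 2) (t x : B) :
    Spec.map (CommRingCat.ofHom φ.toRingHom) ≫ blowPt α k j t x = blowPt α k j (φ t) (φ x) :=
  SpecMap_coordPt _ _ _ _ _ _ _ _ 1 fun k => by rw [map_blowTuple, one_mul]

theorem conicPt_eq (j : Fin 2) (t : B) : conicPt j t =
    Spec.map (CommRingCat.ofHom (Polynomial.aeval (R := ℂ) t).toRingHom) ≫ conicChart j :=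
  (SpecMap_coordPt _ _ _ _ _ _ _ _ 1 fun k => by
    rw [map_conicTuple, one_mul, Polynomial.aeval_X]).symm

/-- A blow-up point has cone coordinates x·e(t); x²h(t) is then the coordinate prescribed by the
second equation of the quartic. -/
theorem blowTuple_eq_vertTuple (k j : Fin 2) (t x : B) :
    blowTuple α k j t x = vertTuple α k (x * conicTuple j t 0) (x * conicTuple j t 1)
      (x * conicTuple j t 2) := by
  fin_cases k <;> fin_cases j <;> funext i <;> fin_cases i <;>
    simp [blowTuple, vertTuple, surfTuple, conicTuple, chartPoly] <;> ring

/-- The homomorphism from the coordinate ring of the cone to that of a chart of the blow-up. -/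
noncomputable def coneHom (j : Fin 2) (t x : B) : Cone →ₐ[ℂ] B :=
  Hyp.lift (x * conicTuple j t 0) (x * conicTuple j t 1) (x * conicTuple j t 2) (by
    fin_cases j <;> simp [conicTuple] <;> ring)

theorem blowPt_eq (k j : Fin 2) (t x : B) : blowPt α k j t x =
    Spec.map (CommRingCat.ofHom (coneHom j t x).toRingHom) ≫ vertChart α k :=
  (SpecMap_coordPt _ _ _ _ _ _ _ _ 1 fun i => by
    rw [map_vertTuple, one_mul, coneHom, Hyp.lift_t, Hyp.lift_p, Hyp.lift_q,
      ← blowTuple_eq_vertTuple]).symm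

theorem conicPt_str (j : Fin 2) (t : B) :
    conicPt j t ≫ Conic.str = Spec.map (CommRingCat.ofHom (algebraMap ℂ B)) :=
  coordPt_projStr _ _ _ _

theorem blowPt_str (k j : Fin 2) (t x : B) :
    blowPt α k j t x ≫ Quartic.str α = Spec.map (CommRingCat.ofHom (algebraMap ℂ B)) :=
  coordPt_projStr _ _ _ _

theorem surfChart_str (j : Fin 2) : surfChart α j ≫ Quartic.str α =
    Spec.map (CommRingCat.ofHom (algebraMap ℂ (Hyp (chartPoly α j)))) :=
  coordPt_projStr _ _ _ _

theorem vertChart_str (k : Fin 2) : vertChart α k ≫ Quartic.str α =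
    Spec.map (CommRingCat.ofHom (algebraMap ℂ Cone)) :=
  coordPt_projStr _ _ _ _

theorem conicChart_str (j : Fin 2) : conicChart j ≫ Conic.str =
    Spec.map (CommRingCat.ofHom (algebraMap ℂ (Polynomial ℂ))) :=
  coordPt_projStr _ _ _ _

theorem genPt_str : genPt α ≫ Quartic.str α =
    Spec.map (CommRingCat.ofHom (algebraMap ℂ RatField)) :=
  coordPt_projStr _ _ _ _

theorem genConicPt_str : genConicPt ≫ Conic.str =
    Spec.map (CommRingCat.ofHom (algebraMap ℂ RatField)) :=
  coordPt_projStr _ _ _ _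

end Points

/-- The product of the quartic surface and the conic. -/
noncomputable abbrev ambient (α : ℝ) : Scheme.{0} := pullback (Quartic.str α) Conic.str

/-- The generic point of the graph of the projection. -/
noncomputable def graphPt (α : ℝ) : Spec (.of RatField) ⟶ ambient α :=
  pullback.lift (genPt α) genConicPt (by rw [genPt_str, genConicPt_str])

/-- The properties of the resolution of the quartic surface, with its morphism to the conic, from
which everything else is derived: it has the affine charts of the blow-up of the two vertices. -/
structure IsModel (α : ℝ) {E : Scheme.{0}} (ρ : E ⟶ Quartic α) (g : E ⟶ Conic) : Prop where
  proper : IsProper ρ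
  comm : g ≫ Conic.str = ρ ≫ Quartic.str α
  gen : ∃ η : Spec (.of RatField) ⟶ E, IsDominant η ∧ η ≫ ρ = genPt α
  surf : ∀ j, ∃ κ : Spec (.of (Hyp (chartPoly α j))) ⟶ E, IsOpenImmersion κ ∧
    κ ≫ ρ = surfChart α j ∧ κ ≫ g = conicPt j (Hyp.x (chartPoly α j) 0) ∧
    Set.range κ = ρ ⁻¹' (surfOpen α (surfIdx j))
  vert : ∀ k j, ∃ κ : Spec (.of Plane) ⟶ E, IsOpenImmersion κ ∧
    κ ≫ ρ = blowPt α k j (X 0) (X 1) ∧ κ ≫ g = conicPt j (X 0 : Plane) ∧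
    Set.range κ = ρ ⁻¹' (surfOpen α (vertIdx k)) ∩ g ⁻¹' (conicOpen (conicIdx j))

/-- The morphism is Spec of R₁ ⊗ R₂ → S, which is surjective once the two images generate S. -/
theorem isClosedImmersion_lift_SpecMap {R₁ R₂ S : Type} [CommRing R₁] [CommRing R₂] [CommRing S]
    [Algebra ℂ R₁] [Algebra ℂ R₂] [Algebra ℂ S] (φ₁ : R₁ →ₐ[ℂ] S) (φ₂ : R₂ →ₐ[ℂ] S)
    (h : Algebra.adjoin ℂ (Set.range φ₁ ∪ Set.range φ₂) = ⊤) (w) :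
    IsClosedImmersion (pullback.lift (f := Spec.map (CommRingCat.ofHom (algebraMap ℂ R₁)))
      (g := Spec.map (CommRingCat.ofHom (algebraMap ℂ R₂)))
      (Spec.map (CommRingCat.ofHom φ₁.toRingHom)) (Spec.map (CommRingCat.ofHom φ₂.toRingHom)) w) := by
  let ψ := Algebra.TensorProduct.productMap φ₁ φ₂
  have hψ : Function.Surjective ψ := by
    rw [← AlgHom.range_eq_top, ← top_le_iff, ← h, Algebra.adjoin_le_iff]
    rintro _ (⟨a, rfl⟩ | ⟨b, rfl⟩)
    · exact ⟨a ⊗ₜ 1, by simp [ψ]⟩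
    · exact ⟨1 ⊗ₜ b, by simp [ψ]⟩
  have : IsClosedImmersion (Spec.map (CommRingCat.ofHom ψ.toRingHom)) :=
    IsClosedImmersion.spec_of_surjective _ hψ
  have heq : pullback.lift (f := Spec.map (CommRingCat.ofHom (algebraMap ℂ R₁)))
      (g := Spec.map (CommRingCat.ofHom (algebraMap ℂ R₂)))
      (Spec.map (CommRingCat.ofHom φ₁.toRingHom)) (Spec.map (CommRingCat.ofHom φ₂.toRingHom)) w =
      Spec.map (CommRingCat.ofHom ψ.toRingHom) ≫ (pullbackSpecIso ℂ R₁ R₂).inv := by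
    apply pullback.hom_ext
    · rw [pullback.lift_fst, Category.assoc, pullbackSpecIso_inv_fst, ← Spec.map_comp,
        ← CommRingCat.ofHom_comp]
      congr 2
      ext a
      simp [ψ]
    · rw [pullback.lift_snd, Category.assoc, pullbackSpecIso_inv_snd, ← Spec.map_comp,
        ← CommRingCat.ofHom_comp]
      congr 2
      ext a
      simp [ψ]
  rw [heq]
  infer_instance

/-- Closedness of the chart inside U is tested after a further morphism g: separatedness of g ≫ a
makes g separated, and then the first factor of a closed immersion is closed. -/
theorem exists_chart_image {S Z A : Scheme.{0}} {R : Type} [CommRing R] (ξ : S ⟶ Z)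
    (η : S ⟶ Spec (.of R)) (c : Spec (.of R) ⟶ Z) (s : Z ⟶ Spec (.of ℂ)) [IsSeparated s]
    [IsSchemeTheoreticallyDominant η] (h : η ≫ c = ξ) (U : Z.Opens) (hU : Set.range c ⊆ U)
    (g : U.toScheme ⟶ A) (a : A ⟶ Spec (.of ℂ)) (hga : g ≫ a = U.ι ≫ s)
    [IsClosedImmersion (IsOpenImmersion.lift U.ι c (by simpa using hU) ≫ g)] :
    ∃ k : Spec (.of R) ⟶ ξ.image, k ≫ ξ.imageι = c ∧ IsOpenImmersion k ∧
      Set.range k = ξ.imageι ⁻¹' U := by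
  set i := IsOpenImmersion.lift U.ι c (by simpa using hU)
  have hi : i ≫ U.ι = c := IsOpenImmersion.lift_fac _ _ _
  have h1 : IsSeparated (g ≫ a) := by rw [hga]; infer_instance
  have h2 : IsSeparated g := .of_comp g a
  have h3 : IsClosedImmersion i := .of_comp i g
  have h4 : QuasiCompact (c ≫ s) := inferInstance
  have h5 : QuasiCompact c := .of_comp c s
  have h6 : QuasiCompact (i ≫ U.ι) := by rwa [hi]
  obtain ⟨k, hk1, hk2, -, hk3⟩ := exists_isOpenImmersion_image ξ η i U.ι (by rw [hi, h])
  refine ⟨k, by rw [hk1, hi], hk2, by rw [hk3]; simp⟩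

theorem conicPt_tau (j : Fin 2) : conicPt j (RatField.tau j) = genConicPt :=
  coordPt_congr _ _ _ _ _ _ _ _ (RatField.conicTuple_eq j)

theorem isModel_image (α : ℝ) : IsModel α ((graphPt α).imageι ≫ pullback.fst _ _)
    ((graphPt α).imageι ≫ pullback.snd _ _) where
  proper := inferInstance
  comm := by rw [Category.assoc, Category.assoc, pullback.condition]
  gen := by
    have h : QuasiCompact (graphPt α) := .of_comp _ (pullback.fst _ _ ≫ Quartic.str α)
    refine ⟨(graphPt α).toImage, inferInstance, ?_⟩
    rw [← Category.assoc, Scheme.Hom.toImage_imageι, graphPt, pullback.lift_fst]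
  surf j := by
    set c : Spec (.of (Hyp (chartPoly α j))) ⟶ ambient α :=
      pullback.lift (surfChart α j) (conicPt j (Hyp.x (chartPoly α j) 0))
        (by rw [surfChart_str, conicPt_str]) with hc
    have hc1 : c ≫ pullback.fst _ _ = surfChart α j := pullback.lift_fst _ _ _
    have hc2 : c ≫ pullback.snd _ _ = conicPt j (Hyp.x (chartPoly α j) 0) := pullback.lift_snd _ _ _
    let U : (ambient α).Opens := pullback.fst (Quartic.str α) Conic.str ⁻¹ᵁ surfOpen α (surfIdx j)
    have hU : Set.range c ⊆ U := by
      rintro _ ⟨w, rfl⟩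
      change (pullback.fst (Quartic.str α) Conic.str) (c w) ∈ (surfOpen α (surfIdx j) : Set _)
      rw [← (isOpenImmersion_surfChart α j).2, ← Scheme.Hom.comp_apply, hc1]
      exact ⟨w, rfl⟩
    have hr : Set.range (U.ι ≫ pullback.fst (Quartic.str α) Conic.str) ⊆
        Set.range (surfChart α j) := by
      rw [(isOpenImmersion_surfChart α j).2]
      rintro _ ⟨w, rfl⟩
      rw [Scheme.Hom.comp_apply]
      exact w.2
    let g := IsOpenImmersion.lift (surfChart α j) _ hr
    have hg : g ≫ surfChart α j = U.ι ≫ pullback.fst _ _ := IsOpenImmersion.lift_fac _ _ _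
    -- Over this open set the chart is the graph of t, and `g` retracts it.
    have hcl : IsClosedImmersion (IsOpenImmersion.lift U.ι c (by simpa using hU) ≫ g) := by
      have : IsOpenImmersion.lift U.ι c (by simpa using hU) ≫ g = 𝟙 _ := by
        rw [← cancel_mono (surfChart α j), Category.assoc, hg, IsOpenImmersion.lift_fac_assoc, hc1,
          Category.id_comp]
      rw [this]
      infer_instance
    have := Hyp.isDomain (chartPoly_ne_zero α j)
    have := isSchemeTheoreticallyDominant_SpecMap (surfHom α j).toRingHom
      (surfHom_injective α j)
    obtain ⟨κ, h1, h2, h3⟩ := exists_chart_image (graphPt α)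
      (Spec.map (CommRingCat.ofHom (surfHom α j).toRingHom)) c
      (pullback.fst (Quartic.str α) Conic.str ≫ Quartic.str α) (by
        apply pullback.hom_ext
        · rw [Category.assoc, hc1, graphPt, pullback.lift_fst, SpecMap_surfHom_surfChart]
        · rw [Category.assoc, hc2, graphPt, pullback.lift_snd, SpecMap_conicPt, surfHom, Hyp.lift_t]
          exact conicPt_tau j) U hU g
      (Spec.map (CommRingCat.ofHom (algebraMap ℂ (Hyp (chartPoly α j))))) (by
        rw [← surfChart_str, ← Category.assoc, hg, Category.assoc])
    refine ⟨κ, h2, ?_, ?_, ?_⟩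
    · rw [← Category.assoc, h1, hc1]
    · rw [← Category.assoc, h1, hc2]
    · rw [h3]; rfl
  vert k j := by
    set c : Spec (.of Plane) ⟶ ambient α :=
      pullback.lift (blowPt α k j (X 0) (X 1)) (conicPt j (X 0 : Plane))
        (by rw [blowPt_str, conicPt_str]) with hc
    have hc1 : c ≫ pullback.fst _ _ = blowPt α k j (X 0) (X 1) := pullback.lift_fst _ _ _
    have hc2 : c ≫ pullback.snd _ _ = conicPt j (X 0 : Plane) := pullback.lift_snd _ _ _
    let U : (ambient α).Opens := pullback.fst (Quartic.str α) Conic.str ⁻¹ᵁ surfOpen α (vertIdx k) ⊓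
      pullback.snd (Quartic.str α) Conic.str ⁻¹ᵁ conicOpen (conicIdx j)
    have hU : Set.range c ⊆ U := by
      rintro _ ⟨w, rfl⟩
      constructor
      · change (pullback.fst (Quartic.str α) Conic.str) (c w) ∈ (surfOpen α (vertIdx k) : Set _)
        rw [← (isOpenImmersion_vertChart α k).2, ← Scheme.Hom.comp_apply, hc1, blowPt_eq,
          Scheme.Hom.comp_apply]
        exact ⟨_, rfl⟩
      · change (pullback.snd (Quartic.str α) Conic.str) (c w) ∈ (conicOpen (conicIdx j) : Set _)
        rw [← (isOpenImmersion_conicChart j).2, ← Scheme.Hom.comp_apply, hc2, conicPt_eq,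
          Scheme.Hom.comp_apply]
        exact ⟨_, rfl⟩
    have hr1 : Set.range (U.ι ≫ pullback.fst (Quartic.str α) Conic.str) ⊆
        Set.range (vertChart α k) := by
      rw [(isOpenImmersion_vertChart α k).2]
      rintro _ ⟨w, rfl⟩
      rw [Scheme.Hom.comp_apply]
      exact w.2.1
    have hr2 : Set.range (U.ι ≫ pullback.snd (Quartic.str α) Conic.str) ⊆
        Set.range (conicChart j) := by
      rw [(isOpenImmersion_conicChart j).2]
      rintro _ ⟨w, rfl⟩
      rw [Scheme.Hom.comp_apply]
      exact w.2.2
    let g1 := IsOpenImmersion.lift (vertChart α k) _ hr1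
    have hg1 : g1 ≫ vertChart α k = U.ι ≫ pullback.fst _ _ := IsOpenImmersion.lift_fac _ _ _
    let g2 := IsOpenImmersion.lift (conicChart j) _ hr2
    have hg2 : g2 ≫ conicChart j = U.ι ≫ pullback.snd _ _ := IsOpenImmersion.lift_fac _ _ _
    have hg12 : g1 ≫ Spec.map (CommRingCat.ofHom (algebraMap ℂ Cone)) =
        g2 ≫ Spec.map (CommRingCat.ofHom (algebraMap ℂ (Polynomial ℂ))) := by
      rw [← vertChart_str α k, ← conicChart_str j, ← Category.assoc, ← Category.assoc, hg1, hg2,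
        Category.assoc, Category.assoc, pullback.condition]
    let g := pullback.lift g1 g2 hg12
    -- Here the comparison is with the product of the cone and the affine line. The line supplies t,
    -- and the cone supplies x as its coordinate p (for j = 0) or q (for j = 1); these generate the
    -- plane.
    have hcl : IsClosedImmersion (IsOpenImmersion.lift U.ι c (by simpa using hU) ≫ g) := by
      have h1 : IsOpenImmersion.lift U.ι c (by simpa using hU) ≫ g1 =
          Spec.map (CommRingCat.ofHom (coneHom j (X 0) (X 1)).toRingHom) := by
        rw [← cancel_mono (vertChart α k), Category.assoc, hg1, IsOpenImmersion.lift_fac_assoc, hc1,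
          blowPt_eq]
      have h2 : IsOpenImmersion.lift U.ι c (by simpa using hU) ≫ g2 =
          Spec.map (CommRingCat.ofHom (Polynomial.aeval (R := ℂ) (X 0 : Plane)).toRingHom) := by
        rw [← cancel_mono (conicChart j), Category.assoc, hg2, IsOpenImmersion.lift_fac_assoc, hc2,
          conicPt_eq]
      have h3 : IsOpenImmersion.lift U.ι c (by simpa using hU) ≫ g =
          pullback.lift (Spec.map (CommRingCat.ofHom (coneHom j (X 0) (X 1)).toRingHom))
            (Spec.map (CommRingCat.ofHom (Polynomial.aeval (R := ℂ) (X 0 : Plane)).toRingHom))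
            (by rw [← h1, ← h2, Category.assoc, hg12, Category.assoc]) := by
        apply pullback.hom_ext
        · rw [Category.assoc, pullback.lift_fst, pullback.lift_fst, h1]
        · rw [Category.assoc, pullback.lift_snd, pullback.lift_snd, h2]
      rw [h3]
      refine isClosedImmersion_lift_SpecMap _ _ ?_ _
      rw [← top_le_iff, ← MvPolynomial.adjoin_range_X, Algebra.adjoin_le_iff]
      rintro _ ⟨i, rfl⟩
      fin_cases i
      · exact Algebra.subset_adjoin (Or.inr ⟨Polynomial.X, Polynomial.aeval_X _⟩)
      · refine Algebra.subset_adjoin (Or.inl ?_)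
        fin_cases j
        · exact ⟨Hyp.x _ 1, by simp [coneHom, conicTuple]⟩
        · exact ⟨Hyp.x _ 2, by simp [coneHom, conicTuple]⟩
    have := isSchemeTheoreticallyDominant_SpecMap _ (RatField.aeval_tau_fib_injective α k j)
    obtain ⟨κ, h1, h2, h3⟩ := exists_chart_image (graphPt α)
      (Spec.map (CommRingCat.ofHom (aeval ![RatField.tau j, RatField.fib α k j] :
        Plane →ₐ[ℂ] RatField).toRingHom)) c
      (pullback.fst (Quartic.str α) Conic.str ≫ Quartic.str α) (by
        apply pullback.hom_ext
        · rw [Category.assoc, hc1, graphPt, pullback.lift_fst, SpecMap_blowPt, aeval_X, aeval_X]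
          exact (coordPt_congr _ _ _ _ _ _ _ _ (RatField.tuple_eq_blowTuple α k j))
        · rw [Category.assoc, hc2, graphPt, pullback.lift_snd, SpecMap_conicPt, aeval_X]
          exact conicPt_tau j) U hU g
      (pullback.fst _ _ ≫ Spec.map (CommRingCat.ofHom (algebraMap ℂ Cone))) (by
        rw [← Category.assoc, pullback.lift_fst, ← vertChart_str α k, ← Category.assoc, hg1,
          Category.assoc])
    refine ⟨κ, h2, ?_, ?_, ?_⟩
    · rw [← Category.assoc, h1, hc1]
    · rw [← Category.assoc, h1, hc2]
    · rw [h3]; rfl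

end Minitwistor

/-! ### Smoothness of the model and birationality -/

namespace Minitwistor

open Polynomial in
-- The roots are 0, 1, -1/α on one chart and 0, 1, -α on the other. They stay apart because α is
-- neither 0 nor -1; the Bézout coefficients are written out.
theorem separable_chartPoly {α : ℝ} (hα₁ : -1 < α) (hα₂ : α < 0) (j : Fin 2) :
    (chartPoly α j).Separable := by
  have h0 : (α : ℂ) ≠ 0 := by exact_mod_cast hα₂.ne
  have h1 : 1 + (α : ℂ) ≠ 0 := by
    have : (1 + α) ≠ 0 := by linarith
    exact_mod_cast this
  have hC : ∀ c d : ℂ, c * d = 1 → (C c * C d : ℂ[X]) = 1 := by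
    intro c d h; rw [← C_mul, h, C_1]
  fin_cases j
  · have e : chartPoly α 0 = X * ((1 - X) * (1 + C (α : ℂ) * X)) := by
      simp only [chartPoly, if_pos, C_sub, C_1]; ring
    change (chartPoly α 0).Separable
    rw [e]
    refine separable_X.mul (Separable.mul ?_ ?_ ?_) (.mul_right ?_ ?_)
    · exact ⟨0, -1, by simp⟩
    · exact ⟨0, C (α : ℂ)⁻¹, by simp [← C_mul, inv_mul_cancel₀ h0]⟩
    · refine ⟨C (α : ℂ) * C (1 + (α : ℂ))⁻¹, C (1 + (α : ℂ))⁻¹, ?_⟩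
      have := hC _ _ (inv_mul_cancel₀ h1)
      simp only [C_add, C_1] at this ⊢
      linear_combination this
    · exact ⟨1, 1, by ring⟩
    · exact ⟨-C (α : ℂ), 1, by ring⟩
  · have e : chartPoly α 1 = X * ((X - 1) * (X + C (α : ℂ))) := by
      simp [chartPoly]; ring
    change (chartPoly α 1).Separable
    rw [e]
    refine separable_X.mul (Separable.mul ?_ ?_ ?_) (.mul_right ?_ ?_)
    · exact ⟨0, 1, by simp⟩
    · exact ⟨0, 1, by simp⟩
    · refine ⟨-C (1 + (α : ℂ))⁻¹, C (1 + (α : ℂ))⁻¹, ?_⟩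
      have := hC _ _ (inv_mul_cancel₀ h1)
      simp only [C_add, C_1] at this ⊢
      linear_combination this
    · exact ⟨1, -1, by ring⟩
    · refine ⟨-C (α : ℂ)⁻¹, C (α : ℂ)⁻¹, ?_⟩
      have := hC _ _ (inv_mul_cancel₀ h0)
      linear_combination this

open Polynomial in
/-- The affine surface `p q = h(t)` is smooth if `h` has no multiple roots. -/
theorem Hyp.smooth {h : ℂ[X]} (hh : h.Separable) : Algebra.Smooth ℂ (Hyp h) := by
  obtain ⟨a, b, hab⟩ := hh
  have h1 : Algebra.FormallySmooth ℂ (Hyp h) := by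
    refine Algebra.FormallySmooth.of_comp_surjective fun {B} _ _ I hI f => ?_
    obtain ⟨t, ht⟩ := Ideal.Quotient.mk_surjective (f (Hyp.x h 0))
    obtain ⟨p, hp⟩ := Ideal.Quotient.mk_surjective (f (Hyp.x h 1))
    obtain ⟨q, hq⟩ := Ideal.Quotient.mk_surjective (f (Hyp.x h 2))
    set e := p * q - aeval t h with he
    have hmap : ∀ P : ℂ[X], Ideal.Quotient.mk I (aeval t P) = aeval (f (Hyp.x h 0)) P := by
      intro P
      rw [← ht]
      exact (aeval_algHom_apply (Ideal.Quotient.mkₐ ℂ I) t P).symm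
    have heI : e ∈ I := by
      rw [← Ideal.Quotient.eq_zero_iff_mem, he, map_sub, map_mul, hp, hq, hmap, ← map_mul,
        Hyp.rel, aeval_algHom_apply, sub_self]
    have hee : e * e = 0 := by
      have : e * e ∈ I ^ 2 := by rw [pow_two]; exact Ideal.mul_mem_mul heI heI
      rwa [hI] at this
    have hab' : aeval t a * aeval t h + aeval t b * aeval t (derivative h) = 1 := by
      rw [← map_mul, ← map_mul, ← map_add, hab, map_one]
    -- First-order correction of the error e, where e² = 0. From ah + bh' = 1 one gets h(t + be) = h
    -- + (1 - ah)e, and p(q - aqe) has the same value because pq = h + e.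
    have key : p * (q - aeval t a * q * e) = aeval (t + aeval t b * e) h := by
      rw [aeval_add_of_sq_eq_zero _ _ _ (by linear_combination (aeval t b) ^ 2 * hee)]
      linear_combination he - (aeval t a) * hee - e * hab' - (aeval t a * e) * he
    refine ⟨Hyp.lift _ _ _ key, Hyp.hom_ext ?_ ?_ ?_⟩
    · rw [AlgHom.comp_apply, Hyp.lift_t, ← ht]
      exact Ideal.Quotient.eq.mpr (by simpa using I.mul_mem_left _ heI)
    · rw [AlgHom.comp_apply, Hyp.lift_p, ← hp]
      rfl
    · rw [AlgHom.comp_apply, Hyp.lift_q, ← hq]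
      exact Ideal.Quotient.eq.mpr (by simpa using I.mul_mem_left _ heI)
  have h2 : Algebra.FinitePresentation ℂ (Hyp h) :=
    Algebra.FinitePresentation.quotient (Submodule.fg_span_singleton _)
  exact ⟨h1, h2⟩

theorem smooth_SpecMap {S : Type} [CommRing S] [Algebra ℂ S] [Algebra.Smooth ℂ S] :
    Smooth (Spec.map (CommRingCat.ofHom (algebraMap ℂ S))) := by
  rw [HasRingHomProperty.Spec_iff (P := @Smooth)]
  exact RingHom.smooth_algebraMap.mpr inferInstance

theorem smooth_of_forall_exists {E Y : Scheme.{0}} (f : E ⟶ Y)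
    (h : ∀ x : E, ∃ (W : Scheme.{0}) (κ : W ⟶ E), IsOpenImmersion κ ∧ x ∈ Set.range κ ∧
      Smooth (κ ≫ f)) : Smooth f := by
  choose W κ h1 h2 h3 using h
  have : IsZariskiLocalAtSource @Smooth.{0} :=
    HasRingHomProperty.instIsZariskiLocalAtSource (P := @Smooth.{0}) (Q := RingHom.Smooth)
  refine IsZariskiLocalAtSource.of_iSup_eq_top (P := @Smooth) (fun x => (κ x).opensRange)
    (top_le_iff.mp fun x _ => TopologicalSpace.Opens.mem_iSup.mpr ⟨x, h2 x⟩) fun x => ?_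
  rw [← IsOpenImmersion.isoOfRangeEq_inv_fac (κ x) (Scheme.Opens.ι _)
    (congr_arg TopologicalSpace.Opens.carrier (κ x).opensRange.opensRange_ι.symm), Category.assoc]
  have := h3 x
  infer_instance

theorem isIso_morphismRestrict_of_chart {W E T : Scheme.{0}} (ρ : E ⟶ T) (V : T.Opens) (κ : W ⟶ E)
    [IsOpenImmersion κ] (hκ : Set.range κ = ρ ⁻¹' V) [IsOpenImmersion (κ ≫ ρ)]
    (hκ' : Set.range (κ ≫ ρ) = V) : IsIso (ρ ∣_ V) := by
  let e := IsOpenImmersion.isoOfRangeEq κ (ρ ⁻¹ᵁ V).ι (by simpa using hκ)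
  let e' := IsOpenImmersion.isoOfRangeEq (κ ≫ ρ) V.ι (by simpa using hκ')
  have h1 : e.hom ≫ (ρ ⁻¹ᵁ V).ι = κ := IsOpenImmersion.isoOfRangeEq_hom_fac _ _ _
  have h2 : e'.hom ≫ V.ι = κ ≫ ρ := IsOpenImmersion.isoOfRangeEq_hom_fac _ _ _
  have h3 : e.hom ≫ ρ ∣_ V = e'.hom := by
    rw [← cancel_mono V.ι, Category.assoc, morphismRestrict_ι, ← Category.assoc, h1, h2]
  have : ρ ∣_ V = e.inv ≫ e'.hom := by rw [← h3, Iso.inv_hom_id_assoc]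
  rw [this]
  infer_instance

/-- A dominant map from a one-point scheme has its image in every nonempty open set, so any two of
these meet. -/
theorem dense_of_isDominant {F : Type} [Field F] {E : Scheme.{0}} (η : Spec (.of F) ⟶ E)
    [IsDominant η] (U : E.Opens) (hU : (U : Set E).Nonempty) : Dense (U : Set E) := by
  have h : ∀ U : E.Opens, (U : Set E).Nonempty → η (IsLocalRing.closedPoint F) ∈ U := by
    intro U hU
    obtain ⟨x, hx, y, rfl⟩ := η.denseRange.inter_open_nonempty U U.2 hU
    rwa [Subsingleton.elim (IsLocalRing.closedPoint F) y]
  rw [dense_iff_inter_open]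
  intro V hV hVne
  exact ⟨_, h ⟨V, hV⟩ hVne, h U hU⟩

theorem coordHom_conicY1 (α : ℝ) : coordHom α conicY1 = quarticY α 1 := by
  change Ideal.Quotient.mk _ (MvPolynomial.rename _ (MvPolynomial.X 1)) = _
  rw [MvPolynomial.rename_X]
  rfl

theorem chart_eq (α : ℝ) : chart α = surfOpen α (surfIdx 0) := by
  rw [chart, coordHom_conicY1]
  rfl

theorem genPt_mem_surfOpen (α : ℝ) (j : Fin 2) (z) : genPt α z ∈ surfOpen α (surfIdx j) := by
  rw [← SetLike.mem_coe, ← (isOpenImmersion_surfChart α j).2, ← SpecMap_surfHom_surfChart α j,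
    Scheme.Hom.comp_apply]
  exact ⟨_, rfl⟩

theorem coneHom_tau_fib_injective (α : ℝ) (k : Fin 2) :
    Function.Injective (coneHom 0 (RatField.tau 0) (RatField.fib α k 0)) := by
  refine Hyp.lift_injective_of_aeval_injective (pow_ne_zero 2 Polynomial.X_ne_zero) _ ?_
  have e0 : conicTuple 0 (RatField.tau 0) 0 = RatField.t := by simp [conicTuple, RatField.tau]
  have e1 : conicTuple 0 (RatField.tau 0) 1 = 1 := by simp [conicTuple]
  rw [e0, e1, mul_one]
  set b := RatField.fib α k 0
  set R := Algebra.adjoin ℂ (Set.range ![b * RatField.t, b])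
  have h0 : IsAlgebraic R (b * RatField.t) :=
    isAlgebraic_algebraMap (⟨_, Algebra.subset_adjoin ⟨0, rfl⟩⟩ : R)
  have h1 : IsAlgebraic R b :=
    isAlgebraic_algebraMap (⟨_, Algebra.subset_adjoin ⟨1, rfl⟩⟩ : R)
  have hp' := RatField.p_ne_zero
  have hh' := RatField.h_ne_zero α
  have hb : b ≠ 0 := by
    simp only [b, RatField.fib]
    refine div_ne_zero (RatField.scale_ne_zero 0) ?_
    split_ifs
    · exact hp'
    · exact div_ne_zero hh' hp'
  have ht : IsAlgebraic R RatField.t := by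
    have := h0.mul h1.inv
    rwa [mul_right_comm, mul_inv_cancel₀ hb, one_mul] at this
  have hh : IsAlgebraic R (RatField.h α) := RatField.isAlgebraic_h α ht
  refine RatField.aeval_injective ht ?_
  fin_cases k
  · have : RatField.p = b⁻¹ := by
      simp [b, RatField.fib, RatField.scale]
    rw [this]
    exact h1.inv
  · have : RatField.p = RatField.h α * b := by
      simp [b, RatField.fib, RatField.scale]; field_simp
    rw [this]
    exact hh.mul h1

theorem SpecMap_coneHom_vertChart (α : ℝ) (k : Fin 2) :
    Spec.map (CommRingCat.ofHom (coneHom 0 (RatField.tau 0) (RatField.fib α k 0)).toRingHom) ≫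
      vertChart α k = genPt α := by
  rw [← blowPt_eq]
  exact coordPt_congr _ _ _ _ _ _ _ _ (RatField.tuple_eq_blowTuple α k 0)

theorem range_subset_closure_range {S W T : Scheme.{0}} (η : S ⟶ W) [IsDominant η] (κ : W ⟶ T) :
    Set.range κ ⊆ closure (Set.range (η ≫ κ)) := by
  rintro _ ⟨w, rfl⟩
  have h := image_closure_subset_closure_image κ.continuous (s := Set.range η)
  rw [η.denseRange.closure_range, ← Set.range_comp] at h
  exact h ⟨w, trivial, rfl⟩

/-- Each of the four charts is the spectrum of a domain that embeds into ℂ(t, p) compatibly with the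
generic point. -/
theorem isDominant_genPt (α : ℝ) : IsDominant (genPt α) := by
  refine ⟨fun z => ?_⟩
  rcases quartic_cover α z with ⟨j, hj⟩ | ⟨k, hk⟩
  · have := Hyp.isDomain (chartPoly_ne_zero α j)
    have := isDominant_SpecMap (surfHom α j).toRingHom (surfHom_injective α j)
    rw [← SetLike.mem_coe, ← (isOpenImmersion_surfChart α j).2] at hj
    rw [← SpecMap_surfHom_surfChart α j]
    exact range_subset_closure_range _ _ hj
  · have : IsDomain Cone := Hyp.isDomain (pow_ne_zero 2 Polynomial.X_ne_zero)
    have := isDominant_SpecMap _ (coneHom_tau_fib_injective α k)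
    rw [← SetLike.mem_coe, ← (isOpenImmersion_vertChart α k).2] at hk
    rw [← SpecMap_coneHom_vertChart α k]
    exact range_subset_closure_range _ _ hk

theorem dense_surfOpen (α : ℝ) (j : Fin 2) : Dense (surfOpen α (surfIdx j) : Set (Quartic α)) :=
  have := isDominant_genPt α
  dense_of_isDominant (genPt α) _ ⟨_, genPt_mem_surfOpen α j (IsLocalRing.closedPoint _)⟩

namespace IsModel

variable {α : ℝ} {E : Scheme.{0}} {ρ : E ⟶ Quartic α} {g : E ⟶ Conic}

theorem smooth (hM : IsModel α ρ g) (hα₁ : -1 < α) (hα₂ : α < 0) : Smooth (ρ ≫ Quartic.str α) := by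
  refine smooth_of_forall_exists _ fun x => ?_
  rcases quartic_cover α (ρ x) with ⟨j, hj⟩ | ⟨k, hk⟩
  · obtain ⟨κ, h1, h2, -, h3⟩ := hM.surf j
    refine ⟨_, κ, h1, by rw [h3]; exact hj, ?_⟩
    have := Hyp.smooth (separable_chartPoly hα₁ hα₂ j)
    rw [← Category.assoc, h2, surfChart_str]
    exact smooth_SpecMap
  · obtain ⟨j, hj⟩ := conic_cover (g x)
    obtain ⟨κ, h1, h2, -, h3⟩ := hM.vert k j
    refine ⟨_, κ, h1, by rw [h3]; exact ⟨hk, hj⟩, ?_⟩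
    rw [← Category.assoc, h2, blowPt_str]
    have : Algebra.Smooth ℂ Plane := ⟨inferInstance, inferInstance⟩
    exact smooth_SpecMap

theorem isIso_restrict (hM : IsModel α ρ g) (j : Fin 2) :
    IsIso (ρ ∣_ surfOpen α (surfIdx j)) := by
  obtain ⟨κ, h1, h2, -, h3⟩ := hM.surf j
  have : IsOpenImmersion (κ ≫ ρ) := by rw [h2]; infer_instance
  exact isIso_morphismRestrict_of_chart ρ _ κ h3 (by rw [h2]; exact (isOpenImmersion_surfChart α j).2)

theorem isResolution (hM : IsModel α ρ g) (hα₁ : -1 < α) (hα₂ : α < 0) :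
    IsResolution (Quartic.str α) ρ where
  smooth := hM.smooth hα₁ hα₂
  proper := hM.proper
  birational := by
    obtain ⟨η, hη, h⟩ := hM.gen
    refine ⟨surfOpen α (surfIdx 0), dense_surfOpen α 0,
      dense_of_isDominant η _ ?_, hM.isIso_restrict 0⟩
    obtain ⟨z⟩ : Nonempty (Spec (.of RatField)) := inferInstance
    refine ⟨η z, ?_⟩
    change ρ (η z) ∈ surfOpen α (surfIdx 0)
    rw [← Scheme.Hom.comp_apply, h]
    exact genPt_mem_surfOpen α 0 _

end IsModel

end Minitwistor

namespace Minitwistor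

/-! ### Étale charts of smooth schemes -/

/-- A smooth algebra is locally standard smooth, hence étale over a polynomial ring. No relation
between n and the function field is known at this stage. -/
theorem exists_etale_chart {Y : Scheme.{0}} (s : Y ⟶ Spec (.of ℂ)) [Smooth s] (y : Y)
    (W : Y.Opens) (hy : y ∈ W) : ∃ (n : ℕ) (B : Type) (_ : CommRing B) (_ : Algebra ℂ B)
      (_ : Algebra (MvPolynomial (Fin n) ℂ) B) (_ : IsScalarTower ℂ (MvPolynomial (Fin n) ℂ) B)
      (_ : Algebra.Etale (MvPolynomial (Fin n) ℂ) B) (κ : Spec (.of B) ⟶ Y), IsOpenImmersion κ ∧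
      y ∈ Set.range κ ∧ Set.range κ ⊆ W ∧
      κ ≫ s = Spec.map (CommRingCat.ofHom (algebraMap ℂ B)) := by
  obtain ⟨V, hV, hyV, hVW⟩ := exists_isAffineOpen_mem_and_subset hy
  let A : Type := Γ(Y, V)
  let κ₀ : Spec (.of A) ⟶ Y := hV.fromSpec
  obtain ⟨φ, hφ⟩ : ∃ φ : ℂ →+* A, κ₀ ≫ s = Spec.map (CommRingCat.ofHom φ) :=
    ⟨(Spec.preimage (κ₀ ≫ s)).hom, (Spec.map_preimage (κ₀ ≫ s)).symm⟩
  have hs : Smooth (κ₀ ≫ s) := inferInstance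
  rw [hφ, HasRingHomProperty.Spec_iff (P := @Smooth)] at hs
  let := φ.toAlgebra
  have hs' : Algebra.Smooth ℂ A := hs
  have hr : Set.range κ₀ = V := hV.range_fromSpec
  obtain ⟨z, hz⟩ : y ∈ Set.range κ₀ := hr ▸ hyV
  have hzp : (PrimeSpectrum.asIdeal (R := A) z).IsPrime := PrimeSpectrum.isPrime z
  obtain ⟨f, hf, hst⟩ := Algebra.IsSmoothAt.exists_notMem_isStandardSmooth ℂ
    (PrimeSpectrum.asIdeal (R := A) z)
  obtain ⟨n, ψ, hgC, hg⟩ := RingHom.IsStandardSmooth.exists_etale_mvPolynomial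
    (f := algebraMap ℂ (Localization.Away f)) (by simpa [RingHom.isStandardSmooth_algebraMap])
  let := ψ.toAlgebra
  let i : Spec (.of (Localization.Away f)) ⟶ Spec (.of A) :=
    Spec.map (CommRingCat.ofHom (algebraMap A (Localization.Away f)))
  have hi : IsOpenImmersion i := inferInstance
  refine ⟨n, Localization.Away f, inferInstance, inferInstance, inferInstance,
    IsScalarTower.of_algebraMap_eq' hgC.symm, hg, i ≫ κ₀, inferInstance, ?_, ?_, ?_⟩
  · have : z ∈ Set.range i := by
      have := PrimeSpectrum.localization_away_comap_range (Localization.Away f) f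
      exact this.symm ▸ hf
    obtain ⟨w, rfl⟩ := this
    exact ⟨w, by rw [Scheme.Hom.comp_apply, hz]⟩
  · rintro _ ⟨w, rfl⟩
    apply hVW
    rw [Scheme.Hom.comp_apply]
    exact (Set.ext_iff.mp hr _).mp ⟨_, rfl⟩
  · rw [Category.assoc, hφ, ← Spec.map_comp]
    congr 1

/-! ### Generic points of resolutions -/

/-- The generic point lies in the open set over which σ is an isomorphism, and lifts through the
inverse. -/
theorem exists_isDominant_of_isResolution {α : ℝ} {Y : Scheme.{0}} {σ : Y ⟶ Quartic α}
    (hσ : IsResolution (Quartic.str α) σ) :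
    ∃ η : Spec (.of RatField) ⟶ Y, IsDominant η ∧ η ≫ σ = genPt α := by
  obtain ⟨V, hV, hV', hiso⟩ := hσ.birational
  have hgen := isDominant_genPt α
  have hr : Set.range (genPt α) ⊆ Set.range V.ι := by
    obtain ⟨z⟩ : Nonempty (Spec (.of RatField)) := inferInstance
    have hne : (V : Set (Quartic α)).Nonempty := by
      have : Nonempty (Quartic α) := ⟨genPt α z⟩
      exact hV.nonempty
    obtain ⟨x, hx, y, rfl⟩ := (genPt α).denseRange.inter_open_nonempty V V.2 hne
    rintro _ ⟨w, rfl⟩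
    rw [Subsingleton.elim w y]
    simpa using hx
  let l := IsOpenImmersion.lift V.ι (genPt α) hr
  have hl : l ≫ V.ι = genPt α := IsOpenImmersion.lift_fac _ _ _
  have : IsDominant (l ≫ V.ι) := by rwa [hl]
  have h1 : IsDominant l := .of_comp_of_isOpenImmersion l V.ι
  have h2 : IsDominant (σ ⁻¹ᵁ V).ι := ⟨by
    have := hV'
    rw [DenseRange]
    simpa using this⟩
  refine ⟨l ≫ inv (σ ∣_ V) ≫ (σ ⁻¹ᵁ V).ι, inferInstance, ?_⟩
  rw [Category.assoc, Category.assoc, ← morphismRestrict_ι, IsIso.inv_hom_id_assoc, hl]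

theorem range_subset_of_isDominant {F : Type} [Field F] {Y : Scheme.{0}} (η : Spec (.of F) ⟶ Y)
    [IsDominant η] (U : Y.Opens) (hU : (U : Set Y).Nonempty) : Set.range η ⊆ U := by
  obtain ⟨x, hx, y, rfl⟩ := η.denseRange.inter_open_nonempty U U.2 hU
  rintro _ ⟨w, rfl⟩
  rwa [Subsingleton.elim w y]

theorem exists_lift_of_isDominant {F : Type} [Field F] {Y Z : Scheme.{0}} (η : Spec (.of F) ⟶ Y)
    [IsDominant η] (i : Z ⟶ Y) [IsOpenImmersion i] [Nonempty Z] :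
    ∃ ζ : Spec (.of F) ⟶ Z, IsDominant ζ ∧ ζ ≫ i = η := by
  have hr := range_subset_of_isDominant η i.opensRange (Set.range_nonempty _)
  have hl := IsOpenImmersion.lift_fac i η hr
  have : IsDominant (IsOpenImmersion.lift i η hr ≫ i) := by rwa [hl]
  exact ⟨_, .of_comp_of_isOpenImmersion _ i, hl⟩

theorem isReduced_of_smooth {Y : Scheme.{0}} (s : Y ⟶ Spec (.of ℂ)) [Smooth s] :
    AlgebraicGeometry.IsReduced Y := by
  have h : ∀ y : Y, ∃ (Z : Scheme.{0}) (κ : Z ⟶ Y), AlgebraicGeometry.IsReduced Z ∧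
      IsOpenImmersion κ ∧ y ∈ Set.range κ := fun y => by
    obtain ⟨n, B, _, _, _, _, _, κ, h1, h2, -, -⟩ := exists_etale_chart s y ⊤ trivial
    have : _root_.IsReduced B := isReduced_of_etale (A := MvPolynomial (Fin n) ℂ)
    exact ⟨_, κ, inferInstance, h1, h2⟩
  choose Z κ h1 h2 h3 using h
  let 𝒰 : Y.OpenCover := .mkOfCovers Y Z κ (fun y => ⟨y, h3 y⟩) h2
  have : ∀ y, AlgebraicGeometry.IsReduced (𝒰.X y) := h1
  exact IsReduced.of_openCover Y 𝒰

theorem isDomain_of_chart {F : Type} [Field F] {Y : Scheme.{0}} (η : Spec (.of F) ⟶ Y)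
    [IsDominant η] {B : Type} [CommRing B] [_root_.IsReduced B] [Nontrivial B] (κ : Spec (.of B) ⟶ Y)
    [IsOpenImmersion κ] : IsDomain B ∧ ∃ ψ : B →+* F, Function.Injective ψ ∧
      Spec.map (CommRingCat.ofHom ψ) ≫ κ = η := by
  have : Nonempty (Spec (.of B)) := inferInstanceAs (Nonempty (PrimeSpectrum B))
  obtain ⟨ζ, hζ, h⟩ := exists_lift_of_isDominant η κ
  obtain ⟨ψ, rfl⟩ : ∃ ψ : B →+* F, ζ = Spec.map (CommRingCat.ofHom ψ) :=
    ⟨(Spec.preimage ζ).hom, (Spec.map_preimage ζ).symm⟩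
  have hinj : Function.Injective ψ := by
    rw [RingHom.injective_iff_ker_eq_bot, eq_bot_iff]
    have := (PrimeSpectrum.denseRange_comap_iff_ker_le_nilRadical ψ).mp hζ.1
    rwa [nilradical_eq_zero] at this
  exact ⟨hinj.isDomain ψ, ψ, hinj, h⟩

/-! ### Gluing lifts -/

/-- Uniqueness is assumed on all open subschemes because the gluing needs it on overlaps. -/
theorem existsUnique_lift_of_local {Y E T : Scheme.{0}} (ρ : E ⟶ T) (σ : Y ⟶ T)
    (huniq : ∀ (Z : Scheme.{0}) (i : Z ⟶ Y) (a b : Z ⟶ E), IsOpenImmersion i →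
      a ≫ ρ = i ≫ σ → b ≫ ρ = i ≫ σ → a = b)
    (hex : ∀ y : Y, ∃ (Z : Scheme.{0}) (i : Z ⟶ Y) (h : Z ⟶ E), IsOpenImmersion i ∧
      y ∈ Set.range i ∧ h ≫ ρ = i ≫ σ) : ∃! h : Y ⟶ E, h ≫ ρ = σ := by
  choose Z i h hi hy hh using hex
  let 𝒰 : Y.OpenCover := .mkOfCovers Y Z i (fun y => ⟨y, hy y⟩) hi
  have hc : ∀ x y : Y, Limits.pullback.fst (i x) (i y) ≫ h x =
      Limits.pullback.snd (i x) (i y) ≫ h y := fun x y => by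
    have := hi x
    have := hi y
    refine huniq _ (Limits.pullback.fst (i x) (i y) ≫ i x) _ _ inferInstance ?_ ?_
    · rw [Category.assoc, Category.assoc, hh]
    · rw [Limits.pullback.condition, Category.assoc, Category.assoc, hh]
  have hg : ∀ x : Y, i x ≫ Scheme.Cover.glueMorphisms 𝒰 h hc = h x :=
    Scheme.Cover.ι_glueMorphisms 𝒰 h hc
  have hgσ : Scheme.Cover.glueMorphisms 𝒰 h hc ≫ ρ = σ := by
    refine Scheme.Cover.hom_ext 𝒰 _ _ fun x => ?_
    have : i x ≫ Scheme.Cover.glueMorphisms 𝒰 h hc ≫ ρ = i x ≫ σ :=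
      (Category.assoc _ _ _).symm.trans ((congrArg (· ≫ ρ) (hg x)).trans (hh x))
    exact this
  exact ⟨_, hgσ, fun k hk => huniq Y (𝟙 Y) _ _ inferInstance (by simpa using hk)
    (by simpa using hgσ)⟩

/-! ### Function fields -/

/-- Serves to recognize ℂ(t, p) as the fraction field of a ring whose image generates it as a field.
-/
theorem RatField.exists_mul_eq {B : Type} [CommRing B] [Algebra ℂ B] (ψ : B →ₐ[ℂ] RatField)
    (ht : RatField.t ∈ Subfield.closure (Set.range ψ))
    (hp : RatField.p ∈ Subfield.closure (Set.range ψ)) (z : RatField) :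
    ∃ a b, ψ b ≠ 0 ∧ z * ψ b = ψ a := by
  have h1 : ∀ P : Plane, algebraMap Plane RatField P ∈ Subfield.closure (Set.range ψ) := by
    intro P
    rw [RatField.algebraMap_eq]
    induction P using MvPolynomial.induction_on with
    | C c =>
      rw [← MvPolynomial.algebraMap_eq, AlgHom.commutes, ← ψ.commutes]
      exact Subfield.subset_closure ⟨_, rfl⟩
    | add P Q hP hQ => rw [map_add]; exact add_mem hP hQ
    | mul_X P i hP =>
      rw [map_mul, MvPolynomial.aeval_X]
      refine mul_mem hP ?_
      fin_cases i
      exacts [ht, hp]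
  have h2 : z ∈ Subfield.closure (Set.range ψ) := by
    obtain ⟨P, Q, -, rfl⟩ := IsFractionRing.div_surjective (A := Plane) z
    exact div_mem (h1 P) (h1 Q)
  rw [Subfield.mem_closure_iff] at h2
  have h3 : Subring.closure (Set.range ψ) = ψ.toRingHom.range := Subring.closure_eq ψ.toRingHom.range
  rw [h3] at h2
  obtain ⟨_, ⟨a, rfl⟩, _, ⟨b, rfl⟩, rfl⟩ := h2
  by_cases hb : ψ b = 0
  · refine ⟨0, 1, by simp, ?_⟩
    change ψ a / ψ b * _ = _
    simp [hb]
  · exact ⟨a, b, hb, div_mul_cancel₀ (ψ a) hb⟩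

theorem RatField.p_mem_of_fib_mem (α : ℝ) (k : Fin 2) (L : Subfield RatField)
    (hc : ∀ c : ℂ, algebraMap ℂ RatField c ∈ L) (ht : RatField.t ∈ L)
    (hf : RatField.fib α k 0 ∈ L) : RatField.p ∈ L := by
  have hp' := RatField.p_ne_zero
  have hh' := RatField.h_ne_zero α
  have hh : RatField.h α ∈ L := by
    rw [RatField.h, Polynomial.aeval_eq_sum_range]
    refine sum_mem fun i _ => ?_
    rw [Algebra.smul_def]
    exact mul_mem (hc _) (pow_mem ht _)
  fin_cases k
  · have : RatField.p = (RatField.fib α 0 0)⁻¹ := by simp [RatField.fib, scale]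
    rw [this]
    exact inv_mem hf
  · have : RatField.p = RatField.h α * RatField.fib α 1 0 := by
      simp [RatField.fib, scale]; field_simp
    rw [this]
    exact mul_mem hh hf

theorem RatField.exists_mul_aeval_eq (α : ℝ) (k : Fin 2) (z : RatField) : ∃ P Q : Plane, Q ≠ 0 ∧
    z * MvPolynomial.aeval ![RatField.tau 0, RatField.fib α k 0] Q =
      MvPolynomial.aeval ![RatField.tau 0, RatField.fib α k 0] P := by
  set ψ : Plane →ₐ[ℂ] RatField := MvPolynomial.aeval ![RatField.tau 0, RatField.fib α k 0]
  set L := Subfield.closure (Set.range ψ)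
  have ht : RatField.t ∈ L := Subfield.subset_closure ⟨MvPolynomial.X 0, by simp [ψ, tau]⟩
  have hf : RatField.fib α k 0 ∈ L := Subfield.subset_closure ⟨MvPolynomial.X 1, by simp [ψ]⟩
  have hp : RatField.p ∈ L := RatField.p_mem_of_fib_mem α k L
    (fun c => ψ.commutes c ▸ Subfield.subset_closure ⟨_, rfl⟩) ht hf
  obtain ⟨P, Q, hQ, h⟩ := RatField.exists_mul_eq ψ ht hp z
  exact ⟨P, Q, fun h0 => hQ (by rw [h0, map_zero]), h⟩

/-! ### Lifting to the blow-up -/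

/-- The heart of the factorization. The images of the cone coordinates include x and xt, so B has
fraction field ℂ(t, p); hence n = 2 and the local ring at q is factorial. The dichotomy puts t or
1/t into that ring, which decides the chart j, and clearing denominators yields d. -/
theorem exists_coneHom_eq_of_etale {α : ℝ} (k : Fin 2) {n : ℕ} {B : Type} [CommRing B] [IsDomain B]
    [Algebra ℂ B] [Algebra (MvPolynomial (Fin n) ℂ) B] [IsScalarTower ℂ (MvPolynomial (Fin n) ℂ) B]
    [Algebra.Etale (MvPolynomial (Fin n) ℂ) B] (ψ : B →ₐ[ℂ] RatField) (hψ : Function.Injective ψ)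
    (φ : Cone →ₐ[ℂ] B)
    (hφ : ψ.comp φ = coneHom 0 (RatField.tau 0) (RatField.fib α k 0)) (q : Ideal B)
    [q.IsMaximal] : ∃ d ∉ q, ∃ (j : Fin 2) (t x : Localization.Away d), coneHom j t x =
      (IsScalarTower.toAlgHom ℂ B (Localization.Away d)).comp φ := by
  let := ψ.toRingHom.toAlgebra
  have hv : ∀ i, ψ (φ (Hyp.x _ i)) = coneHom 0 (RatField.tau 0) (RatField.fib α k 0) (Hyp.x _ i) :=
    fun i => by rw [← hφ]; rfl
  have hv0 : ψ (φ (Hyp.x _ 0)) = RatField.fib α k 0 * RatField.tau 0 := by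
    rw [hv, coneHom, Hyp.lift_t]; simp [conicTuple]
  have hv1 : ψ (φ (Hyp.x _ 1)) = RatField.fib α k 0 := by
    rw [hv, coneHom, Hyp.lift_p]; simp [conicTuple]
  have hfib : RatField.fib α k 0 ≠ 0 := fun h0 => by
    have := RatField.aeval_tau_fib_injective α k 0 (a₁ := MvPolynomial.X 1) (a₂ := 0)
      (by simp [h0])
    exact MvPolynomial.X_ne_zero _ this
  have hf : RatField.fib α k 0 ∈ Subfield.closure (Set.range ψ) :=
    hv1 ▸ Subfield.subset_closure ⟨_, rfl⟩
  have ht : RatField.t ∈ Subfield.closure (Set.range ψ) := by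
    have h1 : RatField.fib α k 0 * RatField.tau 0 ∈ Subfield.closure (Set.range ψ) :=
      hv0 ▸ Subfield.subset_closure ⟨_, rfl⟩
    have h2 : RatField.t = RatField.fib α k 0 * RatField.tau 0 / RatField.fib α k 0 := by
      rw [mul_div_cancel_left₀ _ hfib]; simp [RatField.tau]
    rw [h2]
    exact div_mem h1 hf
  have hp := RatField.p_mem_of_fib_mem α k (Subfield.closure (Set.range ψ))
    (fun c => ψ.commutes c ▸ Subfield.subset_closure ⟨_, rfl⟩) ht hf
  have hBK : ∀ b, algebraMap B RatField b = ψ b := fun _ => rfl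
  have : IsScalarTower ℂ B RatField := .of_algebraMap_eq fun c => (ψ.commutes c).symm
  have hfr : IsFractionRing B RatField := by
    have : FaithfulSMul B RatField := (faithfulSMul_iff_algebraMap_injective _ _).mpr hψ
    refine IsFractionRing.of_field B RatField fun z => ?_
    obtain ⟨a, b, hb, h⟩ := RatField.exists_mul_eq ψ ht hp z
    exact ⟨a, b, (eq_div_iff hb).mpr h⟩
  have hn : n = 2 := by
    let := ((algebraMap B RatField).comp (algebraMap (MvPolynomial (Fin n) ℂ) B)).toAlgebra
    have : IsScalarTower (MvPolynomial (Fin n) ℂ) B RatField := .of_algebraMap_eq fun _ => rfl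
    have : IsScalarTower ℂ (MvPolynomial (Fin n) ℂ) RatField := .of_algebraMap_eq fun c => by
      rw [IsScalarTower.algebraMap_apply ℂ B, IsScalarTower.algebraMap_apply ℂ (MvPolynomial (Fin n) ℂ) B]
      rfl
    exact eq_two_of_etale_of_isFractionRing (n := n) (B := B) (K := RatField)
  subst hn
  have := uniqueFactorizationMonoid_of_etale_plane q
  set O := Localization.AtPrime q
  let : Algebra O RatField := IsLocalization.localizationAlgebraOfSubmonoidLe O RatField q.primeCompl
    (nonZeroDivisors B) q.primeCompl_le_nonZeroDivisors
  have : IsScalarTower B O RatField := IsLocalization.localization_isScalarTower_of_submonoid_le ..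
  have : IsFractionRing O RatField :=
    IsFractionRing.isFractionRing_of_isDomain_of_isLocalization q.primeCompl O RatField
  have : IsScalarTower ℂ O RatField := .of_algebraMap_eq fun c => by
    rw [IsScalarTower.algebraMap_apply ℂ B O, ← IsScalarTower.algebraMap_apply B O,
      ← IsScalarTower.algebraMap_apply ℂ B]
  have hOK : ∀ b, algebraMap O RatField (algebraMap B O b) = ψ b := fun b => by
    rw [← IsScalarTower.algebraMap_apply B O]; rfl
  have hrel : φ (Hyp.x _ 1) * φ (Hyp.x _ 2) = φ (Hyp.x _ 0) ^ 2 := by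
    rw [← map_mul, Cone.rel, map_pow]
  have key := exists_mul_eq_of_uniqueFactorizationMonoid (O := O) (K := RatField)
    (x := algebraMap B O (φ (Hyp.x _ 1))) (y := algebraMap B O (φ (Hyp.x _ 2)))
    (z := algebraMap B O (φ (Hyp.x _ 0))) (τ := RatField.tau 0)
    (by rw [← map_mul, hrel, map_pow])
    (fun h0 => hfib (by rw [← hv1, ← hOK, h0, map_zero]))
    (by rw [hOK, hOK, hv0, hv1])
    (by rw [hOK, hv1]; exact RatField.aeval_tau_fib_injective α k 0)
    (by rw [hOK, hv1]; exact RatField.exists_mul_aeval_eq α k)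
  -- A fraction over the local ring and the two equations it satisfies spread out to a principal
  -- neighbourhood: B embeds into its local ring, so the cleared equations hold in B.
  have aux : ∀ {x z y : B} (t : O), algebraMap B O x * t = algebraMap B O z →
      algebraMap B O z * t = algebraMap B O y → ∃ d ∉ q, ∃ t' : Localization.Away d,
        algebraMap B _ x * t' = algebraMap B _ z ∧ algebraMap B _ z * t' = algebraMap B _ y := by
    intro x z y t h1 h2
    obtain ⟨b, d, rfl⟩ := IsLocalization.exists_mk'_eq q.primeCompl t
    have hinj : Function.Injective (algebraMap B O) :=
      IsLocalization.injective O q.primeCompl_le_nonZeroDivisors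
    rw [← IsLocalization.mk'_one (M := q.primeCompl) O x] at h1
    rw [← IsLocalization.mk'_one (M := q.primeCompl) O z] at h2
    rw [← IsLocalization.mk'_mul, IsLocalization.mk'_eq_iff_eq_mul, ← map_mul] at h1 h2
    have e1 := hinj h1
    have e2 := hinj h2
    simp only [one_mul] at e1 e2
    refine ⟨d, d.2, IsLocalization.mk' _ b (⟨d, 1, pow_one _⟩ : Submonoid.powers (d : B)), ?_, ?_⟩
    · rw [IsLocalization.mul_mk'_eq_mk'_of_mul, IsLocalization.mk'_eq_iff_eq_mul, ← map_mul, e1]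
    · rw [IsLocalization.mul_mk'_eq_mk'_of_mul, IsLocalization.mk'_eq_iff_eq_mul, ← map_mul, e2]
  rcases key with ⟨t, h1, h2⟩ | ⟨s, h1, h2⟩
  · obtain ⟨d, hd, t', e1, e2⟩ := aux t h1 h2
    refine ⟨d, hd, 0, t', algebraMap B _ (φ (Hyp.x _ 1)), Hyp.hom_ext ?_ ?_ ?_⟩
    · rw [coneHom, Hyp.lift_t]; simpa [conicTuple] using e1
    · rw [coneHom, Hyp.lift_p]; simp [conicTuple]
    · rw [coneHom, Hyp.lift_q]; simpa [conicTuple, pow_two, ← mul_assoc, e1] using e2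
  · obtain ⟨d, hd, t', e1, e2⟩ := aux s h1 h2
    refine ⟨d, hd, 1, t', algebraMap B _ (φ (Hyp.x _ 2)), Hyp.hom_ext ?_ ?_ ?_⟩
    · rw [coneHom, Hyp.lift_t]; simpa [conicTuple] using e1
    · rw [coneHom, Hyp.lift_p]; simpa [conicTuple, pow_two, ← mul_assoc, e1] using e2
    · rw [coneHom, Hyp.lift_q]; simp [conicTuple]

theorem ofHom_injective {A B : Type} [CommRing A] [CommRing B] {f g : A →+* B}
    (h : Spec.map (CommRingCat.ofHom f) = Spec.map (CommRingCat.ofHom g)) : f = g := by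
  have := Spec.map_injective h
  exact congrArg CommRingCat.Hom.hom this

theorem exists_algHom_of_comp_eq {A B : Type} [CommRing A] [CommRing B] [Algebra ℂ A] [Algebra ℂ B]
    {T : Scheme.{0}} (s : T ⟶ Spec (.of ℂ)) (κ : Spec (.of A) ⟶ T) [IsOpenImmersion κ]
    (hκ : κ ≫ s = Spec.map (CommRingCat.ofHom (algebraMap ℂ A))) (f : Spec (.of B) ⟶ T)
    (hf : f ≫ s = Spec.map (CommRingCat.ofHom (algebraMap ℂ B))) (hr : Set.range f ⊆ Set.range κ) :
    ∃ φ : A →ₐ[ℂ] B, Spec.map (CommRingCat.ofHom φ.toRingHom) ≫ κ = f := by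
  let l := IsOpenImmersion.lift κ f hr
  have hl : l ≫ κ = f := IsOpenImmersion.lift_fac _ _ _
  obtain ⟨φ, hφ⟩ : ∃ φ : A →+* B, l = Spec.map (CommRingCat.ofHom φ) :=
    ⟨(Spec.preimage l).hom, (Spec.map_preimage l).symm⟩
  refine ⟨⟨φ, fun c => ?_⟩, ?_⟩
  · rw [← hl, hφ, Category.assoc, hκ, ← Spec.map_comp, ← CommRingCat.ofHom_comp] at hf
    exact congrArg (fun f => f c) (ofHom_injective hf)
  · rw [hφ] at hl
    exact hl

/-! ### Factorization of resolutions through the model -/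

namespace IsModel

variable {α : ℝ} {E : Scheme.{0}} {ρ : E ⟶ Quartic α} {g : E ⟶ Conic}

theorem eq_of_comp_eq_genPt (hM : IsModel α ρ g) {a b : Spec (.of RatField) ⟶ E}
    (ha : a ≫ ρ = genPt α) (hb : b ≫ ρ = genPt α) : a = b := by
  obtain ⟨κ, h1, h2, -, h3⟩ := hM.surf 0
  have hr : ∀ c : Spec (.of RatField) ⟶ E, c ≫ ρ = genPt α → Set.range c ⊆ Set.range κ := by
    rintro c hc _ ⟨z, rfl⟩
    rw [h3, Set.mem_preimage, ← Scheme.Hom.comp_apply, hc]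
    exact genPt_mem_surfOpen α 0 z
  rw [← IsOpenImmersion.lift_fac κ a (hr a ha), ← IsOpenImmersion.lift_fac κ b (hr b hb)]
  congr 1
  rw [← cancel_mono (surfChart α 0), ← h2, ← Category.assoc, ← Category.assoc,
    IsOpenImmersion.lift_fac, IsOpenImmersion.lift_fac, ha, hb]

/-- Over the charts p q = h(t) the model is unchanged and the lift is immediate. Near a vertex
factoriality is used, which is available at maximal ideals only; hence the restriction to closed
points. -/
theorem exists_local_lift (hM : IsModel α ρ g) {Y : Scheme.{0}} (σ : Y ⟶ Quartic α)
    [Smooth (σ ≫ Quartic.str α)] (η : Spec (.of RatField) ⟶ Y) [IsDominant η]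
    (hη : η ≫ σ = genPt α) (y : Y) (hy : IsClosed {y}) :
    ∃ (Z : Scheme.{0}) (i : Z ⟶ Y) (h : Z ⟶ E), IsOpenImmersion i ∧
      y ∈ Set.range i ∧ h ≫ ρ = i ≫ σ := by
  rcases quartic_cover α (σ y) with ⟨j, hj⟩ | ⟨k, hk⟩
  · obtain ⟨κ, h1, h2, -, h3⟩ := hM.surf j
    let U := σ ⁻¹ᵁ surfOpen α (surfIdx j)
    have hr : Set.range (U.ι ≫ σ) ⊆ Set.range (surfChart α j) := by
      rw [(isOpenImmersion_surfChart α j).2]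
      rintro _ ⟨z, rfl⟩
      exact z.2
    refine ⟨U, U.ι, IsOpenImmersion.lift (surfChart α j) (U.ι ≫ σ) hr ≫ κ, inferInstance,
      by simpa [U] using hj, ?_⟩
    rw [Category.assoc, h2, IsOpenImmersion.lift_fac]
  obtain ⟨n, B, _, _, _, _, _, κ, h1, ⟨z, hz⟩, h3, h4⟩ := exists_etale_chart (σ ≫ Quartic.str α) y
    (σ ⁻¹ᵁ surfOpen α (vertIdx k)) hk
  have : _root_.IsReduced B := isReduced_of_etale (A := MvPolynomial (Fin n) ℂ)
  have : Nontrivial B := PrimeSpectrum.nonempty_iff_nontrivial.mp ⟨z⟩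
  obtain ⟨hdom, ψ₀, hψ, hψη⟩ := isDomain_of_chart η κ
  have hψc : (ψ₀.comp (algebraMap ℂ B)) = algebraMap ℂ RatField := by
    apply ofHom_injective
    rw [CommRingCat.ofHom_comp, Spec.map_comp, ← h4, ← Category.assoc, hψη, ← Category.assoc, hη,
      genPt_str]
  let ψ : B →ₐ[ℂ] RatField := ⟨ψ₀, fun c => congrArg (fun f => f c) hψc⟩
  have hψη' : Spec.map (CommRingCat.ofHom ψ.toRingHom) ≫ κ = η := hψη
  obtain ⟨φ, hφ⟩ := exists_algHom_of_comp_eq (Quartic.str α) (vertChart α k) (vertChart_str α k)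
    (κ ≫ σ) (by rw [Category.assoc, h4]) (by
      rw [(isOpenImmersion_vertChart α k).2]
      rintro _ ⟨w, rfl⟩
      rw [Scheme.Hom.comp_apply]
      exact h3 ⟨w, rfl⟩)
  have hψφ : ψ.comp φ = coneHom 0 (RatField.tau 0) (RatField.fib α k 0) := by
    apply AlgHom.coe_ringHom_injective
    apply ofHom_injective
    rw [← cancel_mono (vertChart α k)]
    refine Eq.trans ?_ (SpecMap_coneHom_vertChart α k).symm
    rw [← hη, ← hψη', Category.assoc, ← hφ, ← Category.assoc, ← Spec.map_comp]
    rfl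
  have hmax : (PrimeSpectrum.asIdeal (R := B) z).IsMaximal := by
    refine (PrimeSpectrum.isClosed_singleton_iff_isMaximal (R := B) z).mp ?_
    have := hy.preimage κ.continuous
    have e : κ ⁻¹' {y} = {z} := by
      ext w
      rw [← hz]
      exact κ.isOpenEmbedding.injective.eq_iff
    rwa [e] at this
  obtain ⟨d, hd, j, t, x, hc⟩ := exists_coneHom_eq_of_etale (α := α) k (n := n) ψ hψ φ hψφ
    (PrimeSpectrum.asIdeal (R := B) z)
  obtain ⟨κ', g1, g2, -, -⟩ := hM.vert k j
  let i : Spec (.of (Localization.Away d)) ⟶ Spec (.of B) :=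
    Spec.map (CommRingCat.ofHom (algebraMap B (Localization.Away d)))
  have hi : IsOpenImmersion i := inferInstance
  refine ⟨_, i ≫ κ, Spec.map (CommRingCat.ofHom
    (MvPolynomial.aeval ![t, x] : Plane →ₐ[ℂ] _).toRingHom) ≫ κ', inferInstance, ?_, ?_⟩
  · have : z ∈ Set.range i := by
      have := PrimeSpectrum.localization_away_comap_range (Localization.Away d) d
      exact this.symm ▸ hd
    obtain ⟨w, rfl⟩ := this
    exact ⟨w, by rw [Scheme.Hom.comp_apply, hz]⟩
  · rw [Category.assoc, g2, SpecMap_blowPt, blowPt_eq, Category.assoc, ← hφ, ← Category.assoc,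
      ← Spec.map_comp]
    simp only [MvPolynomial.aeval_X, Matrix.cons_val_zero, Matrix.cons_val_one, hc]
    rfl

theorem existsUnique_lift (hM : IsModel α ρ g) {Y : Scheme.{0}} (σ : Y ⟶ Quartic α)
    (hσ : IsResolution (Quartic.str α) σ) : ∃! h : Y ⟶ E, h ≫ ρ = σ := by
  obtain ⟨η, hη, hησ⟩ := exists_isDominant_of_isResolution hσ
  have := hσ.smooth
  have := hM.proper
  have hred := isReduced_of_smooth (σ ≫ Quartic.str α)
  refine existsUnique_lift_of_local ρ σ (fun Z i a b hi ha hb => ?_) ?_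
  · rcases isEmpty_or_nonempty Z with h | h
    · exact isInitialOfIsEmpty.hom_ext _ _
    · obtain ⟨ζ, hζ, h⟩ := exists_lift_of_isDominant η i
      have : AlgebraicGeometry.IsReduced Z := isReduced_of_isOpenImmersion i
      refine ext_of_isDominant_of_isSeparated ρ (ha.trans hb.symm) ζ (hM.eq_of_comp_eq_genPt ?_ ?_)
      · rw [Category.assoc, ha, ← Category.assoc, h, hησ]
      · rw [Category.assoc, hb, ← Category.assoc, h, hησ]
  -- The locus with a local lift is open, and in a Jacobson space an open set containing all closed
  -- points is everything.
  · let S : Set Y := {y | ∃ (Z : Scheme.{0}) (i : Z ⟶ Y) (h : Z ⟶ E), IsOpenImmersion i ∧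
      y ∈ Set.range i ∧ h ≫ ρ = i ≫ σ}
    have hS : IsOpen S := by
      rw [isOpen_iff_forall_mem_open]
      rintro y ⟨Z, i, h, hi, hy, hh⟩
      exact ⟨Set.range i, fun x hx => ⟨Z, i, h, hi, hx, hh⟩, i.isOpenEmbedding.isOpen_range, hy⟩
    have hJ : JacobsonSpace Y := by
      have : JacobsonSpace (Spec (.of ℂ)) := inferInstanceAs (JacobsonSpace (PrimeSpectrum ℂ))
      exact LocallyOfFiniteType.jacobsonSpace (σ ≫ Quartic.str α)
    by_contra! hne
    obtain ⟨y, hy⟩ := hne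
    have h1 : Sᶜ.Nonempty := ⟨y, by rintro ⟨Z, i, h, hi, hy', hh⟩; exact hy Z i h hi hy' hh⟩
    obtain ⟨z, hz, hz'⟩ := nonempty_inter_closedPoints h1 hS.isClosed_compl.isLocallyClosed
    exact hz (hM.exists_local_lift σ η hησ z hz')

theorem isMinimalResolution (hM : IsModel α ρ g) (hα₁ : -1 < α) (hα₂ : α < 0) :
    IsMinimalResolution (Quartic.str α) ρ where
  toIsResolution := hM.isResolution hα₁ hα₂
  factors _ σ hσ := hM.existsUnique_lift σ hσ

end IsModel

end Minitwistor

namespace Minitwistor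

/-! ### The projection on the chart -/

theorem coordHom_mem (α : ℝ) : coordHom α conicY1 ∈ quotGrading (quarticIdeal α) 1 :=
  (coordHom α).map_mem conicY1_mem

theorem comp_coordHom_eq {α : ℝ} {B : Type} [CommRing B] [Algebra ℂ B]
    (ψ : MvPolynomial (Fin 5) ℂ ⧸ (quarticIdeal α).toIdeal →ₐ[ℂ] B)
    (ψ' : MvPolynomial (Fin 3) ℂ ⧸ conicIdeal.toIdeal →ₐ[ℂ] B)
    (h : ∀ k : Fin 3, ψ' (conicY k) = ψ (quarticY α (Fin.castLE (by norm_num) k))) (a) :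
    ψ (coordHom α a) = ψ' a := by
  have : ψ.toRingHom.comp (coordHom α).toRingHom = ψ'.toRingHom := by
    apply Ideal.Quotient.ringHom_ext
    apply MvPolynomial.ringHom_ext
    · intro c
      have h1 : coordHom α (Ideal.Quotient.mk _ (MvPolynomial.C c)) = algebraMap ℂ _ c := by
        change Ideal.Quotient.mk _ (MvPolynomial.rename _ (MvPolynomial.C c)) = _
        rw [MvPolynomial.rename_C]
        rfl
      have h2 : (Ideal.Quotient.mk conicIdeal.toIdeal (MvPolynomial.C c)) = algebraMap ℂ _ c := rfl
      change ψ (coordHom α _) = ψ' _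
      rw [h1, h2, AlgHom.commutes, AlgHom.commutes]
    · intro k
      refine Eq.trans ?_ (h k).symm
      change ψ (Ideal.Quotient.mk _ (MvPolynomial.rename _ (MvPolynomial.X k))) = _
      rw [MvPolynomial.rename_X]
      rfl
  exact congrArg (fun f => f a) this

theorem comp_chartProj {α : ℝ} {B : Type} [CommRing B] [Algebra ℂ B] {c : Fin 5 → B}
    (hc : IsPt (quarticY α) c) (hu : IsUnit (c 1)) {c' : Fin 3 → B} (hc' : IsPt conicY c')
    (hu' : IsUnit (c' 1)) (h : ∀ k : Fin 3, c' k = c (Fin.castLE (by norm_num) k))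
    (l : Spec (.of B) ⟶ (chart α).toScheme)
    (hl : l ≫ (chart α).ι = coordPt (isCoordSystem_quarticY α) hc 1 hu) :
    l ≫ chartProj α = coordPt isCoordSystem_conicY hc' 1 hu' := by
  obtain ⟨ψ, hψ⟩ := id hc
  obtain ⟨ψ', hψ'⟩ := id hc'
  have hcomp := comp_coordHom_eq ψ ψ' (fun k => by rw [hψ, hψ', h])
  have hu₁ : IsUnit (ψ (coordHom α conicY1)) := by rw [coordHom_conicY1, hψ]; exact hu
  have hu₂ : IsUnit (ψ' conicY1) := by rw [← hcomp]; exact hu₁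
  have e1 : coordPt (isCoordSystem_quarticY α) hc 1 hu =
      projPt _ ψ (coordHom_mem α) one_pos hu₁ := by
    rw [coordPt_eq_projPt _ hc 1 hu ψ hψ]
    exact projPt_congr _ _ 1 isUnit_one (by simp) _ _ _ _ _ _
  have e2 : coordPt isCoordSystem_conicY hc' 1 hu' = projPt _ ψ' conicY1_mem one_pos hu₂ := by
    rw [coordPt_eq_projPt _ hc' 1 hu' ψ' hψ']
    exact projPt_congr _ _ 1 isUnit_one (by simp) _ _ _ _ _ _
  have key : ∀ l : Spec (.of B) ⟶
      (Proj.basicOpen (quotGrading (quarticIdeal α)) (coordHom α conicY1)).toScheme,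
      l ≫ (Proj.basicOpen (quotGrading (quarticIdeal α)) (coordHom α conicY1)).ι =
        projPt _ ψ (coordHom_mem α) one_pos hu₁ →
      l ≫ Proj.basicOpenToSpec (quotGrading (quarticIdeal α)) (coordHom α conicY1) ≫
        Spec.map (CommRingCat.ofHom (HomogeneousLocalization.Away.map (coordHom α) conicY1)) ≫
          Proj.awayι (quotGrading conicIdeal) conicY1 conicY1_mem one_pos =
        projPt _ ψ' conicY1_mem one_pos hu₂ := by
    intro l hl
    have e3 : l = Spec.map (CommRingCat.ofHom (awayEval _ ψ hu₁)) ≫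
        (Proj.basicOpenIsoSpec _ _ (coordHom_mem α) one_pos).inv := by
      rw [← cancel_mono (Proj.basicOpen _ _).ι, hl, projPt, Category.assoc]
      rfl
    rw [e3, Category.assoc, ← Proj.basicOpenIsoSpec_hom _ _ (coordHom_mem α) one_pos,
      Iso.inv_hom_id_assoc, projPt, ← Spec.map_comp_assoc, ← CommRingCat.ofHom_comp]
    congr 3
    refine (awayEval_eq_of _ conicY1_mem _ _ fun n a ha => ?_).symm
    rw [RingHom.comp_apply, HomogeneousLocalization.Away.map_mk _ _ conicY1_mem, ← hcomp, ← hcomp]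
    exact awayEval_mk_mul ψ (coordHom_mem α) hu₁ n (coordHom α a) _
  rw [e2]
  exact key l (hl.trans e1)

theorem surfChart_comp_chartProj {α : ℝ} (l : Spec (.of (Hyp (chartPoly α 0))) ⟶ (chart α).toScheme)
    (hl : l ≫ (chart α).ι = surfChart α 0) :
    l ≫ chartProj α = conicPt 0 (Hyp.x (chartPoly α 0) 0) :=
  comp_chartProj _ _ _ _ (fun k => by fin_cases k <;> simp [conicTuple, surfTuple]) l hl

theorem genPt_comp_chartProj {α : ℝ} (l : Spec (.of RatField) ⟶ (chart α).toScheme)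
    (hl : l ≫ (chart α).ι = genPt α) : l ≫ chartProj α = genConicPt :=
  comp_chartProj _ _ _ _ (fun k => by fin_cases k <;> simp [conicTuple, RatField.tuple, surfTuple])
    l hl

namespace IsModel

variable {α : ℝ} {E : Scheme.{0}} {ρ : E ⟶ Quartic α} {g : E ⟶ Conic}

theorem of_iso (hM : IsModel α ρ g) {E' : Scheme.{0}} (e : E' ≅ E) :
    IsModel α (e.hom ≫ ρ) (e.hom ≫ g) where
  proper := have := hM.proper; inferInstance
  comm := by rw [Category.assoc, hM.comm, Category.assoc]
  gen := by
    obtain ⟨η, h1, h2⟩ := hM.gen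
    exact ⟨η ≫ e.inv, inferInstance, by simpa using h2⟩
  surf j := by
    obtain ⟨κ, h1, h2, h3, h4⟩ := hM.surf j
    refine ⟨κ ≫ e.inv, inferInstance, by simpa using h2, by simpa using h3, ?_⟩
    ext x
    rw [Set.mem_preimage, Scheme.Hom.comp_apply]
    change _ ↔ e.hom x ∈ ρ ⁻¹' (surfOpen α (surfIdx j))
    rw [← h4]
    constructor
    · rintro ⟨y, rfl⟩; exact ⟨y, by simp⟩
    · rintro ⟨y, hy⟩; exact ⟨y, by simp [hy]⟩
  vert k j := by
    obtain ⟨κ, h1, h2, h3, h4⟩ := hM.vert k j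
    refine ⟨κ ≫ e.inv, inferInstance, by simpa using h2, by simpa using h3, ?_⟩
    ext x
    rw [Set.mem_inter_iff, Set.mem_preimage, Set.mem_preimage, Scheme.Hom.comp_apply,
      Scheme.Hom.comp_apply]
    change _ ↔ e.hom x ∈ ρ ⁻¹' (surfOpen α (vertIdx k)) ∩ g ⁻¹' conicOpen (conicIdx j)
    rw [← h4]
    constructor
    · rintro ⟨y, rfl⟩; exact ⟨y, by simp⟩
    · rintro ⟨y, hy⟩; exact ⟨y, by simp [hy]⟩

/-- The universal property identifies any two minimal resolutions, so the charts of the model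
transport to an arbitrary one. -/
theorem exists_of_isMinimalResolution (hM : IsModel α ρ g) (hα₁ : -1 < α) (hα₂ : α < 0)
    {Y : Scheme.{0}} {σ : Y ⟶ Quartic α} (hσ : IsMinimalResolution (Quartic.str α) σ) :
    ∃ g' : Y ⟶ Conic, IsModel α σ g' := by
  have hρ := hM.isMinimalResolution hα₁ hα₂
  obtain ⟨a, ha, -⟩ := hρ.factors Y σ hσ.toIsResolution
  obtain ⟨b, hb, -⟩ := hσ.factors E ρ hρ.toIsResolution
  let e : Y ≅ E := ⟨a, b,
    (hσ.factors Y σ hσ.toIsResolution).unique (by rw [Category.assoc, hb, ha]) (Category.id_comp _),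
    (hρ.factors E ρ hρ.toIsResolution).unique (by rw [Category.assoc, ha, hb]) (Category.id_comp _)⟩
  have := hM.of_iso e
  have h : e.hom ≫ ρ = σ := ha
  rw [h] at this
  exact ⟨_, this⟩

theorem ι_comp_eq (hM : IsModel α ρ g) :
    (ρ ⁻¹ᵁ chart α).ι ≫ g = (ρ ∣_ chart α) ≫ chartProj α := by
  obtain ⟨κ, h1, h2, h3, h4⟩ := hM.surf 0
  have hr : Set.range κ = Set.range (ρ ⁻¹ᵁ chart α).ι := by
    rw [h4, Scheme.Opens.range_ι, chart_eq]
    rfl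
  let e := IsOpenImmersion.isoOfRangeEq κ (ρ ⁻¹ᵁ chart α).ι hr
  have he : e.hom ≫ (ρ ⁻¹ᵁ chart α).ι = κ := IsOpenImmersion.isoOfRangeEq_hom_fac _ _ _
  rw [← cancel_epi e.hom, ← Category.assoc, he, h3, ← Category.assoc]
  refine (surfChart_comp_chartProj _ ?_).symm
  rw [Category.assoc, morphismRestrict_ι, ← Category.assoc, he, h2]

theorem dense_preimage_chart (hM : IsModel α ρ g) : Dense (ρ ⁻¹ᵁ chart α : Set E) := by
  obtain ⟨η, hη, h⟩ := hM.gen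
  refine dense_of_isDominant η _ ?_
  obtain ⟨z⟩ : Nonempty (Spec (.of RatField)) := inferInstance
  refine ⟨η z, ?_⟩
  have := genPt_mem_surfOpen α 0 z
  rw [← h, Scheme.Hom.comp_apply, ← chart_eq] at this
  exact this

end IsModel

end Minitwistor

namespace Minitwistor

/-! ### The vertex of the quadric cone -/

namespace Cone

/-- The evaluation at the vertex of the cone. -/
noncomputable def ev : Cone →ₐ[ℂ] ℂ := Hyp.lift 0 0 0 (by simp)

theorem ev_x (i : Fin 3) : ev (Hyp.x _ i) = 0 := by
  fin_cases i
  · exact Hyp.lift_t ..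
  · exact Hyp.lift_p ..
  · exact Hyp.lift_q ..

theorem ev_surjective : Function.Surjective ev := fun c => ⟨algebraMap ℂ _ c, ev.commutes c⟩

/-- The vertex of the cone. -/
noncomputable def origin : PrimeSpectrum Cone := ⟨RingHom.ker ev, RingHom.ker_isPrime _⟩

/-- Modulo an ideal containing the three coordinates, every function equals its value at the vertex.
-/
theorem sub_algebraMap_ev_mem {B : Type} [CommRing B] [Algebra ℂ B] (f : Cone →ₐ[ℂ] B) (I : Ideal B)
    (h : ∀ i, f (Hyp.x _ i) ∈ I) (b : Cone) : f b - algebraMap ℂ B (ev b) ∈ I := by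
  have : (Ideal.Quotient.mkₐ ℂ I).comp f =
      (Ideal.Quotient.mkₐ ℂ I).comp ((Algebra.ofId ℂ B).comp ev) := by
    have h' : ∀ i, ((Ideal.Quotient.mkₐ ℂ I).comp f) (Hyp.x _ i) =
        ((Ideal.Quotient.mkₐ ℂ I).comp ((Algebra.ofId ℂ B).comp ev)) (Hyp.x _ i) := fun i => by
      rw [AlgHom.comp_apply, AlgHom.comp_apply, AlgHom.comp_apply, ev_x, map_zero, map_zero]
      exact Ideal.Quotient.eq_zero_iff_mem.mpr (h i)
    exact Hyp.hom_ext (h' 0) (h' 1) (h' 2)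
  exact Ideal.Quotient.eq.mp (congrArg (fun f => f b) this)

theorem isUnit_map_of_isNilpotent {B : Type} [CommRing B] [Algebra ℂ B] (f : Cone →ₐ[ℂ] B)
    (h : ∀ i, IsNilpotent (f (Hyp.x _ i))) {d : Cone} (hd : ev d ≠ 0) : IsUnit (f d) := by
  have h1 := sub_algebraMap_ev_mem f (nilradical B) h d
  rw [mem_nilradical] at h1
  have h2 : IsUnit (algebraMap ℂ B (ev d)) := (isUnit_iff_ne_zero.mpr hd).map _
  simpa using h1.isUnit_add_left_of_commute h2 (Commute.all _ _)

theorem ker_ev_le {z : PrimeSpectrum Cone} (h : ∀ i, Hyp.x _ i ∈ z.asIdeal) : z = origin := by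
  have h1 : RingHom.ker ev ≤ z.asIdeal := fun b hb => by
    have := sub_algebraMap_ev_mem (AlgHom.id ℂ Cone) z.asIdeal h b
    rw [RingHom.mem_ker] at hb
    simpa [hb] using this
  have h2 : (RingHom.ker ev).IsMaximal := RingHom.ker_isMaximal_of_surjective _ ev_surjective
  exact PrimeSpectrum.ext (h2.eq_of_le z.2.ne_top h1).symm

theorem exists_lift_away {B : Type} [CommRing B] [Algebra ℂ B] (f : Cone →ₐ[ℂ] B)
    (h : ∀ i, IsNilpotent (f (Hyp.x _ i))) {d : Cone} (hd : ev d ≠ 0) :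
    ∃ f' : Localization.Away d →ₐ[ℂ] B, ∀ b, f' (algebraMap Cone _ b) = f b := by
  have hu := isUnit_map_of_isNilpotent f h hd
  refine ⟨⟨IsLocalization.Away.lift (g := f.toRingHom) d hu, fun c => ?_⟩, fun b =>
    IsLocalization.Away.lift_eq d hu b⟩
  rw [IsScalarTower.algebraMap_apply ℂ Cone]
  exact (IsLocalization.Away.lift_eq d hu _).trans (f.commutes c)

/-- Infinitesimal obstruction: t = 0, p = q = e is a point of the cone modulo e². For any lift, p q
= e² ≠ 0 whereas t² = 0. The denominator d is harmless since it is invertible at the vertex. -/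
theorem not_formallySmooth_of_pow_eq_zero {A : Type} [CommRing A] [Algebra ℂ A] {e : A}
    (he3 : e ^ 3 = 0) (he2 : e ^ 2 ≠ 0) {d : Cone} (hd : ev d ≠ 0) :
    ¬ Algebra.FormallySmooth ℂ (Localization.Away d) := by
  intro hs
  let I : Ideal A := Ideal.span {e ^ 2}
  have heI : ∀ u ∈ I, e * u = 0 := by
    intro u hu
    obtain ⟨a, rfl⟩ := Ideal.mem_span_singleton.mp hu
    linear_combination a * he3
  have hI : I ^ 2 = ⊥ := by
    rw [Ideal.span_singleton_pow, Ideal.span_singleton_eq_bot]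
    linear_combination e * he3
  have hII : ∀ u ∈ I, ∀ v ∈ I, u * v = 0 := fun u hu v hv => by
    have := Ideal.mul_mem_mul hu hv
    rwa [← pow_two, hI] at this
  let ε : A ⧸ I := Ideal.Quotient.mk I e
  have hε : ε ^ 2 = 0 := by
    rw [← map_pow]
    exact Ideal.Quotient.eq_zero_iff_mem.mpr (Ideal.mem_span_singleton_self _)
  let f : Cone →ₐ[ℂ] A ⧸ I := Hyp.lift 0 ε ε (by rw [← pow_two, hε]; simp)
  have f0 : f (Hyp.x _ 0) = 0 := Hyp.lift_t ..
  have f1 : f (Hyp.x _ 1) = ε := Hyp.lift_p ..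
  have f2 : f (Hyp.x _ 2) = ε := Hyp.lift_q ..
  obtain ⟨f', hf'⟩ := exists_lift_away f (fun i => by
    fin_cases i
    · exact ⟨1, by rw [pow_one]; exact f0⟩
    · exact ⟨2, (congrArg (· ^ 2) f1).trans hε⟩
    · exact ⟨2, (congrArg (· ^ 2) f2).trans hε⟩) hd
  obtain ⟨F, hF⟩ := Algebra.FormallySmooth.comp_surjective ℂ _ I hI f'
  have hF' : ∀ b, Ideal.Quotient.mk I (F (algebraMap Cone _ b)) = f b := fun b => by
    rw [← hf', ← hF]; rfl
  have h0 : F (algebraMap Cone _ (Hyp.x _ 0)) ∈ I :=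
    Ideal.Quotient.eq_zero_iff_mem.mp ((hF' _).trans f0)
  have h1 := Ideal.Quotient.eq.mp ((hF' _).trans f1)
  have h2 := Ideal.Quotient.eq.mp ((hF' _).trans f2)
  have hrel := congrArg (fun b => F (algebraMap Cone _ b)) Cone.rel
  simp only [map_mul, map_pow] at hrel
  apply he2
  have k0 := hII _ h0 _ h0
  have k1 := heI _ h1
  have k2 := heI _ h2
  have k3 := hII _ h1 _ h2
  linear_combination -k3 - k1 - k2 + hrel + k0

theorem not_smooth {d : Cone} (hd : ev d ≠ 0) :
    ¬ Algebra.FormallySmooth ℂ (Localization.Away d) := by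
  refine not_formallySmooth_of_pow_eq_zero
    (A := Polynomial ℂ ⧸ Ideal.span {(Polynomial.X ^ 3 : Polynomial ℂ)})
    (e := Ideal.Quotient.mk _ Polynomial.X) ?_ (fun h => ?_) hd
  · rw [← map_pow]
    exact Ideal.Quotient.eq_zero_iff_mem.mpr (Ideal.mem_span_singleton_self _)
  · rw [← map_pow, Ideal.Quotient.eq_zero_iff_mem, Ideal.mem_span_singleton,
      Polynomial.X_pow_dvd_iff] at h
    have := h 2 (by norm_num)
    simp at this

/-- The tangent vector t = ε, p = q = 0 lies on the cone, and on it the equation would read 0·τ = ε.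
-/
theorem no_fraction {d : Cone} (hd : ev d ≠ 0) (i : Fin 3) (hi : i ≠ 0) (τ : Localization.Away d) :
    algebraMap Cone _ (Hyp.x _ i) * τ ≠ algebraMap Cone _ (Hyp.x _ 0) := by
  let f : Cone →ₐ[ℂ] DualNumber ℂ := Hyp.lift DualNumber.eps 0 0 (by simp [pow_two])
  have f0 : f (Hyp.x _ 0) = DualNumber.eps := Hyp.lift_t ..
  have f1 : f (Hyp.x _ 1) = 0 := Hyp.lift_p ..
  have f2 : f (Hyp.x _ 2) = 0 := Hyp.lift_q ..
  obtain ⟨f', hf'⟩ := exists_lift_away f (fun i => by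
    fin_cases i
    · exact f0 ▸ ⟨2, by rw [pow_two, DualNumber.eps_mul_eps]⟩
    · exact f1 ▸ IsNilpotent.zero
    · exact f2 ▸ IsNilpotent.zero) hd
  intro h
  have h' := congrArg f' h
  rw [map_mul, hf', hf', f0] at h'
  have : f (Hyp.x _ i) = 0 := by
    fin_cases i
    exacts [absurd rfl hi, f1, f2]
  rw [this, zero_mul] at h'
  have := congrArg TrivSqZeroExt.snd h'
  simp at this

end Cone

/-! ### The vertices of the quartic surface -/

section Vertices

variable (α : ℝ)

/-- The two vertices `(0 : 0 : 0 : 1 : 0)` and `(0 : 0 : 0 : 0 : 1)` of the quartic surface. -/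
noncomputable def vertex (k : Fin 2) : Quartic α := vertChart α k Cone.origin

theorem vertChart_mem_iff (k : Fin 2) (i : Fin 5) (z : Spec (.of Cone)) :
    vertChart α k z ∈ surfOpen α i ↔
      vertTuple α k (Hyp.x _ 0) (Hyp.x _ 1) (Hyp.x _ 2) i ∉ PrimeSpectrum.asIdeal (R := Cone) z := by
  have := coordPt_preimage (isCoordSystem_quarticY α) (isPt_vertTuple α k Cone.rel) (vertIdx k)
    (isUnit_vertTuple α k _ _ _) i
  have h2 := congrArg (fun U : (Spec (.of Cone)).Opens => z ∈ U) this
  exact Iff.of_eq h2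

theorem vertex_notMem_surfOpen (k j : Fin 2) : vertex α k ∉ surfOpen α (surfIdx j) := by
  refine (not_congr (vertChart_mem_iff α k _ Cone.origin)).mpr (not_not.mpr ?_)
  have : Cone.ev (vertTuple α k (Hyp.x _ 0) (Hyp.x _ 1) (Hyp.x _ 2) (surfIdx j)) = 0 := by
    fin_cases k <;> fin_cases j <;> simp [vertTuple, surfIdx, Cone.ev_x]
  exact this

theorem vertex_injective : Function.Injective (vertex α) := by
  have h1 : vertex α 0 ∉ surfOpen α (vertIdx 1) := by
    refine (not_congr (vertChart_mem_iff α 0 _ Cone.origin)).mpr (not_not.mpr ?_)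
    have : Cone.ev (vertTuple α 0 (Hyp.x _ 0) (Hyp.x _ 1) (Hyp.x _ 2) (vertIdx 1)) = 0 := by
      simp [vertTuple, vertIdx, Cone.ev_x]
    exact this
  have h2 : vertex α 1 ∈ surfOpen α (vertIdx 1) := by
    rw [← SetLike.mem_coe, surfOpen, ← (isOpenImmersion_vertChart α 1).2]
    exact ⟨_, rfl⟩
  have h3 : vertex α 0 ≠ vertex α 1 := fun h => h1 (h ▸ h2)
  intro a b hab
  fin_cases a <;> fin_cases b
  exacts [rfl, absurd hab h3, absurd hab.symm h3, rfl]

theorem compl_iUnion_surfOpen :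
    {z : Quartic α | ∀ j, z ∉ surfOpen α (surfIdx j)} = Set.range (vertex α) := by
  ext z
  constructor
  · intro hz
    rcases quartic_cover α z with ⟨j, hj⟩ | ⟨k, hk⟩
    · exact absurd hj (hz j)
    · rw [← SetLike.mem_coe, ← (isOpenImmersion_vertChart α k).2] at hk
      obtain ⟨w, rfl⟩ := hk
      refine ⟨k, ?_⟩
      have h : ∀ j, vertTuple α k (Hyp.x _ 0) (Hyp.x _ 1) (Hyp.x _ 2) (surfIdx j) ∈
          PrimeSpectrum.asIdeal (R := Cone) w := fun j => by
        have := hz j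
        rwa [vertChart_mem_iff, not_not] at this
      have h1 : Hyp.x _ 1 ∈ PrimeSpectrum.asIdeal (R := Cone) w := by
        have := h 0
        fin_cases k <;> simpa [vertTuple, surfIdx] using this
      have h2 : Hyp.x _ 2 ∈ PrimeSpectrum.asIdeal (R := Cone) w := by
        have := h 1
        fin_cases k <;> simpa [vertTuple, surfIdx] using this
      have h0 : Hyp.x _ 0 ∈ PrimeSpectrum.asIdeal (R := Cone) w := by
        refine (PrimeSpectrum.isPrime (R := Cone) w).mem_of_pow_mem 2 ?_
        rw [← Cone.rel]
        exact Ideal.mul_mem_right _ _ h1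
      have : w = Cone.origin := Cone.ker_ev_le fun i => by
        fin_cases i
        exacts [h0, h1, h2]
      rw [vertex, this]
  · rintro ⟨k, rfl⟩ j
    exact vertex_notMem_surfOpen α k j

/-- A basic open neighbourhood of the vertex of the cone, as a chart of the quartic surface. -/
noncomputable def vertNbhd (k : Fin 2) (d : Cone) : Spec (.of (Localization.Away d)) ⟶ Quartic α :=
  Spec.map (CommRingCat.ofHom (algebraMap Cone (Localization.Away d))) ≫ vertChart α k

instance (k : Fin 2) (d : Cone) : IsOpenImmersion (vertNbhd α k d) := by
  rw [vertNbhd]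
  have : IsOpenImmersion (Spec.map (CommRingCat.ofHom (algebraMap Cone (Localization.Away d)))) :=
    inferInstance
  infer_instance

theorem exists_vertNbhd (k : Fin 2) (U : (Quartic α).Opens) (hU : vertex α k ∈ U) :
    ∃ d, Cone.ev d ≠ 0 ∧ Set.range (vertNbhd α k d) ⊆ U := by
  have h1 : Cone.origin ∈ vertChart α k ⁻¹ᵁ U := hU
  obtain ⟨_, ⟨_, ⟨d, rfl⟩, rfl⟩, hd, hd'⟩ := PrimeSpectrum.isBasis_basic_opens.exists_subset_of_mem_open
    h1 (vertChart α k ⁻¹ᵁ U).2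
  refine ⟨d, hd, ?_⟩
  rintro _ ⟨w, rfl⟩
  rw [vertNbhd, Scheme.Hom.comp_apply]
  refine hd' ?_
  have := PrimeSpectrum.localization_away_comap_range (Localization.Away d) d
  exact (Set.ext_iff.mp this _).mp ⟨w, rfl⟩

theorem singularLocus_eq {α : ℝ} (hα₁ : -1 < α) (hα₂ : α < 0) :
    singularLocus (Quartic.str α) = Set.range (vertex α) := by
  rw [← compl_iUnion_surfOpen]
  ext z
  constructor
  · intro hz j hj
    refine hz ⟨surfOpen α (surfIdx j), hj, ?_⟩
    have h1 : Set.range (surfChart α j) = Set.range (surfOpen α (surfIdx j)).ι := by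
      rw [(isOpenImmersion_surfChart α j).2, Scheme.Opens.range_ι]
    let e := IsOpenImmersion.isoOfRangeEq (surfChart α j) (surfOpen α (surfIdx j)).ι h1
    have he : e.inv ≫ surfChart α j = (surfOpen α (surfIdx j)).ι :=
      IsOpenImmersion.isoOfRangeEq_inv_fac _ _ _
    rw [← he, Category.assoc, surfChart_str]
    have := Hyp.smooth (separable_chartPoly hα₁ hα₂ j)
    have := smooth_SpecMap (S := Hyp (chartPoly α j))
    infer_instance
  · intro hz
    have hz' : z ∈ Set.range (vertex α) := by
      rw [← compl_iUnion_surfOpen]; exact hz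
    obtain ⟨k, rfl⟩ := hz'
    rintro ⟨U, hU, hs⟩
    obtain ⟨d, hd, hr⟩ := exists_vertNbhd α k U hU
    let l := IsOpenImmersion.lift U.ι (vertNbhd α k d) (by simpa using hr)
    have hl : l ≫ U.ι = vertNbhd α k d := IsOpenImmersion.lift_fac _ _ _
    have h1 : IsOpenImmersion (l ≫ U.ι) := by rw [hl]; infer_instance
    have h2 : IsOpenImmersion l := IsOpenImmersion.of_comp l U.ι
    have h3 : Smooth (l ≫ U.ι ≫ Quartic.str α) := inferInstance
    rw [← Category.assoc, hl, vertNbhd, Category.assoc, vertChart_str, ← Spec.map_comp,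
      ← CommRingCat.ofHom_comp, ← IsScalarTower.algebraMap_eq,
      HasRingHomProperty.Spec_iff (P := @Smooth)] at h3
    have h4 : Algebra.Smooth ℂ (Localization.Away d) := RingHom.smooth_algebraMap.mp h3
    exact Cone.not_smooth hd inferInstance

/-! ### The domain of definition of the projection -/

/-- Any representative of π agrees with `chartProj` on a dense open set, which contains the generic
point. -/
theorem equiv_chartProj_apply_genPt {hd : Dense (chart α : Set (Quartic α))}
    (f : (Quartic α).PartialMap Conic) (hf : f.toRationalMap = ratProj α hd)
    (a : Spec (.of RatField) ⟶ f.domain.toScheme) (ha : a ≫ f.domain.ι = genPt α) :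
    a ≫ f.hom = genConicPt := by
  obtain ⟨W, hW, hW1, hW2, h⟩ := Scheme.PartialMap.toRationalMap_eq_iff.mp hf
  have := isDominant_genPt α
  obtain ⟨z⟩ : Nonempty (Spec (.of RatField)) := inferInstance
  have hne : Nonempty (Quartic α) := ⟨genPt α z⟩
  have hr : Set.range (genPt α) ⊆ Set.range W.ι := by
    rw [Scheme.Opens.range_ι]
    exact range_subset_of_isDominant (genPt α) W hW.nonempty
  let w := IsOpenImmersion.lift W.ι (genPt α) hr
  have hw : w ≫ W.ι = genPt α := IsOpenImmersion.lift_fac _ _ _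
  have h1 : a = w ≫ (Quartic α).homOfLE hW1 := by
    rw [← cancel_mono f.domain.ι, ha, Category.assoc, Scheme.homOfLE_ι, hw]
  have h2 : (Quartic α).homOfLE hW1 ≫ f.hom = (Quartic α).homOfLE hW2 ≫ chartProj α := h
  rw [h1, Category.assoc, h2, ← Category.assoc]
  apply genPt_comp_chartProj
  have h3 : (Quartic α).homOfLE hW2 ≫ (chart α).ι = W.ι := Scheme.homOfLE_ι _ _
  rw [Category.assoc, h3, hw]

theorem exists_ratField_hom_away (k : Fin 2) {d : Cone} (hd : d ≠ 0) :
    ∃ ψ : Localization.Away d →+* RatField, Function.Injective ψ ∧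
      (∀ b, ψ (algebraMap Cone _ b) = coneHom 0 (RatField.tau 0) (RatField.fib α k 0) b) ∧
      Spec.map (CommRingCat.ofHom ψ) ≫ vertNbhd α k d = genPt α := by
  let χ := coneHom 0 (RatField.tau 0) (RatField.fib α k 0)
  have hχ : Function.Injective χ := coneHom_tau_fib_injective α k
  have hu : IsUnit (χ.toRingHom d) :=
    isUnit_iff_ne_zero.mpr fun h => hd (hχ (h.trans (map_zero χ).symm))
  let ψ : Localization.Away d →+* RatField := IsLocalization.Away.lift d hu
  have hψ : ∀ b, ψ (algebraMap Cone _ b) = χ b := IsLocalization.Away.lift_eq d hu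
  refine ⟨ψ, ?_, hψ, ?_⟩
  · rw [injective_iff_map_eq_zero]
    intro z hz
    obtain ⟨a, s, rfl⟩ := IsLocalization.exists_mk'_eq (Submonoid.powers d) z
    have h1 := congrArg ψ (IsLocalization.mk'_spec (Localization.Away d) a s)
    rw [map_mul, hz, zero_mul, hψ] at h1
    have : a = 0 := hχ (h1.symm.trans (map_zero χ).symm)
    rw [this, IsLocalization.mk'_zero]
  · rw [← SpecMap_coneHom_vertChart α k, vertNbhd, ← Category.assoc, ← Spec.map_comp,
      ← CommRingCat.ofHom_comp]
    congr 3
    exact RingHom.ext hψ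

/-- An extension of π would send a neighbourhood of the vertex into a chart of the conic, and the
parameter of that chart would pull back to a regular function equal to t/p or t/q. -/
theorem vertex_notMem_domain (hd : Dense (chart α : Set (Quartic α))) (k : Fin 2) :
    vertex α k ∉ (ratProj α hd).domain := by
  intro hv
  obtain ⟨f, hf, hfe⟩ := Scheme.RationalMap.mem_domain.mp hv
  obtain ⟨j, hj⟩ := conic_cover (f.hom ⟨vertex α k, hf⟩)
  let V := f.hom ⁻¹ᵁ (Proj.basicOpen (quotGrading conicIdeal) (conicY (conicIdx j)))
  obtain ⟨d, hd0, hr⟩ := exists_vertNbhd α k (f.domain.ι ''ᵁ V) ⟨⟨vertex α k, hf⟩, hj, rfl⟩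
  have hr1 : Set.range (vertNbhd α k d) ⊆ Set.range f.domain.ι := fun x hx => by
    obtain ⟨y, -, rfl⟩ := hr hx
    exact ⟨y, rfl⟩
  let l := IsOpenImmersion.lift f.domain.ι (vertNbhd α k d) hr1
  have hl : l ≫ f.domain.ι = vertNbhd α k d := IsOpenImmersion.lift_fac _ _ _
  have hr2 : Set.range (l ≫ f.hom) ⊆ Set.range (conicChart j) := by
    rw [(isOpenImmersion_conicChart j).2]
    rintro _ ⟨w, rfl⟩
    obtain ⟨y, hy, hyw⟩ := hr ⟨w, rfl⟩
    have : y = l w := f.domain.ι.isOpenEmbedding.injective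
      (hyw.trans (by rw [← hl, Scheme.Hom.comp_apply]))
    rw [Scheme.Hom.comp_apply, ← this]
    exact hy
  let m := IsOpenImmersion.lift (conicChart j) (l ≫ f.hom) hr2
  have hm : m ≫ conicChart j = l ≫ f.hom := IsOpenImmersion.lift_fac _ _ _
  obtain ⟨θ, hθ⟩ : ∃ θ : Polynomial ℂ →+* Localization.Away d, m = Spec.map (CommRingCat.ofHom θ) :=
    ⟨(Spec.preimage m).hom, (Spec.map_preimage m).symm⟩
  obtain ⟨ψ, hψ, hψb, hψg⟩ := exists_ratField_hom_away α k
    (fun h => hd0 (by rw [h, map_zero]) : d ≠ 0)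
  have h1 := equiv_chartProj_apply_genPt α f hfe (Spec.map (CommRingCat.ofHom ψ) ≫ l)
    (by rw [Category.assoc, hl, hψg])
  rw [Category.assoc, ← hm, hθ, ← conicPt_tau j, conicPt_eq, ← Category.assoc, cancel_mono,
    ← Spec.map_comp, ← CommRingCat.ofHom_comp] at h1
  have h2 : ψ (θ Polynomial.X) = RatField.tau j := by
    have := congrArg (fun f => f Polynomial.X) (ofHom_injective h1)
    refine Eq.trans this ?_
    change Polynomial.aeval _ Polynomial.X = _
    rw [Polynomial.aeval_X]
  have hτ := RatField.t_ne_zero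
  have key : ∃ i : Fin 3, i ≠ 0 ∧ coneHom 0 (RatField.tau 0) (RatField.fib α k 0) (Hyp.x _ i) *
      RatField.tau j = coneHom 0 (RatField.tau 0) (RatField.fib α k 0) (Hyp.x _ 0) := by
    fin_cases j
    · refine ⟨1, by decide, ?_⟩
      rw [coneHom, Hyp.lift_p, Hyp.lift_t]
      simp [conicTuple]
    · refine ⟨2, by decide, ?_⟩
      rw [coneHom, Hyp.lift_q, Hyp.lift_t]
      simp [conicTuple, RatField.tau]
      field_simp
  obtain ⟨i, hi, h3⟩ := key
  refine Cone.no_fraction hd0 i hi (θ Polynomial.X) (hψ ?_)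
  rw [map_mul, hψb, hψb, h2, h3]

/-- The parameter t on either chart represents π. Agreement with `chartProj` on the overlap, which
is reduced, is checked at the generic point because the conic is separated. -/
theorem surfOpen_le_domain (hd : Dense (chart α : Set (Quartic α))) (j : Fin 2) :
    surfOpen α (surfIdx j) ≤ (ratProj α hd).domain := by
  have hr : Set.range (surfChart α j) = Set.range (surfOpen α (surfIdx j)).ι := by
    rw [(isOpenImmersion_surfChart α j).2, Scheme.Opens.range_ι]
  let e := IsOpenImmersion.isoOfRangeEq (surfChart α j) (surfOpen α (surfIdx j)).ι hr
  have he : e.inv ≫ surfChart α j = (surfOpen α (surfIdx j)).ι :=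
    IsOpenImmersion.isoOfRangeEq_inv_fac _ _ _
  have hr0 : Set.range (surfChart α 0) = Set.range (chart α).ι := by
    rw [(isOpenImmersion_surfChart α 0).2, Scheme.Opens.range_ι, chart_eq]
  let e0 := IsOpenImmersion.isoOfRangeEq (surfChart α 0) (chart α).ι hr0
  have he0 : e0.hom ≫ (chart α).ι = surfChart α 0 :=
    IsOpenImmersion.isoOfRangeEq_hom_fac _ _ _
  let p : (surfOpen α (surfIdx j)).toScheme ⟶ Conic := e.inv ≫ conicPt j (Hyp.x (chartPoly α j) 0)
  let f : (Quartic α).PartialMap Conic := ⟨surfOpen α (surfIdx j), dense_surfOpen α j, p⟩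
  have hp : p ≫ Conic.str = (surfOpen α (surfIdx j)).ι ≫ Quartic.str α := by
    rw [Category.assoc, conicPt_str, ← he, Category.assoc, surfChart_str]
  have hc : chartProj α ≫ Conic.str = (chart α).ι ≫ Quartic.str α := by
    rw [← cancel_epi e0.hom, ← Category.assoc, surfChart_comp_chartProj _ he0, conicPt_str,
      ← Category.assoc, he0, surfChart_str]
  let W := surfOpen α (surfIdx j) ⊓ chart α
  have hW1 : W ≤ surfOpen α (surfIdx j) := inf_le_left
  have hW2 : W ≤ chart α := inf_le_right
  have hgW : Set.range (genPt α) ⊆ Set.range W.ι := by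
    rw [Scheme.Opens.range_ι]
    rintro _ ⟨z, rfl⟩
    refine ⟨genPt_mem_surfOpen α j z, ?_⟩
    rw [chart_eq]
    exact genPt_mem_surfOpen α 0 z
  let w := IsOpenImmersion.lift W.ι (genPt α) hgW
  have hw : w ≫ W.ι = genPt α := IsOpenImmersion.lift_fac _ _ _
  have hgd := isDominant_genPt α
  have : IsDominant (w ≫ W.ι) := by rwa [hw]
  have hwd : IsDominant w := .of_comp_of_isOpenImmersion w W.ι
  have hWd : Dense (W : Set (Quartic α)) :=
    (dense_surfOpen α j).inter_of_isOpen_left hd (surfOpen α (surfIdx j)).2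
  have hred : AlgebraicGeometry.IsReduced W.toScheme := by
    have := Hyp.isDomain (chartPoly_ne_zero α j)
    exact isReduced_of_isOpenImmersion ((Quartic α).homOfLE hW1 ≫ e.inv)
  have hfe : f.toRationalMap = ratProj α hd := by
    refine Scheme.PartialMap.toRationalMap_eq_iff.mpr ⟨W, hWd, hW1, hW2, ?_⟩
    change (Quartic α).homOfLE hW1 ≫ p = (Quartic α).homOfLE hW2 ≫ chartProj α
    refine ext_of_isDominant_of_isSeparated Conic.str ?_ w ?_
    · rw [Category.assoc _ p, Category.assoc _ (chartProj α), hp, hc, Scheme.homOfLE_ι_assoc,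
        Scheme.homOfLE_ι_assoc]
    · have h1 : w ≫ (Quartic α).homOfLE hW2 ≫ chartProj α = genConicPt := by
        rw [← Category.assoc]
        apply genPt_comp_chartProj
        rw [Category.assoc, Scheme.homOfLE_ι, hw]
      have h2 : w ≫ (Quartic α).homOfLE hW1 ≫ e.inv =
          Spec.map (CommRingCat.ofHom (surfHom α j).toRingHom) := by
        rw [← cancel_mono (surfChart α j), Category.assoc, Category.assoc, he, Scheme.homOfLE_ι, hw,
          SpecMap_surfHom_surfChart]
      rw [h1]
      change w ≫ (Quartic α).homOfLE hW1 ≫ e.inv ≫ _ = _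
      rw [← Category.assoc, ← Category.assoc, Category.assoc w, h2, SpecMap_conicPt, surfHom,
        Hyp.lift_t, conicPt_tau]
  rw [← hfe]
  exact f.le_domain_toRationalMap

theorem compl_domain_eq (hd : Dense (chart α : Set (Quartic α))) :
    ((ratProj α hd).domain : Set (Quartic α))ᶜ = Set.range (vertex α) := by
  refine subset_antisymm (fun z hz => ?_) ?_
  · rw [← compl_iUnion_surfOpen]
    exact fun j hj => hz (surfOpen_le_domain α hd j hj)
  · rintro _ ⟨k, rfl⟩
    exact vertex_notMem_domain α hd k

theorem ncard_range_vertex : (Set.range (vertex α)).ncard = 2 := by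
  rw [← Set.image_univ, Set.ncard_image_of_injective _ (vertex_injective α), Set.ncard_univ]
  simp

end Vertices

end Minitwistor

namespace Minitwistor

/-! ### Completions of local rings of hypersurfaces -/

section Completion

open MvPolynomial (idealOfVars mem_pow_idealOfVars_iff')
open Finsupp (degree)

variable {m : ℕ}

/-- A coefficient in degree d no longer changes from the index d + 1 on, so the limit reads it
there. -/
theorem MvPowerSeries.exists_of_cauchy (p : ℕ → MvPolynomial (Fin m) ℂ)
    (hp : ∀ n, p (n + 1) - p n ∈ idealOfVars (Fin m) ℂ ^ n) :
    ∃ F : MvPowerSeries (Fin m) ℂ, ∀ n, MvPowerSeries.truncTotal n F - p n ∈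
      idealOfVars (Fin m) ℂ ^ n := by
  have h : ∀ k n, n ≤ k → p k - p n ∈ idealOfVars (Fin m) ℂ ^ n := by
    intro k n hk
    induction k, hk using Nat.le_induction with
    | base => simp
    | succ k hk ih =>
      have := add_mem (Ideal.pow_le_pow_right hk (hp k)) ih
      rwa [sub_add_sub_cancel] at this
  let F : MvPowerSeries (Fin m) ℂ := fun e => (p (degree e + 1)).coeff e
  refine ⟨F, fun n => (mem_pow_idealOfVars_iff' _ _).mpr fun e he => ?_⟩
  have h1 := (mem_pow_idealOfVars_iff' _ _).mp (h n (degree e + 1) he) e (Nat.lt_succ_self _)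
  rw [MvPolynomial.coeff_sub, sub_eq_zero] at h1 ⊢
  rw [MvPowerSeries.coeff_truncTotal _ he, h1]
  rfl

/-- Orders add under multiplication, so with r the order of g the n-th approximate quotient is
determined in degrees below n - r. The coefficients stabilize and define the quotient. -/
theorem MvPowerSeries.dvd_of_forall_truncTotal (g : MvPolynomial (Fin m) ℂ) (hg : g ≠ 0)
    (F : MvPowerSeries (Fin m) ℂ)
    (h : ∀ n, MvPowerSeries.truncTotal n F ∈ idealOfVars (Fin m) ℂ ^ n ⊔ Ideal.span {g}) :
    (g : MvPowerSeries (Fin m) ℂ) ∣ F := by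
  have hw : ∀ n, ∃ w : MvPolynomial (Fin m) ℂ, ∀ e, degree e < n →
      MvPowerSeries.coeff e F = (g * w).coeff e := by
    intro n
    obtain ⟨u, hu, v, hv, huv⟩ := Submodule.mem_sup.mp (h n)
    obtain ⟨w, rfl⟩ := Ideal.mem_span_singleton'.mp hv
    refine ⟨w, fun e he => ?_⟩
    rw [← MvPowerSeries.coeff_truncTotal _ he, ← huv, MvPolynomial.coeff_add,
      (mem_pow_idealOfVars_iff' _ _).mp hu e he, zero_add, mul_comm]
  choose w hw using hw
  have hg0 : (g : MvPowerSeries (Fin m) ℂ) ≠ 0 := by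
    rw [Ne, ← MvPolynomial.coe_zero, MvPolynomial.coe_inj]; exact hg
  obtain ⟨r, hr⟩ : ∃ r : ℕ, (g : MvPowerSeries (Fin m) ℂ).order = r :=
    ⟨_, (MvPowerSeries.ne_zero_iff_order_finite.mp hg0).symm⟩
  have hord : ∀ (d : MvPowerSeries (Fin m) ℂ) (n : ℕ),
      (∀ e, degree e < n → MvPowerSeries.coeff e ((g : MvPowerSeries (Fin m) ℂ) * d) = 0) →
      ∀ e, degree e + r < n → MvPowerSeries.coeff e d = 0 := by
    intro d n hd e he
    apply MvPowerSeries.coeff_of_lt_order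
    have h1 := MvPowerSeries.nat_le_order hd
    rw [MvPowerSeries.order_mul, hr, add_comm] at h1
    by_contra hlt
    have h2 : d.order + r ≤ ((degree e : ℕ) : ℕ∞) + r := add_le_add_left (not_lt.mp hlt) _
    have h3 : (n : ℕ∞) ≤ ((degree e + r : ℕ) : ℕ∞) := by push_cast; exact h1.trans h2
    have : n ≤ degree e + r := by exact_mod_cast h3
    omega
  have hww : ∀ k n, n ≤ k → ∀ e, degree e + r < n → (w k).coeff e = (w n).coeff e := by
    intro k n hkn e he
    have := hord ((w k : MvPowerSeries (Fin m) ℂ) - w n) n (fun e he => by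
      rw [mul_sub, map_sub, ← MvPolynomial.coe_mul, ← MvPolynomial.coe_mul,
        MvPolynomial.coeff_coe, MvPolynomial.coeff_coe, ← hw n e he, ← hw k e (he.trans_le hkn),
        sub_self]) e he
    rwa [map_sub, MvPolynomial.coeff_coe, MvPolynomial.coeff_coe, sub_eq_zero] at this
  let W : MvPowerSeries (Fin m) ℂ := fun e => (w (degree e + r + 1)).coeff e
  have hW : ∀ e, MvPowerSeries.coeff e W = (w (degree e + r + 1)).coeff e := fun _ => rfl
  refine ⟨W, MvPowerSeries.ext fun e => ?_⟩
  have h1 : MvPowerSeries.coeff e ((g : MvPowerSeries (Fin m) ℂ) *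
      (W - (w (degree e + r + 1) : MvPowerSeries (Fin m) ℂ))) = 0 := by
    apply MvPowerSeries.coeff_of_lt_order
    refine lt_of_lt_of_le ?_ MvPowerSeries.le_order_mul
    have h2 : ((degree e + 1 : ℕ) : ℕ∞) ≤
        (W - (w (degree e + r + 1) : MvPowerSeries (Fin m) ℂ)).order :=
      MvPowerSeries.nat_le_order fun d hd => by
        rw [map_sub, hW, MvPolynomial.coeff_coe, sub_eq_zero]
        exact (hww _ _ (by omega) d (by omega)).symm
    refine lt_of_lt_of_le ?_ (h2.trans le_add_self)
    exact_mod_cast Nat.lt_succ_self _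
  rw [mul_sub, map_sub, sub_eq_zero] at h1
  rw [h1, ← MvPolynomial.coe_mul, MvPolynomial.coeff_coe]
  exact hw _ e (by omega)

variable {O : Type} [CommRing O] [IsLocalRing O] (φ : MvPolynomial (Fin m) ℂ →+* O)

open IsLocalRing in
-- One step of successive approximation: modulo the next power of the maximal ideal, coefficients
-- may be replaced by constants.
theorem exists_mem_pow_sub_mem (h1 : maximalIdeal O = (idealOfVars (Fin m) ℂ).map φ)
    (h2 : ∀ r, ∃ c : ℂ, r - φ (MvPolynomial.C c) ∈ maximalIdeal O) (n : ℕ) (a : O)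
    (ha : a ∈ maximalIdeal O ^ n) :
    ∃ d ∈ idealOfVars (Fin m) ℂ ^ n, a - φ d ∈ maximalIdeal O ^ (n + 1) := by
  have hmap : maximalIdeal O ^ n = (idealOfVars (Fin m) ℂ ^ n).map φ := by rw [h1, Ideal.map_pow]
  have ha' := ha
  rw [hmap, Ideal.map] at ha'
  induction ha' using Submodule.span_induction with
  | mem x hx =>
    obtain ⟨d, hd, rfl⟩ := hx
    exact ⟨d, hd, by simp⟩
  | zero => exact ⟨0, zero_mem _, by simp⟩
  | add x y hx hy ihx ihy =>
    obtain ⟨d, hd, h⟩ := ihx (hmap ▸ hx)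
    obtain ⟨d', hd', h'⟩ := ihy (hmap ▸ hy)
    refine ⟨d + d', add_mem hd hd', ?_⟩
    rw [map_add, add_sub_add_comm]
    exact add_mem h h'
  | smul r x hx ih =>
    obtain ⟨d, hd, h⟩ := ih (hmap ▸ hx)
    obtain ⟨c, hc⟩ := h2 r
    refine ⟨MvPolynomial.C c * d, Ideal.mul_mem_left _ _ hd, ?_⟩
    have e : r • x - φ (MvPolynomial.C c * d) = (r - φ (MvPolynomial.C c)) * x +
        φ (MvPolynomial.C c) * (x - φ d) := by
      rw [smul_eq_mul, map_mul]; ring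
    rw [e]
    refine add_mem ?_ (Ideal.mul_mem_left _ _ h)
    rw [pow_succ']
    exact Ideal.mul_mem_mul hc (hmap ▸ hx)

open IsLocalRing in
-- Truncations of a power series give compatible elements of the quotients by powers of the maximal
-- ideal. Successive approximation makes the resulting map surjective; `h3` says that a series in
-- the kernel is a multiple of g to every finite order, hence divisible by g.
theorem nonempty_adicCompletion_equiv (h1 : maximalIdeal O = (idealOfVars (Fin m) ℂ).map φ)
    (h2 : ∀ r, ∃ c : ℂ, r - φ (MvPolynomial.C c) ∈ maximalIdeal O) (g : MvPolynomial (Fin m) ℂ)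
    (hg0 : g ≠ 0) (hg : φ g = 0)
    (h3 : ∀ n p, φ p ∈ maximalIdeal O ^ n → p ∈ idealOfVars (Fin m) ℂ ^ n ⊔ Ideal.span {g}) :
    Nonempty (AdicCompletion (maximalIdeal O) O ≃+*
      (MvPowerSeries (Fin m) ℂ ⧸ Ideal.span {(g : MvPowerSeries (Fin m) ℂ)})) := by
  have hle : ∀ n, idealOfVars (Fin m) ℂ ^ n ≤ (maximalIdeal O ^ n).comap φ := fun n => by
    rw [← Ideal.map_le_iff_le_comap, Ideal.map_pow, h1]
  let f : ∀ n, MvPowerSeries (Fin m) ℂ →+* O ⧸ maximalIdeal O ^ n := fun n =>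
    (Ideal.quotientMap (maximalIdeal O ^ n) φ (hle n)).comp
      (MvPowerSeries.truncTotalAlgHom (Fin m) ℂ n).toRingHom
  have hf : ∀ n F, f n F = Ideal.Quotient.mk _ (φ (MvPowerSeries.truncTotal n F)) := fun _ _ => rfl
  let θ : MvPowerSeries (Fin m) ℂ →+* AdicCompletion (maximalIdeal O) O :=
    AdicCompletion.liftRingHom (maximalIdeal O) f (fun {k n} hkn => by
      refine RingHom.ext fun F => ?_
      rw [RingHom.comp_apply, hf, hf, Ideal.Quotient.factor_mk, Ideal.Quotient.eq, ← map_sub]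
      exact hle k (MvPowerSeries.truncTotal_sub_truncTotal_mem_pow_idealOfVars hkn le_rfl F))
  have hθ : ∀ n F, AdicCompletion.evalₐ (maximalIdeal O) n (θ F) =
      Ideal.Quotient.mk _ (φ (MvPowerSeries.truncTotal n F)) := fun n F =>
    (AdicCompletion.evalₐ_liftRingHom _ _ _ n F).trans (hf n F)
  have hsurj : Function.Surjective θ := by
    intro A
    obtain ⟨a, ha, hcompat⟩ : ∃ a : ℕ → O,
        (∀ n, Ideal.Quotient.mk _ (a n) = AdicCompletion.evalₐ (maximalIdeal O) n A) ∧
        ∀ n, a (n + 1) - a n ∈ maximalIdeal O ^ n := by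
      induction A using AdicCompletion.induction_on with
      | h x =>
        refine ⟨fun n => x.val n, fun n => (AdicCompletion.evalₐ_mk _ n x).symm, fun n => ?_⟩
        have := SModEq.sub_mem.mp (x.property n.le_succ).symm
        simpa using this
    have hstep : ∀ n (p : MvPolynomial (Fin m) ℂ), a n - φ p ∈ maximalIdeal O ^ n →
        ∃ q, a (n + 1) - φ q ∈ maximalIdeal O ^ (n + 1) ∧ q - p ∈ idealOfVars (Fin m) ℂ ^ n := by
      intro n p hp
      obtain ⟨d, hd, h⟩ := exists_mem_pow_sub_mem φ h1 h2 n (a (n + 1) - φ p) (by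
        have := add_mem (hcompat n) hp
        rwa [sub_add_sub_cancel] at this)
      exact ⟨p + d, by rwa [map_add, ← sub_sub], by rwa [add_sub_cancel_left]⟩
    choose! q hq hq' using hstep
    let p : ℕ → MvPolynomial (Fin m) ℂ := fun n => Nat.rec 0 q n
    have hp : ∀ n, a n - φ (p n) ∈ maximalIdeal O ^ n := by
      intro n
      induction n with
      | zero => simp
      | succ n ih => exact hq n _ ih
    obtain ⟨F, hF⟩ := MvPowerSeries.exists_of_cauchy p fun n => hq' n _ (hp n)
    refine ⟨F, AdicCompletion.ext_evalₐ fun n => ?_⟩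
    rw [hθ, ← ha, Ideal.Quotient.eq]
    have e : φ (MvPowerSeries.truncTotal n F) - a n =
      φ (MvPowerSeries.truncTotal n F - p n) - (a n - φ (p n)) := by rw [map_sub]; ring
    rw [e]
    exact sub_mem (hle n (hF n)) (hp n)
  have hker : RingHom.ker θ = Ideal.span {(g : MvPowerSeries (Fin m) ℂ)} := by
    refine le_antisymm (fun F hF => ?_) ?_
    · rw [Ideal.mem_span_singleton]
      refine MvPowerSeries.dvd_of_forall_truncTotal g hg0 F fun n => h3 n _ ?_
      rw [← Ideal.Quotient.eq_zero_iff_mem, ← hθ, RingHom.mem_ker.mp hF, map_zero]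
    · rw [Ideal.span_le, Set.singleton_subset_iff]
      refine AdicCompletion.ext_evalₐ fun n => ?_
      rw [hθ, map_zero, Ideal.Quotient.eq_zero_iff_mem, ← sub_zero (φ _), ← hg, ← map_sub]
      refine hle n ((mem_pow_idealOfVars_iff' _ _).mpr fun e he => ?_)
      rw [MvPolynomial.coeff_sub, MvPowerSeries.coeff_truncTotal _ he, MvPolynomial.coeff_coe,
        sub_self]
  exact ⟨((Ideal.quotEquivOfEq hker.symm).trans (RingHom.quotientKerEquivOfSurjective hsurj)).symm⟩

end Completion

/-! ### The vertices are ordinary double points -/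

open MvPolynomial (idealOfVars) in
theorem Cone.ker_ev_eq (χ : MvPolynomial (Fin 3) ℂ →+* Cone)
    (h : ∀ i, ∃ k, χ (MvPolynomial.X k) = Hyp.x _ i) (h' : ∀ k, ev (χ (MvPolynomial.X k)) = 0) :
    RingHom.ker ev = (idealOfVars (Fin 3) ℂ).map χ := by
  refine le_antisymm (fun b hb => ?_) ?_
  · have := sub_algebraMap_ev_mem (AlgHom.id ℂ Cone) ((idealOfVars (Fin 3) ℂ).map χ) (fun i => by
      obtain ⟨k, hk⟩ := h i
      rw [AlgHom.id_apply, ← hk]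
      exact Ideal.mem_map_of_mem _ (Ideal.subset_span ⟨k, rfl⟩)) b
    rw [RingHom.mem_ker] at hb
    simpa [hb] using this
  · rw [Ideal.map_le_iff_le_comap, Ideal.span_le]
    rintro _ ⟨k, rfl⟩
    exact h' k

/-- The coordinate ring of affine space with the coordinates `x = p`, `y = q`, `z = t`. -/
noncomputable def Cone.ofPoly : MvPolynomial (Fin 3) ℂ →ₐ[ℂ] Cone :=
  MvPolynomial.aeval ![Hyp.x _ 1, Hyp.x _ 2, Hyp.x _ 0]

open MvPolynomial in
theorem Cone.ker_ofPoly : RingHom.ker Cone.ofPoly = Ideal.span {X 0 * X 1 - X 2 ^ 2} := by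
  set I : Ideal (MvPolynomial (Fin 3) ℂ) := Ideal.span {X 0 * X 1 - X 2 ^ 2}
  have hI : (Ideal.Quotient.mk I (X 0)) * (Ideal.Quotient.mk I (X 1)) =
      (Ideal.Quotient.mk I (X 2)) ^ 2 := by
    rw [← map_mul, ← map_pow, Ideal.Quotient.eq]
    exact Ideal.mem_span_singleton_self _
  refine le_antisymm (fun p hp => ?_) ?_
  · let ψ : Cone →ₐ[ℂ] MvPolynomial (Fin 3) ℂ ⧸ I := Hyp.lift (Ideal.Quotient.mk I (X 2))
      (Ideal.Quotient.mk I (X 0)) (Ideal.Quotient.mk I (X 1)) (by rw [hI]; simp)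
    have h : ψ.comp Cone.ofPoly = Ideal.Quotient.mkₐ ℂ I := by
      apply MvPolynomial.algHom_ext
      intro i
      fin_cases i
      · simpa [Cone.ofPoly] using Hyp.lift_p ..
      · simpa [Cone.ofPoly] using Hyp.lift_q ..
      · simpa [Cone.ofPoly] using Hyp.lift_t ..
    have h1 := congrArg (fun f => f p) h
    simp only [AlgHom.comp_apply] at h1
    rw [RingHom.mem_ker.mp hp, map_zero] at h1
    exact Ideal.Quotient.eq_zero_iff_mem.mp h1.symm
  · rw [Ideal.span_le, Set.singleton_subset_iff]
    have := Cone.rel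
    simp [Cone.ofPoly, this]

theorem Cone.ofPoly_surjective : Function.Surjective Cone.ofPoly := by
  rw [← AlgHom.range_eq_top, eq_top_iff, ← Hyp.adjoin_eq_top, Algebra.adjoin_le_iff]
  rintro _ (rfl | rfl | rfl)
  · exact ⟨MvPolynomial.X 2, by simp [Cone.ofPoly]⟩
  · exact ⟨MvPolynomial.X 0, by simp [Cone.ofPoly]⟩
  · exact ⟨MvPolynomial.X 1, by simp [Cone.ofPoly]⟩

open IsLocalRing MvPolynomial in
theorem Cone.nonempty_adicCompletion_equiv {O : Type} [CommRing O] [IsLocalRing O] [Algebra Cone O]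
    [IsLocalization.AtPrime O origin.asIdeal] :
    Nonempty (AdicCompletion (maximalIdeal O) O ≃+* (MvPowerSeries (Fin 3) ℂ ⧸
      Ideal.span {(MvPowerSeries.X 0 * MvPowerSeries.X 1 - MvPowerSeries.X 2 ^ 2 :
        MvPowerSeries (Fin 3) ℂ)})) := by
  have hmax : origin.asIdeal.IsMaximal :=
    RingHom.ker_isMaximal_of_surjective Cone.ev Cone.ev_surjective
  have hker : origin.asIdeal = (idealOfVars (Fin 3) ℂ).map Cone.ofPoly.toRingHom := by
    refine Cone.ker_ev_eq _ (fun i => ?_) fun k => ?_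
    · fin_cases i
      · exact ⟨2, by simp [Cone.ofPoly]⟩
      · exact ⟨0, by simp [Cone.ofPoly]⟩
      · exact ⟨1, by simp [Cone.ofPoly]⟩
    · fin_cases k <;> simp [Cone.ofPoly, Cone.ev_x]
  have hmO : maximalIdeal O = origin.asIdeal.map (algebraMap Cone O) :=
    (IsLocalization.AtPrime.map_eq_maximalIdeal origin.asIdeal O).symm
  let φ : MvPolynomial (Fin 3) ℂ →+* O := (algebraMap Cone O).comp Cone.ofPoly.toRingHom
  have h1 : maximalIdeal O = (idealOfVars (Fin 3) ℂ).map φ := by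
    rw [hmO, hker, Ideal.map_map]
  have hmem : ∀ b : Cone, b ∈ origin.asIdeal → algebraMap Cone O b ∈ maximalIdeal O := fun b hb =>
    hmO ▸ Ideal.mem_map_of_mem _ hb
  have hC : ∀ c : ℂ, φ (C c) = algebraMap Cone O (algebraMap ℂ Cone c) := fun c => by
    change algebraMap Cone O (Cone.ofPoly (C c)) = _
    rw [← MvPolynomial.algebraMap_eq, AlgHom.commutes]
  have hsub : ∀ b : Cone, b - algebraMap ℂ Cone (Cone.ev b) ∈ origin.asIdeal := fun b => by
    change Cone.ev _ = 0
    rw [map_sub, AlgHom.commutes]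
    exact sub_self _
  have h2 : ∀ r, ∃ c : ℂ, r - φ (C c) ∈ maximalIdeal O := by
    intro r
    obtain ⟨b, s, rfl⟩ := IsLocalization.exists_mk'_eq origin.asIdeal.primeCompl r
    have hs : Cone.ev s ≠ 0 := s.2
    refine ⟨Cone.ev b / Cone.ev s, ?_⟩
    have hu : IsUnit (algebraMap Cone O s) := IsLocalization.map_units O s
    rw [← Ideal.unit_mul_mem_iff_mem _ hu, mul_sub, IsLocalization.mk'_spec', hC, ← map_mul,
      ← map_sub]
    apply hmem
    change Cone.ev _ = 0
    rw [map_sub, map_mul, AlgHom.commutes]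
    change _ - _ * (Cone.ev b / Cone.ev s) = 0
    field_simp
    ring
  have h3 : ∀ n p, φ p ∈ maximalIdeal O ^ n → p ∈ idealOfVars (Fin 3) ℂ ^ n ⊔
      Ideal.span {X 0 * X 1 - X 2 ^ 2} := by
    intro n p hp
    have hp1 : algebraMap Cone O (Cone.ofPoly p) ∈ (origin.asIdeal ^ n).map (algebraMap Cone O) := by
      rw [Ideal.map_pow, ← hmO]; exact hp
    rw [IsLocalization.algebraMap_mem_map_algebraMap_iff origin.asIdeal.primeCompl] at hp1
    obtain ⟨s, hs, hsp⟩ := hp1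
    -- Powers of a maximal ideal are contracted from the localization: a denominator outside the
    -- ideal is invertible modulo each power.
    have hcop : origin.asIdeal ^ n ⊔ Ideal.span {s} = ⊤ := by
      apply Ideal.pow_sup_eq_top
      refine hmax.1.2 _ (lt_of_le_of_ne le_sup_left fun h => hs ?_)
      rw [h]
      exact Ideal.mem_sup_right (Ideal.mem_span_singleton_self s)
    have hp2 : Cone.ofPoly p ∈ origin.asIdeal ^ n := by
      obtain ⟨u, hu, v, hv, huv⟩ := Submodule.mem_sup.mp ((Ideal.eq_top_iff_one _).mp hcop)
      obtain ⟨r, rfl⟩ := Ideal.mem_span_singleton'.mp hv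
      have e : Cone.ofPoly p = Cone.ofPoly p * u + r * (s * Cone.ofPoly p) := by
        linear_combination -(Cone.ofPoly p) * huv
      rw [e]
      exact add_mem (Ideal.mul_mem_left _ _ hu) (Ideal.mul_mem_left _ _ hsp)
    rw [hker, ← Ideal.map_pow] at hp2
    obtain ⟨q, hq, hqp⟩ := (Ideal.mem_map_iff_of_surjective Cone.ofPoly.toRingHom
      Cone.ofPoly_surjective).mp hp2
    have : p - q ∈ RingHom.ker Cone.ofPoly := by
      rw [RingHom.mem_ker, map_sub, sub_eq_zero]
      exact hqp.symm
    rw [Cone.ker_ofPoly] at this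
    have h4 := add_mem (Ideal.mem_sup_left (T := Ideal.span {X 0 * X 1 - X 2 ^ 2}) hq)
      (Ideal.mem_sup_right this)
    rwa [add_sub_cancel] at h4
  have hφg : φ (X 0 * X 1 - X 2 ^ 2) = 0 := by
    have : (X 0 * X 1 - X 2 ^ 2 : MvPolynomial (Fin 3) ℂ) ∈ RingHom.ker Cone.ofPoly := by
      rw [Cone.ker_ofPoly]; exact Ideal.mem_span_singleton_self _
    change algebraMap Cone O (Cone.ofPoly _) = 0
    rw [RingHom.mem_ker.mp this, map_zero]
  have hg0 : (X 0 * X 1 - X 2 ^ 2 : MvPolynomial (Fin 3) ℂ) ≠ 0 := fun h => by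
    have := congrArg (MvPolynomial.eval ![1, 1, 0]) h
    simp at this
  have := Minitwistor.nonempty_adicCompletion_equiv φ h1 h2 _ hg0 hφg h3
  have hcoe : ((X 0 * X 1 - X 2 ^ 2 : MvPolynomial (Fin 3) ℂ) : MvPowerSeries (Fin 3) ℂ) =
      MvPowerSeries.X 0 * MvPowerSeries.X 1 - MvPowerSeries.X 2 ^ 2 := by
    rw [eq_sub_iff_add_eq, ← MvPolynomial.coe_X, ← MvPolynomial.coe_X, ← MvPolynomial.coe_X,
      ← MvPolynomial.coe_pow, ← MvPolynomial.coe_mul, ← MvPolynomial.coe_add, sub_add_cancel]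
  rwa [hcoe] at this

theorem isOrdinaryDoublePoint_vertex (α : ℝ) (k : Fin 2) : IsOrdinaryDoublePoint (vertex α k) := by
  have := (isOpenImmersion_vertChart α k).1
  let z : Spec (.of Cone) := Cone.origin
  let e : (Quartic α).presheaf.stalk (vertChart α k z) ≃+* (Spec (.of Cone)).presheaf.stalk z :=
    (asIso ((vertChart α k).stalkMap z)).commRingCatIsoToRingEquiv
  let _ : Algebra Cone ((Spec (.of Cone)).presheaf.stalk z) := StructureSheaf.stalkAlgebra Cone z
  have : IsLocalization.AtPrime ((Spec (.of Cone)).presheaf.stalk z) Cone.origin.asIdeal :=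
    StructureSheaf.IsLocalization.to_stalk Cone z
  let _ : Algebra Cone ((Quartic α).presheaf.stalk (vertChart α k z)) :=
    ((e.symm : _ →+* _).comp (algebraMap Cone ((Spec (.of Cone)).presheaf.stalk z))).toAlgebra
  have : IsLocalization.AtPrime ((Quartic α).presheaf.stalk (vertChart α k z))
      Cone.origin.asIdeal :=
    IsLocalization.isLocalization_of_algEquiv Cone.origin.asIdeal.primeCompl
      (AlgEquiv.ofRingEquiv (f := e.symm) fun _ => rfl)
  exact Cone.nonempty_adicCompletion_equiv (O := (Quartic α).presheaf.stalk (vertChart α k z))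

end Minitwistor

namespace Minitwistor

open Limits

/-! ### Isomorphisms given by charts -/

/-- The overlaps are reduced and the target is separated, so compatibility of the local maps needs
checking only at a common generic point. -/
theorem exists_hom_of_charts {S V Y : Scheme.{0}} (sV : V ⟶ S) (sY : Y ⟶ S) [IsSeparated sY]
    {ι K : Type} [Field K] {A : ι → Scheme.{0}} [∀ i, AlgebraicGeometry.IsReduced (A i)]
    (a : ∀ i, A i ⟶ V) (b : ∀ i, A i ⟶ Y) [∀ i, IsOpenImmersion (a i)]
    (hab : ∀ i, a i ≫ sV = b i ≫ sY) (η : ∀ i, Spec (.of K) ⟶ A i) [∀ i, IsDominant (η i)]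
    (ha : ∀ i j, η i ≫ a i = η j ≫ a j) (hb : ∀ i j, η i ≫ b i = η j ≫ b j)
    (hcov : ∀ x : V, ∃ i, x ∈ Set.range (a i)) :
    ∃ f : V ⟶ Y, (∀ i, a i ≫ f = b i) ∧ f ≫ sY = sV := by
  let 𝒰 : V.OpenCover := .mkOfCovers ι A a (fun x => hcov x) inferInstance
  have hc : ∀ i j, pullback.fst (a i) (a j) ≫ b i = pullback.snd (a i) (a j) ≫ b j := by
    intro i j
    obtain ⟨z⟩ : Nonempty (Spec (.of K)) := inferInstance
    have : Nonempty (pullback (a i) (a j) :) := ⟨pullback.lift (η i) (η j) (ha i j) z⟩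
    have : AlgebraicGeometry.IsReduced (pullback (a i) (a j)) :=
      isReduced_of_isOpenImmersion (pullback.fst (a i) (a j))
    obtain ⟨ζ, hζ, hζ1⟩ := exists_lift_of_isDominant (η i) (pullback.fst (a i) (a j))
    have hζ2 : ζ ≫ pullback.snd (a i) (a j) = η j := by
      rw [← cancel_mono (a j), Category.assoc, ← pullback.condition, reassoc_of% hζ1, ha i j]
    refine ext_of_isDominant_of_isSeparated sY ?_ ζ ?_
    · rw [Category.assoc, Category.assoc, ← hab, ← hab, pullback.condition_assoc]
    · rw [reassoc_of% hζ1, reassoc_of% hζ2, hb i j]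
  have hg : ∀ i, a i ≫ Scheme.Cover.glueMorphisms 𝒰 b hc = b i :=
    Scheme.Cover.ι_glueMorphisms 𝒰 b hc
  refine ⟨Scheme.Cover.glueMorphisms 𝒰 b hc, hg, Scheme.Cover.hom_ext 𝒰 _ _ ?_⟩
  have : ∀ i : ι, a i ≫ Scheme.Cover.glueMorphisms 𝒰 b hc ≫ sY = a i ≫ sV := fun i => by
    rw [reassoc_of% hg, hab]
  exact this

theorem exists_iso_of_charts {S V Y : Scheme.{0}} (sV : V ⟶ S) (sY : Y ⟶ S) [IsSeparated sV]
    [IsSeparated sY] {ι K : Type} [Field K] {A : ι → Scheme.{0}}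
    [∀ i, AlgebraicGeometry.IsReduced (A i)] (a : ∀ i, A i ⟶ V) (b : ∀ i, A i ⟶ Y)
    [∀ i, IsOpenImmersion (a i)] [∀ i, IsOpenImmersion (b i)]
    (hab : ∀ i, a i ≫ sV = b i ≫ sY) (η : ∀ i, Spec (.of K) ⟶ A i) [∀ i, IsDominant (η i)]
    (ha : ∀ i j, η i ≫ a i = η j ≫ a j) (hb : ∀ i j, η i ≫ b i = η j ≫ b j)
    (hcov : ∀ x : V, ∃ i, x ∈ Set.range (a i)) (hcov' : ∀ y : Y, ∃ i, y ∈ Set.range (b i)) :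
    ∃ e : V ≅ Y, e.hom ≫ sY = sV := by
  obtain ⟨f, hf, hfs⟩ := exists_hom_of_charts sV sY a b hab η ha hb hcov
  obtain ⟨f', hf', -⟩ := exists_hom_of_charts sY sV b a (fun i => (hab i).symm) η hb ha hcov'
  refine ⟨⟨f, f', ?_, ?_⟩, hfs⟩
  · let 𝒰 : V.OpenCover := .mkOfCovers ι A a (fun x => hcov x) inferInstance
    refine Scheme.Cover.hom_ext 𝒰 _ _ ?_
    have : ∀ i : ι, a i ≫ f ≫ f' = a i ≫ 𝟙 V := fun i => by rw [reassoc_of% hf, hf', Category.comp_id]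
    exact this
  · let 𝒰 : Y.OpenCover := .mkOfCovers ι A b (fun x => hcov' x) inferInstance
    refine Scheme.Cover.hom_ext 𝒰 _ _ ?_
    have : ∀ i : ι, b i ≫ f' ≫ f = b i ≫ 𝟙 Y := fun i => by rw [reassoc_of% hf', hf, Category.comp_id]
    exact this

/-! ### Reduced closed subschemes -/

/-- As i is a monomorphism, l is the base change of l ≫ i along i. -/
theorem isOpenImmersion_of_comp_mono {U Z F : Scheme.{0}} (l : U ⟶ Z) (i : Z ⟶ F) [Mono i]
    [IsOpenImmersion (l ≫ i)] : IsOpenImmersion l := by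
  have : IsPullback (𝟙 U) l (l ≫ i) i :=
    ⟨⟨by simp⟩, ⟨PullbackCone.IsLimit.mk _ (fun s => s.fst) (fun s => by simp)
      (fun s => by rw [← cancel_mono i, Category.assoc, s.condition])
      (fun s m h _ => by simpa using h)⟩⟩
  exact MorphismProperty.of_isPullback (P := @IsOpenImmersion) this inferInstance

theorem isReduced_vanishingIdeal_subscheme {F : Scheme.{0}} (Z : TopologicalSpace.Closeds F) :
    AlgebraicGeometry.IsReduced (Scheme.IdealSheafData.vanishingIdeal Z).subscheme := by
  let I := Scheme.IdealSheafData.vanishingIdeal Z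
  have (U : F.affineOpens) : _root_.IsReduced (Γ(F, U) ⧸ I.ideal U) := by
    rw [← Ideal.isRadical_iff_quotient_reduced]
    exact PrimeSpectrum.isRadical_vanishingIdeal _
  have (U : I.subschemeCover.openCover.I₀) :
      AlgebraicGeometry.IsReduced (I.subschemeCover.openCover.X U) :=
    (affine_isReduced_iff (.of (Γ(F, U.1) ⧸ I.ideal U))).mpr (this U)
  exact IsReduced.of_openCover _ I.subschemeCover.openCover

/-- A reduced source makes the kernel radical, so it contains the vanishing ideal of Z. -/
theorem exists_lift_reducedι {A F : Scheme.{0}} [AlgebraicGeometry.IsReduced A] (f : A ⟶ F)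
    [QuasiCompact f] (Z : TopologicalSpace.Closeds F) (hf : Set.range f ⊆ Z) :
    ∃ l, l ≫ reducedι Z = f := by
  have h1 : f.ker.radical = f.ker := by
    ext U : 2
    rw [Scheme.IdealSheafData.radical_ideal, Scheme.Hom.ker_apply]
    refine Ideal.IsRadical.radical fun x ⟨n, hn⟩ => ?_
    rw [RingHom.mem_ker, map_pow] at hn
    exact eq_zero_of_pow_eq_zero hn
  have h2 : Scheme.IdealSheafData.vanishingIdeal Z ≤ f.ker := by
    rw [← h1, ← Scheme.IdealSheafData.vanishingIdeal_support]
    refine Scheme.IdealSheafData.vanishingIdeal_antimono ?_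
    change (f.ker.support : Set F) ⊆ Z
    rw [Scheme.Hom.support_ker]
    exact closure_minimal hf Z.isClosed
  refine ⟨f.toImage ≫ Scheme.IdealSheafData.inclusion h2, ?_⟩
  rw [reducedι, Category.assoc, Scheme.IdealSheafData.inclusion_subschemeι]
  exact f.toImage_imageι

theorem birationalOver_of_charts {S A V Y : Scheme.{0}} (sV : V ⟶ S) (sY : Y ⟶ S) (a : A ⟶ V)
    (b : A ⟶ Y) [IsOpenImmersion a] [IsOpenImmersion b] [IsDominant a] [IsDominant b]
    (h : a ≫ sV = b ≫ sY) : Scheme.BirationalOver sV sY := by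
  refine ⟨⟨a.opensRange, a.denseRange, b.opensRange, b.denseRange,
    a.isoOpensRange.symm ≪≫ b.isoOpensRange⟩, ?_⟩
  rw [Scheme.PartialIso.IsOver]
  simp [← h]

/-! ### The projective line -/

/-- The standard parametrizations `(1 : x)` and `(x : 1)` of the projective line. -/
def lineTuple {B : Type*} [CommRing B] (k : Fin 2) (x : B) : Fin 2 → B :=
  if k = 0 then ![1, x] else ![x, 1]

theorem isUnit_lineTuple {B : Type*} [CommRing B] (k : Fin 2) (x : B) :
    IsUnit (lineTuple k x k) := by
  fin_cases k <;> simp [lineTuple]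

theorem isPt_lineTuple {B : Type} [CommRing B] [Algebra ℂ B] (k : Fin 2) (x : B) :
    IsPt (MvPolynomial.X : Fin 2 → MvPolynomial (Fin 2) ℂ) (lineTuple k x) :=
  ⟨MvPolynomial.aeval (lineTuple k x), fun _ => MvPolynomial.aeval_X _ _⟩

/-- The `B`-valued point of the line with coordinate `x` in the chart `k`. -/
noncomputable def linePt {B : Type} [CommRing B] [Algebra ℂ B] (k : Fin 2) (x : B) :
    Spec (.of B) ⟶ P1 :=
  coordPt (isCoordSystem_coordGrading 2) (isPt_lineTuple k x) k (isUnit_lineTuple k x)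

theorem SpecMap_linePt {B B' : Type} [CommRing B] [Algebra ℂ B] [CommRing B'] [Algebra ℂ B']
    (φ : B →ₐ[ℂ] B') (k : Fin 2) (x : B) :
    Spec.map (CommRingCat.ofHom φ.toRingHom) ≫ linePt k x = linePt k (φ x) :=
  SpecMap_coordPt _ _ _ _ _ _ _ _ 1 fun i => by
    fin_cases k <;> fin_cases i <;> simp [lineTuple]

theorem linePt_zero_eq_linePt_one {B : Type} [CommRing B] [Algebra ℂ B] {x y : B}
    (h : x * y = 1) : linePt 0 x = linePt 1 y :=
  coordPt_congr _ _ _ _ _ _ _ y fun i => by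
    fin_cases i <;> simp [lineTuple, mul_comm y x, h]

/-- The charts of the projective line with coordinates scaled by `u`. -/
noncomputable def lineChart (u : ℂ) (k : Fin 2) : Spec (.of (Polynomial ℂ)) ⟶ P1 :=
  linePt k (Polynomial.C u * Polynomial.X)

theorem lineChart_str (u : ℂ) (k : Fin 2) : lineChart u k ≫ projStr (coordGrading 2) =
    Spec.map (CommRingCat.ofHom (algebraMap ℂ (Polynomial ℂ))) :=
  coordPt_projStr (isCoordSystem_coordGrading 2) (isPt_lineTuple k _) k (isUnit_lineTuple k _)

theorem adjoin_C_mul_X {u : ℂ} (hu : u ≠ 0) :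
    Algebra.adjoin ℂ {Polynomial.C u * Polynomial.X} = ⊤ := by
  rw [eq_top_iff, ← Polynomial.adjoin_X]
  refine Algebra.adjoin_le (Set.singleton_subset_iff.mpr ?_)
  have h1 : (Polynomial.X : Polynomial ℂ) = Polynomial.C u⁻¹ * (Polynomial.C u * Polynomial.X) := by
    rw [← mul_assoc, ← Polynomial.C_mul, inv_mul_cancel₀ hu, Polynomial.C_1, one_mul]
  have h2 : Polynomial.C u⁻¹ ∈ Algebra.adjoin ℂ {Polynomial.C u * Polynomial.X} :=
    Subalgebra.algebraMap_mem _ u⁻¹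
  have h3 := mul_mem h2 (Algebra.self_mem_adjoin_singleton ℂ (Polynomial.C u * Polynomial.X))
  rwa [← h1] at h3

theorem isOpenImmersion_lineChart {u : ℂ} (hu : u ≠ 0) (k : Fin 2) :
    IsOpenImmersion (lineChart u k) ∧
      Set.range (lineChart u k) = Proj.basicOpen (coordGrading 2) (MvPolynomial.X k) := by
  let A := Localization.Away (MvPolynomial.X k : MvPolynomial (Fin 2) ℂ)
  let Y : Fin 2 → A := fun i => algebraMap (MvPolynomial (Fin 2) ℂ) A (MvPolynomial.X i)
  let w : A := IsLocalization.Away.invSelf (MvPolynomial.X k : MvPolynomial (Fin 2) ℂ)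
  have h1 : Y k * w = 1 := IsLocalization.Away.mul_invSelf _
  have h2 : algebraMap ℂ A u * algebraMap ℂ A u⁻¹ = 1 := by
    rw [← map_mul, mul_inv_cancel₀ hu, map_one]
  refine (isCoordSystem_coordGrading 2).isOpenImmersion_coordPt (isPt_lineTuple k _) k ?_
    (isUnit_lineTuple k _) ?_
    (Polynomial.aeval (algebraMap ℂ A u⁻¹ * Y (1 - k) * w)) ?_
  · fin_cases k <;> simp [lineTuple]
  · refine adjoin_eq_top_of_subset (adjoin_C_mul_X hu) (Set.singleton_subset_iff.mpr ⟨1 - k, ?_⟩)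
    fin_cases k <;> simp [lineTuple]
  · intro i
    change Y i = Y k * _
    have h3 : Polynomial.aeval (algebraMap ℂ A u⁻¹ * Y (1 - k) * w)
        (Polynomial.C u * Polynomial.X) = Y (1 - k) * w := by
      rw [map_mul, Polynomial.aeval_C, Polynomial.aeval_X]
      linear_combination Y (1 - k) * w * h2
    have h4 : Y (1 - k) = Y k * (Y (1 - k) * w) := by linear_combination -Y (1 - k) * h1
    fin_cases k <;> fin_cases i
    · simp [lineTuple]
    · exact h4.trans (congrArg _ h3.symm)
    · exact h4.trans (congrArg _ h3.symm)
    · simp [lineTuple]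

instance : IsProper (projStr (coordGrading 2)) := (isCoordSystem_coordGrading 2).isProper

theorem line_cover {u : ℂ} (hu : u ≠ 0) (y : P1) : ∃ k, y ∈ Set.range (lineChart u k) := by
  have := (isCoordSystem_coordGrading 2).iSup_basicOpen
  obtain ⟨k, hk⟩ := TopologicalSpace.Opens.mem_iSup.mp (this.ge (Set.mem_univ y) : y ∈ _)
  exact ⟨k, (Set.ext_iff.mp (isOpenImmersion_lineChart hu k).2 y).mpr hk⟩

/-- The function field of the line. -/
abbrev LineField : Type := FractionRing (Polynomial ℂ)

/-- The coordinate on the line. -/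
noncomputable def LineField.x : LineField := algebraMap (Polynomial ℂ) LineField Polynomial.X

/-- The value at the generic point of the coordinate `x` or `(e x)⁻¹`. -/
noncomputable def LineField.coord (e : ℂ) (k : Fin 2) : LineField :=
  if k = 0 then LineField.x else (algebraMap ℂ LineField e * LineField.x)⁻¹

theorem LineField.x_ne_zero : LineField.x ≠ 0 := by
  simp [LineField.x]

theorem LineField.transcendental_x : Transcendental ℂ LineField.x :=
  (transcendental_algebraMap_iff (IsFractionRing.injective _ _)).mpr (Polynomial.transcendental_X ℂ)

theorem LineField.transcendental_coord {e : ℂ} (he : e ≠ 0) (k : Fin 2) :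
    Transcendental ℂ (LineField.coord e k) := by
  fin_cases k
  · exact LineField.transcendental_x
  · intro h
    have h1 : IsAlgebraic ℂ (algebraMap ℂ LineField e * LineField.x) := IsAlgebraic.inv_iff.mp h
    refine LineField.transcendental_x ?_
    have h2 : LineField.x = algebraMap ℂ LineField e⁻¹ * (algebraMap ℂ LineField e * LineField.x) := by
      rw [← mul_assoc, ← map_mul, inv_mul_cancel₀ he, map_one, one_mul]
    rw [h2]
    exact (isAlgebraic_algebraMap _).mul h1

/-- The generic point of the line in the chart `k`. -/
noncomputable def lineGen (e : ℂ) (k : Fin 2) :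
    Spec (.of LineField) ⟶ Spec (.of (Polynomial ℂ)) :=
  Spec.map (CommRingCat.ofHom (Polynomial.aeval (R := ℂ) (LineField.coord e k)).toRingHom)

theorem isDominant_lineGen {e : ℂ} (he : e ≠ 0) (k : Fin 2) : IsDominant (lineGen e k) :=
  isDominant_SpecMap _ (transcendental_iff_injective.mp (LineField.transcendental_coord he k))

/-- After scaling by u, the coordinates x and 1/(u²x) become ux and 1/(ux), which are related by the
standard transition of the projective line. -/
theorem lineGen_lineChart {u : ℂ} (hu : u ≠ 0) (k : Fin 2) :
    lineGen (u ^ 2) k ≫ lineChart u k = linePt 0 (algebraMap ℂ LineField u * LineField.x) := by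
  rw [lineGen, lineChart, SpecMap_linePt, map_mul, Polynomial.aeval_C, Polynomial.aeval_X]
  have hu' : algebraMap ℂ LineField u ≠ 0 := by simpa using hu
  have := LineField.x_ne_zero
  fin_cases k
  · rfl
  · refine (linePt_zero_eq_linePt_one ?_).symm
    simp only [LineField.coord, Fin.mk_one, one_ne_zero, if_false, map_pow]
    field_simp

theorem isDominant_lineChart {u : ℂ} (hu : u ≠ 0) (k : Fin 2) : IsDominant (lineChart u k) := by
  have h1 (k) := isDominant_lineGen (pow_ne_zero 2 hu) k
  constructor
  intro y
  obtain ⟨k', hk'⟩ := line_cover hu y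
  have := range_subset_closure_range (lineGen (u ^ 2) k') (lineChart u k') hk'
  rw [lineGen_lineChart hu, ← lineGen_lineChart hu k] at this
  refine closure_mono ?_ this
  rw [Scheme.Hom.comp_base, TopCat.coe_comp]
  exact Set.range_comp_subset_range _ _

/-- The affine line lifts to a dense open subscheme of the reduced closed subscheme, which thereby
inherits irreducibility and birationality to the projective line. -/
theorem isRationalCurve_of_chart {F : Scheme.{0}} (s : F ⟶ Spec (.of ℂ)) [IsProper s]
    (v : Spec (.of (Polynomial ℂ)) ⟶ F) [IsOpenImmersion v]
    (hv : v ≫ s = Spec.map (CommRingCat.ofHom (algebraMap ℂ (Polynomial ℂ))))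
    (Z : TopologicalSpace.Closeds F) (hZ : (Z : Set F) = closure (Set.range v)) :
    IsRationalCurve (reducedι Z ≫ s) := by
  have : QuasiCompact v := by
    have : QuasiCompact (v ≫ s) := by rw [hv]; infer_instance
    exact QuasiCompact.of_comp v s
  obtain ⟨l, hl⟩ := exists_lift_reducedι v Z (hZ ▸ subset_closure)
  have : IsClosedImmersion (reducedι Z) := by rw [reducedι]; infer_instance
  have : IsOpenImmersion (l ≫ reducedι Z) := hl ▸ inferInstance
  have := isOpenImmersion_of_comp_mono l (reducedι Z)
  have hdom : IsDominant l := by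
    constructor
    rw [DenseRange, (reducedι Z).isEmbedding.isInducing.dense_iff]
    intro z
    rw [← Set.range_comp, ← TopCat.coe_comp, ← Scheme.Hom.comp_base, hl, ← hZ]
    have : Set.range (reducedι Z) = Z := by
      rw [reducedι, Scheme.IdealSheafData.range_subschemeι]; rfl
    rw [← this]
    exact ⟨z, rfl⟩
  have := isReduced_vanishingIdeal_subscheme Z
  have hirr : IrreducibleSpace (Scheme.IdealSheafData.vanishingIdeal Z).subscheme := by
    have h1 : IsIrreducible (Set.range l) := by
      rw [← Set.image_univ]
      exact (IrreducibleSpace.isIrreducible_univ _).image _ l.continuous.continuousOn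
    have h2 := h1.closure
    rw [l.denseRange.closure_range] at h2
    exact irreducibleSpace_def _ |>.mpr h2
  have := isDominant_lineChart one_ne_zero 0
  have := (isOpenImmersion_lineChart one_ne_zero 0).1
  exact ⟨isIntegral_of_irreducibleSpace_of_isReduced _, inferInstance,
    birationalOver_of_charts _ _ l (lineChart 1 0) (by rw [reassoc_of% hl, hv, lineChart_str])⟩

end Minitwistor

namespace Minitwistor

/-! ### The affine curve `p q = e` -/

open MvPolynomial in
/-- The coordinate ring of the curve `p q = e`. -/
abbrev Node (e : ℂ) : Type :=
  MvPolynomial (Fin 2) ℂ ⧸ Ideal.span {(X 0 * X 1 - C e : MvPolynomial (Fin 2) ℂ)}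

namespace Node

variable (e : ℂ)

/-- The coordinates `p` and `q` on the curve `p q = e`. -/
noncomputable def y (k : Fin 2) : Node e := Ideal.Quotient.mk _ (MvPolynomial.X k)

theorem rel : y e 0 * y e 1 = algebraMap ℂ (Node e) e := by
  have h1 : Ideal.Quotient.mkₐ ℂ (Ideal.span {(MvPolynomial.X 0 * MvPolynomial.X 1 -
      MvPolynomial.C e : MvPolynomial (Fin 2) ℂ)}) (MvPolynomial.X 0 * MvPolynomial.X 1 -
      MvPolynomial.C e) = 0 :=
    Ideal.Quotient.eq_zero_iff_mem.mpr (Ideal.subset_span rfl)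
  rw [map_sub, sub_eq_zero, map_mul, ← MvPolynomial.algebraMap_eq, AlgHom.commutes] at h1
  exact h1

theorem rel_zero : y 0 0 * y 0 1 = 0 := (rel 0).trans (map_zero _)

variable {e}

section Lift

variable {B : Type*} [CommRing B] [Algebra ℂ B]

/-- The homomorphism from the coordinate ring of `p q = e` given by a solution of the
equation. -/
noncomputable def lift (a b : B) (hab : a * b = algebraMap ℂ B e) : Node e →ₐ[ℂ] B :=
  Ideal.Quotient.liftₐ _ (MvPolynomial.aeval ![a, b]) (by
    intro P hP
    obtain ⟨r, rfl⟩ := Ideal.mem_span_singleton.mp hP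
    simp [hab])

theorem lift_y {a b : B} (hab : a * b = algebraMap ℂ B e) (k : Fin 2) :
    lift a b hab (y e k) = ![a, b] k :=
  (Ideal.Quotient.lift_mk _ _ _).trans (MvPolynomial.aeval_X _ _)

theorem hom_ext {f g : Node e →ₐ[ℂ] B} (h0 : f (y e 0) = g (y e 0))
    (h1 : f (y e 1) = g (y e 1)) : f = g := by
  apply Ideal.Quotient.algHom_ext
  apply MvPolynomial.algHom_ext
  intro i
  fin_cases i
  · exact h0
  · exact h1

end Lift

/-- The restriction of functions to the coordinate axes `q = 0` and `p = 0` of `p q = 0`. -/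
noncomputable def axis (k : Fin 2) : Node 0 →ₐ[ℂ] Polynomial ℂ :=
  lift (if k = 0 then Polynomial.X else 0) (if k = 0 then 0 else Polynomial.X)
    (by rw [map_zero]; split_ifs <;> simp)

theorem axis_self (k : Fin 2) : axis k (y 0 k) = Polynomial.X := by
  fin_cases k
  · exact lift_y _ 0
  · exact lift_y _ 1

theorem axis_other (k : Fin 2) : axis k (y 0 (1 - k)) = 0 := by
  fin_cases k
  · exact lift_y _ 1
  · exact lift_y _ 0

theorem comp_axis {B : Type*} [CommRing B] [Algebra ℂ B] (k : Fin 2) (m : Node 0 →ₐ[ℂ] B)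
    (hm : m (y 0 (1 - k)) = 0) :
    (m.comp (Polynomial.aeval (R := ℂ) (y 0 k))).comp (axis k) = m := by
  have h1 : ((m.comp (Polynomial.aeval (R := ℂ) (y 0 k))).comp (axis k)) (y 0 k) =
      m (y 0 k) := by
    rw [AlgHom.comp_apply, AlgHom.comp_apply, axis_self, Polynomial.aeval_X]
  have h2 : ((m.comp (Polynomial.aeval (R := ℂ) (y 0 k))).comp (axis k)) (y 0 (1 - k)) =
      m (y 0 (1 - k)) := by
    rw [AlgHom.comp_apply, axis_other]
    exact (map_zero _).trans hm.symm
  obtain rfl | rfl : k = 0 ∨ k = 1 := by omega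
  · refine hom_ext (e := 0) ?_ ?_
    exacts [h1, h2]
  · refine hom_ext (e := 0) ?_ ?_
    exacts [h2, h1]

theorem dvd_of_axis_eq_zero (k : Fin 2) {b : Node 0} (hb : axis k b = 0) : y 0 (1 - k) ∣ b := by
  let J : Ideal (Node 0) := Ideal.span {y 0 (1 - k)}
  have hm : (Ideal.Quotient.mkₐ ℂ J) (y 0 (1 - k)) = 0 :=
    Ideal.Quotient.eq_zero_iff_mem.mpr (Ideal.mem_span_singleton_self _)
  have h1 := comp_axis (B := Node 0 ⧸ J) k (Ideal.Quotient.mkₐ ℂ J) hm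
  have h2 : Ideal.Quotient.mkₐ ℂ J b = 0 := by
    rw [← h1, AlgHom.comp_apply, hb]
    exact map_zero _
  exact Ideal.mem_span_singleton.mp (Ideal.Quotient.eq_zero_iff_mem.mp h2)

/-- The coordinate ring of p q = 0 embeds into the product of those of its two axes, which yields
reducedness. -/
theorem eq_zero_of_axis_eq_zero {b : Node 0} (h0 : axis 0 b = 0) (h1 : axis 1 b = 0) : b = 0 := by
  obtain ⟨d, rfl⟩ := dvd_of_axis_eq_zero 0 h0
  have h2 : axis 1 d = 0 := by
    have h3 : axis 1 (y 0 (1 - 0)) = Polynomial.X := axis_self 1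
    rw [map_mul, h3] at h1
    exact (mul_eq_zero.mp h1).resolve_left Polynomial.X_ne_zero
  obtain ⟨d', rfl⟩ := dvd_of_axis_eq_zero 1 h2
  have h4 : y 0 (1 - 0) * y 0 (1 - 1) = 0 := (mul_comm _ _).trans rel_zero
  rw [← mul_assoc, h4, zero_mul]

instance isReduced : _root_.IsReduced (Node 0) where
  eq_zero _ hb := eq_zero_of_axis_eq_zero (hb.map (axis 0)).eq_zero (hb.map (axis 1)).eq_zero

/-- As for the cone: p = q = a solves p q = 0 modulo a², but every lift has p q = a² ≠ 0. -/
theorem not_formallySmooth_of_pow_eq_zero {A : Type} [CommRing A] [Algebra ℂ A] {a : A}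
    (ha3 : a ^ 3 = 0) (ha2 : a ^ 2 ≠ 0) : ¬ Algebra.FormallySmooth ℂ (Node 0) := by
  intro hs
  let I : Ideal A := Ideal.span {a ^ 2}
  have haI : ∀ u ∈ I, a * u = 0 := by
    intro u hu
    obtain ⟨b, rfl⟩ := Ideal.mem_span_singleton.mp hu
    linear_combination b * ha3
  have hI : I ^ 2 = ⊥ := by
    rw [Ideal.span_singleton_pow, Ideal.span_singleton_eq_bot]
    linear_combination a * ha3
  have hII : ∀ u ∈ I, ∀ v ∈ I, u * v = 0 := fun u hu v hv => by
    have := Ideal.mul_mem_mul hu hv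
    rwa [← pow_two, hI] at this
  let ε : A ⧸ I := Ideal.Quotient.mk I a
  have hε : ε ^ 2 = 0 := by
    rw [← map_pow]
    exact Ideal.Quotient.eq_zero_iff_mem.mpr (Ideal.mem_span_singleton_self _)
  have hεε : ε * ε = algebraMap ℂ (A ⧸ I) 0 := by rw [← pow_two, hε, map_zero]
  obtain ⟨F, hF⟩ := Algebra.FormallySmooth.comp_surjective ℂ _ I hI (lift ε ε hεε)
  have hF' : ∀ b, Ideal.Quotient.mk I (F b) = lift ε ε hεε b := fun b => by rw [← hF]; rfl
  have k1 := Ideal.Quotient.eq.mp ((hF' _).trans (lift_y hεε 0))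
  have k2 := Ideal.Quotient.eq.mp ((hF' _).trans (lift_y hεε 1))
  have h1 := haI _ k1
  have h2 := haI _ k2
  have h3 := hII _ k1 _ k2
  have hrel : F (y 0 0) * F (y 0 1) = 0 := by
    rw [← map_mul, rel_zero]
    exact map_zero F
  apply ha2
  linear_combination -h3 - h1 - h2 + hrel

theorem not_formallySmooth : ¬ Algebra.FormallySmooth ℂ (Node 0) := by
  refine not_formallySmooth_of_pow_eq_zero
    (A := Polynomial ℂ ⧸ Ideal.span {(Polynomial.X ^ 3 : Polynomial ℂ)})
    (a := Ideal.Quotient.mk _ Polynomial.X) ?_ (fun h => ?_)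
  · rw [← map_pow]
    exact Ideal.Quotient.eq_zero_iff_mem.mpr (Ideal.mem_span_singleton_self _)
  · rw [← map_pow, Ideal.Quotient.eq_zero_iff_mem, Ideal.mem_span_singleton,
      Polynomial.X_pow_dvd_iff] at h
    simpa using h 2 (by norm_num)

end Node

/-! ### Curves with the charts of a fibre -/

theorem irreducibleComponents_eq_pair {T : Type*} [TopologicalSpace T] {U : Fin 2 → Set T}
    (ho : ∀ k, IsOpen (U k)) (hi : ∀ k, IsIrreducible (U k)) (hd : Disjoint (U 0) (U 1))
    (hc : ∀ x, ∃ k, x ∈ closure (U k)) :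
    irreducibleComponents T = {closure (U 0), closure (U 1)} ∧ closure (U 0) ≠ closure (U 1) := by
  have hd' : ∀ k l, U k ⊆ closure (U l) → k = l := by
    intro k l h
    by_contra hkl
    have h1 : Disjoint (U k) (U l) := by
      fin_cases k <;> fin_cases l
      · exact absurd rfl hkl
      · exact hd
      · exact hd.symm
      · exact absurd rfl hkl
    obtain ⟨x, hx⟩ := (hi k).nonempty
    exact Set.disjoint_left.mp (h1.closure_right (ho k)) hx (h hx)
  have hle : ∀ S : Set T, IsIrreducible S → ∃ k, S ⊆ closure (U k) := by
    intro S hS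
    have := isPreirreducible_iff_isClosed_union_isClosed.mp hS.isPreirreducible
      (closure (U 0)) (closure (U 1)) isClosed_closure isClosed_closure (fun x _ => by
        obtain ⟨k, hk⟩ := hc x
        fin_cases k
        · exact Or.inl hk
        · exact Or.inr hk)
    exact this.elim (fun h => ⟨0, h⟩) fun h => ⟨1, h⟩
  have hmax : ∀ k, closure (U k) ∈ irreducibleComponents T := by
    intro k
    refine ⟨(hi k).closure, fun S hS hkS => ?_⟩
    obtain ⟨l, hl⟩ := hle S hS
    obtain rfl := hd' k l (subset_closure.trans (hkS.trans hl))
    exact hl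
  refine ⟨?_, fun h => absurd (hd' 0 1 (h ▸ subset_closure)) (by decide)⟩
  ext S
  constructor
  · intro hS
    obtain ⟨k, hk⟩ := hle S hS.1
    have := hk.antisymm (hS.2 (hi k).closure hk)
    fin_cases k
    · exact Or.inl this
    · exact Or.inr this
  · rintro (rfl | rfl)
    · exact hmax 0
    · exact hmax 1

/-- A curve over `ℂ` with the charts `p q = e` and two affine lines with coordinates `p⁻¹` and
`q⁻¹`. -/
structure IsConicFibre (e : ℂ) {F : Scheme.{0}} (s : F ⟶ Spec (.of ℂ))
    (n : Spec (.of (Node e)) ⟶ F) (v : Fin 2 → (Spec (.of (Polynomial ℂ)) ⟶ F)) : Prop where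
  proper : IsProper s
  isOpenImmersion_node : IsOpenImmersion n
  isOpenImmersion_line : ∀ k, IsOpenImmersion (v k)
  node_str : n ≫ s = Spec.map (CommRingCat.ofHom (algebraMap ℂ (Node e)))
  line_str : ∀ k, v k ≫ s = Spec.map (CommRingCat.ofHom (algebraMap ℂ (Polynomial ℂ)))
  cover : ∀ x : F, x ∈ Set.range n ∨ ∃ k, x ∈ Set.range (v k)
  mem_iff : ∀ k z, n z ∈ Set.range (v k) ↔
    Node.y e k ∉ PrimeSpectrum.asIdeal (R := Node e) z
  disjoint : e = 0 → Disjoint (Set.range (v 0)) (Set.range (v 1))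
  gen : e ≠ 0 → lineGen (e) 0 ≫ v 0 = lineGen (e) 1 ≫ v 1

namespace IsConicFibre

variable {e : ℂ} {F : Scheme.{0}} {s : F ⟶ Spec (.of ℂ)}
  {n : Spec (.of (Node e)) ⟶ F} {v : Fin 2 → (Spec (.of (Polynomial ℂ)) ⟶ F)}

/-- If e ≠ 0 then p is invertible on p q = e, so the two lines already cover. -/
theorem cover_of_ne_zero (H : IsConicFibre e s n v) (he : e ≠ 0) (x : F) :
    ∃ k, x ∈ Set.range (v k) := by
  obtain ⟨z, rfl⟩ | hx := H.cover x
  · by_contra! hk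
    have h0 := not_not.mp ((not_congr (H.mem_iff 0 z)).mp (hk 0))
    have h1 := Ideal.mul_mem_right (Node.y e 1) _ h0
    rw [Node.rel] at h1
    have hz : (PrimeSpectrum.asIdeal (R := Node e) z).IsPrime :=
      PrimeSpectrum.isPrime (R := Node e) z
    exact hz.ne_top (Ideal.eq_top_of_isUnit_mem _ h1 ((Ne.isUnit he).map (algebraMap ℂ _)))
  · exact hx

theorem smooth (H : IsConicFibre e s n v) (he : e ≠ 0) : Smooth s := by
  refine smooth_of_forall_exists s fun x => ?_
  obtain ⟨k, hk⟩ := H.cover_of_ne_zero he x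
  refine ⟨_, v k, H.isOpenImmersion_line k, hk, ?_⟩
  rw [H.line_str]
  have : Algebra.Smooth ℂ (Polynomial ℂ) := .mk inferInstance inferInstance
  exact smooth_SpecMap

theorem isSmoothRationalCurve (H : IsConicFibre e s n v) (he : e ≠ 0) :
    IsSmoothRationalCurve s := by
  -- The coordinates 1/p and 1/q have product 1/e; scaling both by a square root u of e turns this
  -- into the gluing of the projective line.
  obtain ⟨u, hu⟩ := IsAlgClosed.exists_pow_nat_eq (e) (n := 2) (by norm_num)
  have hu0 : u ≠ 0 := by
    rintro rfl
    exact he (by rw [← hu]; norm_num)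
  have := H.proper
  have := H.isOpenImmersion_line
  have := fun k => (isOpenImmersion_lineChart hu0 k).1
  have := isDominant_lineGen he
  have hv := H.gen he
  have hl : ∀ k, lineGen (e) k ≫ lineChart u k =
      linePt 0 (algebraMap ℂ LineField u * LineField.x) := fun k => by
    rw [← hu]; exact lineGen_lineChart hu0 k
  refine exists_iso_of_charts s (projStr (coordGrading 2)) v (lineChart u)
    (fun k => by rw [H.line_str, lineChart_str]) (lineGen (e)) (fun k l => ?_)
    (fun k l => by rw [hl, hl]) (H.cover_of_ne_zero he) (line_cover hu0)
  fin_cases k <;> fin_cases l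
  exacts [rfl, hv, hv.symm, rfl]

variable {n : Spec (.of (Node 0)) ⟶ F}

theorem not_smooth (H : IsConicFibre 0 s n v) : ¬ Smooth s := by
  intro hs
  have := H.isOpenImmersion_node
  have h1 : Smooth (n ≫ s) := inferInstance
  rw [H.node_str, HasRingHomProperty.Spec_iff (P := @Smooth)] at h1
  have h2 : Algebra.Smooth ℂ (Node 0) := RingHom.smooth_algebraMap.mp h1
  exact Node.not_formallySmooth inferInstance

/-- A point of p q = 0 lies on an axis and specializes its generic point, where the axis coordinate
is invertible, so that generic point lies in the corresponding line. -/
theorem exists_mem_closure (H : IsConicFibre 0 s n v) (x : F) :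
    ∃ k, x ∈ closure (Set.range (v k)) := by
  obtain ⟨z, rfl⟩ | ⟨k, hk⟩ := H.cover x
  · have hz : (PrimeSpectrum.asIdeal (R := Node 0) z).IsPrime :=
      PrimeSpectrum.isPrime (R := Node 0) z
    have h1 : ∃ k : Fin 2, Node.y 0 (1 - k) ∈ PrimeSpectrum.asIdeal (R := Node 0) z := by
      have h2 : Node.y 0 0 * Node.y 0 1 ∈ PrimeSpectrum.asIdeal (R := Node 0) z := by
        rw [Node.rel_zero]; exact zero_mem _
      exact (hz.mem_or_mem h2).elim (fun h => ⟨1, h⟩) fun h => ⟨0, h⟩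
    obtain ⟨k, hk⟩ := h1
    refine ⟨k, ?_⟩
    let w : PrimeSpectrum (Node 0) := ⟨RingHom.ker (Node.axis k).toRingHom,
      RingHom.ker_isPrime _⟩
    have hw : w ⤳ (z : PrimeSpectrum (Node 0)) := by
      refine (PrimeSpectrum.le_iff_specializes w z).mp fun b hb => ?_
      obtain ⟨d, rfl⟩ := Node.dvd_of_axis_eq_zero k hb
      exact Ideal.mul_mem_right _ _ hk
    have hw' : n w ⤳ n z := Specializes.map hw n.continuous
    refine hw'.mem_closed isClosed_closure (subset_closure ((H.mem_iff k w).mpr fun h => ?_))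
    have h3 : Node.axis k (Node.y 0 k) = 0 := h
    rw [Node.axis_self] at h3
    exact Polynomial.X_ne_zero h3
  · exact ⟨k, subset_closure hk⟩

theorem isReduced (H : IsConicFibre 0 s n v) :
    AlgebraicGeometry.IsReduced F := by
  have := H.isOpenImmersion_node
  have := H.isOpenImmersion_line
  have hn : AlgebraicGeometry.IsReduced (Spec (.of (Node 0))) :=
    (affine_isReduced_iff (.of (Node 0))).mpr inferInstance
  have (x : F) : _root_.IsReduced (F.presheaf.stalk x) := by
    obtain ⟨z, rfl⟩ | ⟨k, z, rfl⟩ := H.cover x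
    · exact isReduced_of_injective _
        (asIso (n.stalkMap z)).commRingCatIsoToRingEquiv.injective
    · exact isReduced_of_injective _
        (asIso ((v k).stalkMap z)).commRingCatIsoToRingEquiv.injective
  exact isReduced_of_isReduced_stalk _

theorem isPairOfRationalCurves (H : IsConicFibre 0 s n v) :
    IsPairOfRationalCurves s := by
  have := H.proper
  have := H.isOpenImmersion_line
  have hirr : ∀ k, IsIrreducible (Set.range (v k)) := fun k => by
    rw [← Set.image_univ]
    exact (IrreducibleSpace.isIrreducible_univ _).image _ (v k).continuous.continuousOn
  obtain ⟨h1, h2⟩ := irreducibleComponents_eq_pair (U := fun k => Set.range (v k))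
    (fun k => (v k).isOpenEmbedding.isOpen_range) hirr (H.disjoint rfl) H.exists_mem_closure
  refine ⟨H.isReduced, by rw [h1, Set.ncard_pair h2], fun Z hZ => ?_⟩
  rw [h1] at hZ
  obtain hZ | hZ := hZ
  · exact isRationalCurve_of_chart s (v 0) (H.line_str 0) Z hZ
  · exact isRationalCurve_of_chart s (v 1) (H.line_str 1) Z hZ

end IsConicFibre

end Minitwistor

namespace Minitwistor

open Limits

/-! ### Fibres over rational points -/

/-- The residue field at a ℂ-point is ℂ, since its map to ℂ has a right inverse. So the fibre
defined by residue fields is the pullback along the point. -/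
theorem isPullback_fiberι {E Y : Scheme.{0}} (g : E ⟶ Y) (sY : Y ⟶ Spec (.of ℂ))
    (f : Spec (.of ℂ) ⟶ Y) (hf : f ≫ sY = 𝟙 _) :
    ∃ q, IsPullback (g.fiberι (f (IsLocalRing.closedPoint ℂ))) q g f := by
  let y := f (IsLocalRing.closedPoint ℂ)
  let ψ : Y.residueField y ⟶ .of ℂ := Y.descResidueField (Scheme.stalkClosedPointTo f)
  have hψ : Spec.map ψ ≫ Y.fromSpecResidueField y = f :=
    Scheme.descResidueField_stalkClosedPointTo_fromSpecResidueField ℂ Y f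
  obtain ⟨χ, hχ⟩ := Spec.map_surjective (Y.fromSpecResidueField y ≫ sY)
  have h1 : χ ≫ ψ = 𝟙 _ := by
    apply Spec.map_injective
    rw [Spec.map_comp, hχ, reassoc_of% hψ, hf, Spec.map_id]
  have : IsIso ψ := by
    refine (ConcreteCategory.isIso_iff_bijective ψ).mpr ⟨RingHom.injective ψ.hom, fun c => ?_⟩
    exact ⟨χ c, congrArg (fun a => a c) h1⟩
  change ∃ q, IsPullback (g.fiberι y) q g f
  refine ⟨g.fiberToSpecResidueField y ≫ inv (Spec.map ψ), ?_⟩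
  have h2 : IsPullback (g.fiberι y) (g.fiberToSpecResidueField y) g (Y.fromSpecResidueField y) :=
    IsPullback.of_hasPullback _ _
  exact h2.of_iso (Iso.refl _) (Iso.refl _) (asIso (Spec.map ψ)).symm (Iso.refl _) (by simp)
    (by simp) (by simp) (by simp [← hψ])

/-- The fibre of t over c is the quotient by t - c; the kernel condition identifies φ with this
quotient. -/
theorem isPullback_SpecMap {A Q : Type} [CommRing A] [CommRing Q] [Algebra ℂ A] [Algebra ℂ Q]
    {t : A} {c : ℂ} {φ : A →ₐ[ℂ] Q} (hφ : Function.Surjective φ) (ht : φ t = algebraMap ℂ Q c)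
    (hker : RingHom.ker φ.toRingHom ≤ Ideal.span {t - algebraMap ℂ A c}) :
    IsPullback (Spec.map (CommRingCat.ofHom φ.toRingHom))
      (Spec.map (CommRingCat.ofHom (algebraMap ℂ Q)))
      (Spec.map (CommRingCat.ofHom (Polynomial.aeval (R := ℂ) t).toRingHom))
      (Spec.map (CommRingCat.ofHom (Polynomial.aeval (R := ℂ) c).toRingHom)) := by
  refine isPullback_SpecMap_of_isPushout _ _ _ _ ?_
  have hw : CommRingCat.ofHom (Polynomial.aeval (R := ℂ) t).toRingHom ≫
      CommRingCat.ofHom φ.toRingHom = CommRingCat.ofHom (Polynomial.aeval (R := ℂ) c).toRingHom ≫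
        CommRingCat.ofHom (algebraMap ℂ Q) := by
    rw [← CommRingCat.ofHom_comp, ← CommRingCat.ofHom_comp]
    congr 1
    have : φ.comp (Polynomial.aeval (R := ℂ) t) =
        (Algebra.ofId ℂ Q).comp (Polynomial.aeval (R := ℂ) c) := by
      ext
      simp [ht, Algebra.ofId_apply]
    exact congrArg AlgHom.toRingHom this
  have key : ∀ s : PushoutCocone (CommRingCat.ofHom (Polynomial.aeval (R := ℂ) t).toRingHom)
      (CommRingCat.ofHom (Polynomial.aeval (R := ℂ) c).toRingHom),
      RingHom.ker φ.toRingHom ≤ RingHom.ker s.inl.hom ∧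
        ∀ z : ℂ, s.inl.hom (algebraMap ℂ A z) = s.inr.hom z := by
    intro s
    have hs : ∀ P : Polynomial ℂ, s.inl.hom (Polynomial.aeval t P) =
        s.inr.hom (Polynomial.aeval c P) := fun P =>
      congrArg (fun a => a.hom P) s.condition
    have hC : ∀ z : ℂ, s.inl.hom (algebraMap ℂ A z) = s.inr.hom z := fun z => by
      simpa using hs (Polynomial.C z)
    refine ⟨hker.trans ?_, hC⟩
    rw [Ideal.span_singleton_le_iff_mem, RingHom.mem_ker, map_sub, hC, sub_eq_zero]
    simpa using hs Polynomial.X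
  refine ⟨⟨hw⟩, ⟨PushoutCocone.IsColimit.mk _
    (fun s => CommRingCat.ofHom (φ.toRingHom.liftOfSurjective hφ ⟨s.inl.hom, (key s).1⟩))
    (fun s => ?_) (fun s => ?_) (fun s m h1 _ => ?_)⟩⟩
  · ext a
    exact RingHom.liftOfRightInverse_comp_apply φ.toRingHom _ (Function.rightInverse_surjInv hφ)
      ⟨s.inl.hom, (key s).1⟩ a
  · ext z
    have h1 : algebraMap ℂ Q z = φ.toRingHom (algebraMap ℂ A z) := (φ.commutes z).symm
    have h2 := RingHom.liftOfRightInverse_comp_apply φ.toRingHom _ (Function.rightInverse_surjInv hφ)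
      ⟨s.inl.hom, (key s).1⟩ (algebraMap ℂ A z)
    rw [← h1] at h2
    exact h2.trans ((key s).2 z)
  · ext b
    obtain ⟨a, rfl⟩ := hφ b
    have h2 := RingHom.liftOfRightInverse_comp_apply φ.toRingHom _ (Function.rightInverse_surjInv hφ)
      ⟨s.inl.hom, (key s).1⟩ a
    exact (congrArg (fun f => f.hom a) h1).trans h2.symm

theorem exists_fiber_chart {S E Y F U W : Scheme.{0}} {g : E ⟶ Y} {i : F ⟶ E} {q : F ⟶ S}
    {f : S ⟶ Y} (H : IsPullback i q g f) (κ : U ⟶ E) [IsOpenImmersion κ] {a : W ⟶ U} {b : W ⟶ S}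
    (H' : IsPullback a b (κ ≫ g) f) : ∃ n : W ⟶ F, IsOpenImmersion n ∧ n ≫ i = a ≫ κ ∧
      n ≫ q = b ∧ Set.range n = i ⁻¹' Set.range κ := by
  let n : W ⟶ F := H.lift (a ≫ κ) b (by rw [Category.assoc, H'.w])
  have hn1 : n ≫ i = a ≫ κ := H.lift_fst _ _ _
  have hn2 : n ≫ q = b := H.lift_snd _ _ _
  have hP : IsPullback n a i κ := by
    refine IsPullback.of_right (h₁₂ := q) (h₂₂ := g) (v₁₃ := f) ?_ hn1 H.flip
    rw [hn2]
    exact H'.flip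
  refine ⟨n, MorphismProperty.of_isPullback (P := @IsOpenImmersion) hP.flip inferInstance, hn1,
    hn2, ?_⟩
  rw [← Scheme.Pullback.range_fst, ← hP.isoPullback_hom_fst, Scheme.Hom.comp_base, TopCat.coe_comp,
    Set.range_comp, Set.range_eq_univ.mpr hP.isoPullback.hom.surjective, Set.image_univ]

theorem coordPt_mem_iff {A : Type} [CommRing A] [Algebra ℂ A] {𝒜 : ℕ → Submodule ℂ A}
    [GradedAlgebra 𝒜] {m : ℕ} {y : Fin m → A} {B : Type} [CommRing B] [Algebra ℂ B]
    (hy : IsCoordSystem 𝒜 y) {c : Fin m → B} (hc : IsPt y c) (i : Fin m) (hu : IsUnit (c i))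
    (k : Fin m) (z : Spec (.of B)) : coordPt hy hc i hu z ∈ Proj.basicOpen 𝒜 (y k) ↔
      c k ∉ PrimeSpectrum.asIdeal (R := B) z :=
  Iff.of_eq (congrArg (fun U : (Spec (.of B)).Opens => z ∈ U) (coordPt_preimage hy hc i hu k))

/-! ### The charts of the fibres of the projection -/

/-- The restriction of functions on the surface `p q = h(t)` to the curve `t = c`. -/
noncomputable def Hyp.toNode (h : Polynomial ℂ) (c : ℂ) : Hyp h →ₐ[ℂ] Node (h.eval c) :=
  Hyp.lift (algebraMap ℂ _ c) (Node.y _ 0) (Node.y _ 1) (by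
    rw [Node.rel, Polynomial.aeval_algebraMap_apply]; simp)

theorem Hyp.toNode_x_succ (h : Polynomial ℂ) (c : ℂ) (k : Fin 2) :
    Hyp.toNode h c (Hyp.x h k.succ) = Node.y _ k := by
  fin_cases k
  · exact Hyp.lift_p _
  · exact Hyp.lift_q _

theorem Hyp.toNode_surjective (h : Polynomial ℂ) (c : ℂ) :
    Function.Surjective (Hyp.toNode h c) := by
  intro b
  obtain ⟨P, rfl⟩ := Ideal.Quotient.mk_surjective b
  refine ⟨MvPolynomial.aeval ![Hyp.x h 1, Hyp.x h 2] P, ?_⟩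
  have : (Hyp.toNode h c).comp (MvPolynomial.aeval ![Hyp.x h 1, Hyp.x h 2]) =
      Ideal.Quotient.mkₐ ℂ _ := by
    apply MvPolynomial.algHom_ext
    intro i
    rw [AlgHom.comp_apply, MvPolynomial.aeval_X]
    fin_cases i
    · exact Hyp.lift_p _
    · exact Hyp.lift_q _
  exact congrArg (fun f => f P) this

theorem Hyp.ker_toNode_le_ker {h : Polynomial ℂ} {c : ℂ} {B : Type} [CommRing B] [Algebra ℂ B]
    (m : Hyp h →ₐ[ℂ] B) (hm : m (Hyp.x h 0 - algebraMap ℂ (Hyp h) c) = 0) {b : Hyp h}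
    (hb : Hyp.toNode h c b = 0) : m b = 0 := by
  rw [map_sub, sub_eq_zero, AlgHom.commutes] at hm
  have hr : m (Hyp.x h 1) * m (Hyp.x h 2) = algebraMap ℂ B (h.eval c) := by
    rw [← map_mul, Hyp.rel, ← Polynomial.aeval_algHom_apply, hm, Polynomial.aeval_algebraMap_apply]
    simp
  have h1 : (Node.lift (m (Hyp.x h 1)) (m (Hyp.x h 2)) hr).comp (Hyp.toNode h c) = m := by
    refine Hyp.hom_ext ?_ ?_ ?_
    · rw [AlgHom.comp_apply, hm]
      exact (congrArg _ (Hyp.lift_t _)).trans (AlgHom.commutes _ _)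
    · rw [AlgHom.comp_apply]
      exact (congrArg _ (Hyp.lift_p _)).trans (Node.lift_y _ 0)
    · rw [AlgHom.comp_apply]
      exact (congrArg _ (Hyp.lift_q _)).trans (Node.lift_y _ 1)
  rw [← h1, AlgHom.comp_apply, hb]
  exact map_zero _

theorem Hyp.ker_toNode_le (h : Polynomial ℂ) (c : ℂ) : RingHom.ker (Hyp.toNode h c).toRingHom ≤
    Ideal.span {Hyp.x h 0 - algebraMap ℂ (Hyp h) c} := by
  intro b hb
  have hb' : Hyp.toNode h c b = 0 := hb
  let J : Ideal (Hyp h) := Ideal.span {Hyp.x h 0 - algebraMap ℂ (Hyp h) c}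
  have hm : Ideal.Quotient.mkₐ ℂ J (Hyp.x h 0 - algebraMap ℂ (Hyp h) c) = 0 :=
    Ideal.Quotient.eq_zero_iff_mem.mpr (Ideal.mem_span_singleton_self _)
  exact Ideal.Quotient.eq_zero_iff_mem.mp
    (Hyp.ker_toNode_le_ker (B := Hyp h ⧸ J) (Ideal.Quotient.mkₐ ℂ J) hm hb')

/-- The restriction of functions on the plane to the line `t = c`. -/
noncomputable def planeToLine (c : ℂ) : Plane →ₐ[ℂ] Polynomial ℂ :=
  MvPolynomial.aeval ![Polynomial.C c, Polynomial.X]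

theorem planeToLine_X_zero (c : ℂ) :
    planeToLine c (MvPolynomial.X 0) = algebraMap ℂ (Polynomial ℂ) c :=
  MvPolynomial.aeval_X _ _

theorem planeToLine_X_one (c : ℂ) : planeToLine c (MvPolynomial.X 1) = Polynomial.X :=
  MvPolynomial.aeval_X _ _

theorem planeToLine_surjective (c : ℂ) : Function.Surjective (planeToLine c) := by
  intro P
  refine ⟨Polynomial.aeval (MvPolynomial.X 1) P, ?_⟩
  rw [← Polynomial.aeval_algHom_apply, planeToLine_X_one, Polynomial.aeval_X_left_apply]

theorem ker_planeToLine_le (c : ℂ) : RingHom.ker (planeToLine c).toRingHom ≤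
    Ideal.span {MvPolynomial.X 0 - algebraMap ℂ Plane c} := by
  refine ker_le_of_section (Polynomial.aeval (R := ℂ) (MvPolynomial.X 1 : Plane)).toRingHom ?_
  refine MvPolynomial.ringHom_ext (fun r => ?_) fun i => ?_
  · change Ideal.Quotient.mk _ (Polynomial.aeval (MvPolynomial.X 1 : Plane)
      (planeToLine c (MvPolynomial.C r))) = _
    rw [← MvPolynomial.algebraMap_eq, AlgHom.commutes, AlgHom.commutes]
  obtain rfl | rfl : i = 0 ∨ i = 1 := by omega
  · refine (Ideal.Quotient.eq.mpr ?_).symm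
    change MvPolynomial.X 0 - Polynomial.aeval (MvPolynomial.X 1 : Plane)
      (planeToLine c (MvPolynomial.X 0)) ∈ _
    rw [planeToLine_X_zero, AlgHom.commutes]
    exact Ideal.mem_span_singleton_self _
  · change Ideal.Quotient.mk _ (Polynomial.aeval (MvPolynomial.X 1 : Plane)
      (planeToLine c (MvPolynomial.X 1))) = _
    rw [planeToLine_X_one, Polynomial.aeval_X]

theorem isPullback_conicPt {A Q : Type} [CommRing A] [CommRing Q] [Algebra ℂ A] [Algebra ℂ Q]
    (j : Fin 2) {t : A} {c : ℂ} {φ : A →ₐ[ℂ] Q} (hφ : Function.Surjective φ)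
    (ht : φ t = algebraMap ℂ Q c)
    (hker : RingHom.ker φ.toRingHom ≤ Ideal.span {t - algebraMap ℂ A c}) :
    IsPullback (Spec.map (CommRingCat.ofHom φ.toRingHom))
      (Spec.map (CommRingCat.ofHom (algebraMap ℂ Q))) (conicPt j t) (conicPt j c) := by
  have h := isPullback_SpecMap hφ ht hker
  rw [conicPt_eq, conicPt_eq]
  exact ⟨⟨by rw [reassoc_of% h.w]⟩, ⟨PullbackCone.IsLimit.mk _
    (fun s => h.lift s.fst s.snd (by
      rw [← cancel_mono (conicChart j), Category.assoc, Category.assoc]; exact s.condition))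
    (fun s => h.lift_fst _ _ _) (fun s => h.lift_snd _ _ _)
    (fun s m h1 h2 => h.hom_ext (h1.trans (h.lift_fst _ _ _).symm)
      (h2.trans (h.lift_snd _ _ _).symm))⟩⟩

end Minitwistor

/-! ### Fibres of the model over closed points of the conic -/

namespace Minitwistor

open Limits

/-- The closed point of the conic with parameter `c` in the chart `j`. -/
noncomputable def conicPoint (j : Fin 2) (c : ℂ) : Conic :=
  conicPt j c (IsLocalRing.closedPoint ℂ)

theorem conicPt_self_str (j : Fin 2) (c : ℂ) : conicPt j c ≫ Conic.str = 𝟙 _ := by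
  rw [conicPt_str]
  exact Spec.map_id _

theorem conicPt_mem_conicOpen {B : Type} [CommRing B] [Algebra ℂ B] (j : Fin 2) (t : B)
    (z : Spec (.of B)) : conicPt j t z ∈ conicOpen (conicIdx j) := by
  refine (coordPt_mem_iff _ _ _ _ _ _).mpr fun h => ?_
  rw [conicTuple_idx] at h
  exact (PrimeSpectrum.isPrime (R := B) z).ne_top ((Ideal.eq_top_iff_one _).mpr h)

section

variable {α : ℝ} {E : Scheme.{0}} {ρ : E ⟶ Quartic α} {g : E ⟶ Conic}

namespace IsModel

theorem mem_surfOpen_or_exists (hM : IsModel α ρ g) (j : Fin 2) {z : E}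
    (hz : g z ∈ conicOpen (conicIdx j)) :
    ρ z ∈ surfOpen α (surfIdx j) ∨ ∃ k, ρ z ∈ surfOpen α (vertIdx k) := by
  obtain ⟨j', hj'⟩ | hk := quartic_cover α (ρ z)
  · left
    obtain ⟨κ, hκ, h1, h2, h3⟩ := hM.surf j'
    obtain ⟨w, rfl⟩ := (Set.ext_iff.mp h3 z).mpr hj'
    rw [← Scheme.Hom.comp_apply, h2] at hz
    rw [← Scheme.Hom.comp_apply, h1]
    refine (coordPt_mem_iff _ _ _ _ _ _).mpr ?_
    have h4 := (coordPt_mem_iff _ _ _ _ _ _).mp hz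
    have h5 : surfTuple j' (Hyp.x (chartPoly α j') 0) 1 (Hyp.x _ 1) (Hyp.x _ 2) (surfIdx j) =
        conicTuple j' (Hyp.x (chartPoly α j') 0) (conicIdx j) := by
      fin_cases j <;> fin_cases j' <;> simp [surfTuple, conicTuple, surfIdx, conicIdx]
    rw [h5]
    exact h4
  · exact Or.inr hk

/-- On the overlap with p q = h(t) the two planes have x₀ = 1/p and x₁ = 1/q, so the gluing
condition is x₀ x₁ h(t) = 1. The points are compared in that chart, where the model maps
isomorphically to the quartic. -/
theorem SpecMap_comp_eq {K : Type} [Field K] [Algebra ℂ K] (hM : IsModel α ρ g) (j : Fin 2)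
    {κ₀ κ₁ : Spec (.of Plane) ⟶ E}
    (h₀ : κ₀ ≫ ρ = blowPt α 0 j (MvPolynomial.X 0) (MvPolynomial.X 1))
    (h₁ : κ₁ ≫ ρ = blowPt α 1 j (MvPolynomial.X 0) (MvPolynomial.X 1)) {t x₀ x₁ : K}
    (hx : x₀ * x₁ * Polynomial.aeval t (chartPoly α j) = 1) {f₀ f₁ : Plane →ₐ[ℂ] K}
    (hf₀ : f₀ (MvPolynomial.X 0) = t ∧ f₀ (MvPolynomial.X 1) = x₀)
    (hf₁ : f₁ (MvPolynomial.X 0) = t ∧ f₁ (MvPolynomial.X 1) = x₁) :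
    Spec.map (CommRingCat.ofHom f₀.toRingHom) ≫ κ₀ =
      Spec.map (CommRingCat.ofHom f₁.toRingHom) ≫ κ₁ := by
  obtain ⟨κ, hκ, h2, -, h3⟩ := hM.surf j
  have hb₀ : (Spec.map (CommRingCat.ofHom f₀.toRingHom) ≫ κ₀) ≫ ρ = blowPt α 0 j t x₀ := by
    rw [Category.assoc, h₀, SpecMap_blowPt, hf₀.1, hf₀.2]
  have hb₁ : (Spec.map (CommRingCat.ofHom f₁.toRingHom) ≫ κ₁) ≫ ρ = blowPt α 0 j t x₀ := by
    rw [Category.assoc, h₁, SpecMap_blowPt, hf₁.1, hf₁.2]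
    -- One tuple has y₃ = 1 and the other y₄ = 1; their ratio is the value x₀²h(t) of y₄ on the
    -- first.
    refine coordPt_congr _ _ _ _ _ _ _ (x₀ ^ 2 * Polynomial.aeval t (chartPoly α j)) fun i => ?_
    have e1 : x₀ = x₀ ^ 2 * Polynomial.aeval t (chartPoly α j) * x₁ := by
      linear_combination (-x₀) * hx
    have e2 : 1 = x₀ ^ 2 * Polynomial.aeval t (chartPoly α j) *
        (x₁ ^ 2 * Polynomial.aeval t (chartPoly α j)) := by
      linear_combination (-1 - x₀ * x₁ * Polynomial.aeval t (chartPoly α j)) * hx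
    have e3 : ∀ u, x₀ * u = x₀ ^ 2 * Polynomial.aeval t (chartPoly α j) * (x₁ * u) := fun u => by
      linear_combination u * e1
    fin_cases j <;> fin_cases i
    all_goals first
      | exact e3 _
      | exact e2
      | exact (mul_one _).symm
  have hx0 : x₀ ≠ 0 := by
    rintro rfl
    simp at hx
  have hr : ∀ a : Spec (.of K) ⟶ E, a ≫ ρ = blowPt α 0 j t x₀ → Set.range a ⊆ Set.range κ := by
    rintro a ha _ ⟨z, rfl⟩
    refine (Set.ext_iff.mp h3 _).mpr ?_
    change ρ (a z) ∈ surfOpen α (surfIdx j)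
    rw [← Scheme.Hom.comp_apply, ha]
    refine (coordPt_mem_iff _ _ _ _ _ _).mpr fun h => ?_
    have h4 : blowTuple α 0 j t x₀ (surfIdx j) = x₀ := by
      fin_cases j <;> simp [blowTuple, surfTuple, surfIdx, conicTuple]
    rw [h4] at h
    exact (PrimeSpectrum.isPrime (R := K) z).ne_top (Ideal.eq_top_of_isUnit_mem _ h hx0.isUnit)
  have e₀ := IsOpenImmersion.lift_fac κ _ (hr _ hb₀)
  have e₁ := IsOpenImmersion.lift_fac κ _ (hr _ hb₁)
  rw [← e₀, ← e₁]
  congr 1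
  rw [← cancel_mono (surfChart α j), ← h2, reassoc_of% e₀, reassoc_of% e₁]
  simp only [Category.assoc] at hb₀ hb₁
  rw [hb₀, hb₁]

/-- Setting t = c turns the chart p q = h(t) into p q = h(c) and the two planes into the lines with
coordinates 1/p and 1/q. If h(c) = 0, the coordinate y₄ = x²h(c) vanishes on the first line, which
is therefore disjoint from the second. -/
theorem exists_isConicFibre_of_isPullback (hM : IsModel α ρ g) (j : Fin 2) (c : ℂ)
    {F : Scheme.{0}} {i : F ⟶ E} {q : F ⟶ Spec (.of ℂ)} (H : IsPullback i q g (conicPt j c)) :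
    ∃ n v, IsConicFibre ((chartPoly α j).eval c) q n v := by
  have hgp : IsProper g := by
    have := hM.proper
    have : IsProper (g ≫ Conic.str) := by rw [hM.comm]; infer_instance
    exact IsProper.of_comp g Conic.str
  obtain ⟨κ, hκ, hκρ, hκg, hκr⟩ := hM.surf j
  choose μ hμ hμρ hμg hμr using fun k => hM.vert k j
  obtain ⟨n, hn, hni, hnq, hnr⟩ := exists_fiber_chart H κ (by
    rw [hκg]
    exact isPullback_conicPt j (Hyp.toNode_surjective (chartPoly α j) c) (Hyp.lift_t _)
      (Hyp.ker_toNode_le _ _))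
  have hv : ∀ k, ∃ v : Spec (.of (Polynomial ℂ)) ⟶ F,
      IsOpenImmersion v ∧ v ≫ i =
        Spec.map (CommRingCat.ofHom (planeToLine c).toRingHom) ≫ μ k ∧
      v ≫ q = Spec.map (CommRingCat.ofHom (algebraMap ℂ (Polynomial ℂ))) ∧
      Set.range v = i ⁻¹' Set.range (μ k) := fun k => by
    have := hμ k
    refine exists_fiber_chart H (μ k) ?_
    rw [hμg]
    exact isPullback_conicPt j (planeToLine_surjective c) (planeToLine_X_zero c)
      (ker_planeToLine_le c)
  choose v hv hvi hvq hvr using hv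
  have hgy : ∀ x : F, g (i x) ∈
      conicOpen (conicIdx j) := fun x => by
    rw [← Scheme.Hom.comp_apply, H.w, Scheme.Hom.comp_apply]
    exact conicPt_mem_conicOpen j c _
  have hmem : ∀ k x, x ∈ Set.range (v k) ↔
      ρ (i x) ∈ surfOpen α (vertIdx k) := fun k x => by
    rw [hvr k]
    exact ⟨fun h => ((Set.ext_iff.mp (hμr k) _).mp h).1,
      fun h => (Set.ext_iff.mp (hμr k) _).mpr ⟨h, hgy x⟩⟩
  refine ⟨n, v, ?_, hn, hv, hnq, hvq, fun x => ?_, fun k z => ?_, fun he => ?_, fun he => ?_⟩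
  · exact MorphismProperty.of_isPullback (P := @IsProper) H inferInstance
  · obtain h | ⟨k, hk⟩ := hM.mem_surfOpen_or_exists j (hgy x)
    · left
      rw [hnr]
      exact (Set.ext_iff.mp hκr _).mpr h
    · exact Or.inr ⟨k, (hmem k x).mpr hk⟩
  · rw [hmem k, ← Scheme.Hom.comp_apply, ← Scheme.Hom.comp_apply, ← Category.assoc, hni,
      Category.assoc, hκρ, Scheme.Hom.comp_apply]
    refine (coordPt_mem_iff _ _ _ _ _ _).trans (not_congr ?_)
    have h1 : surfTuple j (Hyp.x (chartPoly α j) 0) 1 (Hyp.x _ 1) (Hyp.x _ 2) (vertIdx k) =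
        Hyp.x _ k.succ := by
      fin_cases k <;> simp [surfTuple, vertIdx]
    rw [h1, ← Hyp.toNode_x_succ]
    exact Iff.rfl
  · rw [Set.disjoint_left]
    rintro _ ⟨z, rfl⟩ h1
    rw [hmem 1, ← Scheme.Hom.comp_apply, ← Scheme.Hom.comp_apply, ← Category.assoc, hvi,
      Category.assoc, hμρ, SpecMap_blowPt] at h1
    refine (coordPt_mem_iff _ _ _ _ _ _).mp h1 ?_
    have h2 : blowTuple α 0 j (planeToLine c (MvPolynomial.X 0))
        (planeToLine c (MvPolynomial.X 1)) (vertIdx 1) = 0 := by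
      have h3 : Polynomial.aeval (planeToLine c (MvPolynomial.X 0)) (chartPoly α j) = 0 := by
        rw [planeToLine_X_zero, Polynomial.aeval_algebraMap_apply, Polynomial.coe_aeval_eq_eval,
          he, map_zero]
      simp [blowTuple, surfTuple, vertIdx, h3]
    rw [h2]
    exact zero_mem _
  · refine H.hom_ext ?_ ?_
    · rw [Category.assoc, Category.assoc, hvi, hvi, lineGen, lineGen, ← Spec.map_comp_assoc,
        ← Spec.map_comp_assoc, ← CommRingCat.ofHom_comp, ← CommRingCat.ofHom_comp]
      refine hM.SpecMap_comp_eq (K := LineField) j (hμρ 0) (hμρ 1)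
        (t := algebraMap ℂ LineField c) (x₀ := LineField.coord ((chartPoly α j).eval c) 0)
        (x₁ := LineField.coord ((chartPoly α j).eval c) 1)
        (f₀ := (Polynomial.aeval (LineField.coord ((chartPoly α j).eval c) 0)).comp (planeToLine c))
        (f₁ := (Polynomial.aeval (LineField.coord ((chartPoly α j).eval c) 1)).comp (planeToLine c))
        ?_ ?_ ?_
      · rw [Polynomial.aeval_algebraMap_apply]
        have h1 : algebraMap ℂ LineField ((chartPoly α j).eval c) ≠ 0 := by simpa using he
        have h2 := LineField.x_ne_zero
        simp only [LineField.coord, one_ne_zero, if_true, if_false, Polynomial.coe_aeval_eq_eval]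
        field_simp
      · simp only [AlgHom.comp_apply, planeToLine_X_zero, planeToLine_X_one, AlgHom.commutes,
          Polynomial.aeval_X, and_self]
      · simp only [AlgHom.comp_apply, planeToLine_X_zero, planeToLine_X_one, AlgHom.commutes,
          Polynomial.aeval_X, and_self]
    · rw [Category.assoc, Category.assoc, hvq, hvq, lineGen, lineGen, ← Spec.map_comp,
        ← Spec.map_comp, ← CommRingCat.ofHom_comp, ← CommRingCat.ofHom_comp]
      congr 2
      ext z
      simp

theorem exists_isConicFibre (hM : IsModel α ρ g) (j : Fin 2) (c : ℂ) :
    ∃ n v, IsConicFibre ((chartPoly α j).eval c)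
      (fiberStr (ρ ≫ Quartic.str α) g (conicPoint j c)) n v := by
  obtain ⟨q, H⟩ := isPullback_fiberι g Conic.str (conicPt j c) (conicPt_self_str j c)
  have hq : fiberStr (ρ ≫ Quartic.str α) g (conicPoint j c) = q := by
    have := H.w
    rw [fiberStr, ← hM.comm]
    exact (Category.assoc _ _ _).symm.trans ((congrArg (· ≫ Conic.str) this).trans
      ((Category.assoc _ _ _).trans
        ((congrArg (q ≫ ·) (conicPt_self_str j c)).trans (Category.comp_id _))))
  rw [hq]
  exact hM.exists_isConicFibre_of_isPullback j c H

end IsModel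

end

end Minitwistor

namespace Minitwistor

/-! ### Closed points of the conic -/

theorem isClosed_conicPoint (j : Fin 2) (c : ℂ) : IsClosed {conicPoint j c} := by
  have : IsClosedImmersion (conicPt j c ≫ Conic.str) := by
    rw [conicPt_self_str]; infer_instance
  have : IsClosedImmersion (conicPt j c) := IsClosedImmersion.of_comp (conicPt j c) Conic.str
  have h := (conicPt j c).isClosedEmbedding.isClosed_range
  have h2 : Set.range (conicPt j c) = {conicPoint j c} := by
    refine Set.Subset.antisymm ?_ (Set.singleton_subset_iff.mpr ⟨_, rfl⟩)
    rintro _ ⟨z, rfl⟩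
    rw [Set.mem_singleton_iff, conicPoint]
    exact congrArg _ (Subsingleton.elim (α := PrimeSpectrum ℂ) _ _)
  rwa [h2] at h

/-- The closed point `t = c` of the affine line. -/
noncomputable def linePoint (c : ℂ) : PrimeSpectrum (Polynomial ℂ) :=
  ⟨RingHom.ker (Polynomial.aeval (R := ℂ) c).toRingHom, RingHom.ker_isPrime _⟩

theorem mem_linePoint_iff {c : ℂ} {P : Polynomial ℂ} :
    P ∈ (linePoint c).asIdeal ↔ P.eval c = 0 := Iff.rfl

theorem conicPoint_eq (j : Fin 2) (c : ℂ) : conicPoint j c = conicChart j (linePoint c) := by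
  rw [conicPoint, conicPt_eq]
  refine (Scheme.Hom.comp_apply _ _ _).trans (congrArg (conicChart j) (PrimeSpectrum.ext ?_))
  have : IsLocalRing.closedPoint ℂ = (⊥ : PrimeSpectrum ℂ) := Subsingleton.elim _ _
  rw [this]
  rfl

theorem conicPoint_injective (j : Fin 2) : Function.Injective (conicPoint j) := by
  intro c c' h
  rw [conicPoint_eq, conicPoint_eq] at h
  have h1 : linePoint c = linePoint c' := (conicChart j).injective h
  have h2 : (Polynomial.X - Polynomial.C c') ∈ (linePoint c).asIdeal := by
    rw [h1, mem_linePoint_iff]; simp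
  rw [mem_linePoint_iff] at h2
  simpa [sub_eq_zero] using h2

theorem exists_eq_linePoint (m : PrimeSpectrum (Polynomial ℂ)) (hm : m.asIdeal.IsMaximal) :
    ∃ c, m = linePoint c := by
  obtain ⟨p, hp⟩ := IsPrincipalIdealRing.principal m.asIdeal
  have hp' : m.asIdeal = Ideal.span {p} := hp
  have hirr : Irreducible p := by
    have h0 : p ≠ 0 := by
      rintro rfl
      rw [Ideal.span_singleton_zero] at hp'
      exact Ring.ne_bot_of_isMaximal_of_not_isField hm (Polynomial.not_isField ℂ) hp'
    exact ((Ideal.span_singleton_prime h0).mp (hp' ▸ m.2)).irreducible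
  obtain ⟨c, hc⟩ := IsAlgClosed.exists_root p
    (by rw [IsAlgClosed.degree_eq_one_of_irreducible ℂ hirr]; norm_num)
  refine ⟨c, PrimeSpectrum.ext (hm.eq_of_le (linePoint c).2.ne_top ?_)⟩
  rw [hp', Ideal.span_singleton_le_iff_mem]
  exact hc

theorem exists_eq_conicPoint {y : Conic} (hy : IsClosed {y}) : ∃ j c, y = conicPoint j c := by
  obtain ⟨j, hj⟩ := conic_cover y
  obtain ⟨z, rfl⟩ := (Set.ext_iff.mp (isOpenImmersion_conicChart j).2 y).mpr hj
  have h1 : IsClosed ({z} : Set (PrimeSpectrum (Polynomial ℂ))) := by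
    have := hy.preimage (conicChart j).continuous
    rwa [← Set.image_singleton, (conicChart j).injective.preimage_image] at this
  obtain ⟨c, hc⟩ := exists_eq_linePoint z ((PrimeSpectrum.isClosed_singleton_iff_isMaximal _).mp h1)
  exact ⟨j, c, by rw [conicPoint_eq]; exact congrArg _ hc⟩

theorem conicPoint_one_eq {c : ℂ} (hc : c ≠ 0) : conicPoint 1 c = conicPoint 0 c⁻¹ := by
  have : conicPt 1 c = conicPt 0 c⁻¹ := by
    refine coordPt_congr _ _ _ _ _ _ _ (c⁻¹ ^ 2) fun k => ?_
    fin_cases k <;> simp [conicTuple] <;> field_simp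
  rw [conicPoint, this, conicPoint]

theorem conicPoint_zero_ne (c : ℂ) : conicPoint 0 c ≠ conicPoint 1 0 := by
  intro h
  have h1 : conicPoint 0 c ∈ conicOpen (conicIdx 0) := conicPt_mem_conicOpen 0 c _
  rw [h] at h1
  refine (coordPt_mem_iff _ _ _ _ _ _).mp h1 ?_
  have h2 : conicTuple 1 (0 : ℂ) (conicIdx 0) = 0 := by simp [conicTuple, conicIdx]
  rw [h2]
  exact zero_mem _

theorem dense_of_nonempty (U : Conic.Opens) (hU : (U : Set Conic).Nonempty) :
    Dense (U : Set Conic) := by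
  have h1 : ∀ j, lineGen 1 j ≫ conicChart j = conicPt j (LineField.coord 1 j) := fun j =>
    (conicPt_eq j _).symm
  have h2 : conicPt 0 (LineField.coord 1 0) = conicPt 1 (LineField.coord 1 1) := by
    have := LineField.x_ne_zero
    refine coordPt_congr _ _ _ _ _ _ _ (LineField.x⁻¹ ^ 2) fun k => ?_
    fin_cases k <;> simp [conicTuple, LineField.coord] <;> field_simp
  have h3 : IsDominant (conicPt 0 (LineField.coord 1 0)) := by
    constructor
    intro y
    obtain ⟨j, hj⟩ := conic_cover y
    have := isDominant_lineGen one_ne_zero j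
    have h4 := range_subset_closure_range (lineGen 1 j) (conicChart j)
      ((Set.ext_iff.mp (isOpenImmersion_conicChart j).2 y).mpr hj)
    rw [h1] at h4
    obtain rfl | rfl : j = 0 ∨ j = 1 := by omega
    · exact h4
    · rwa [← h2] at h4
  exact dense_of_isDominant (conicPt 0 (LineField.coord 1 0)) U hU

/-! ### The singular fibres of the projection -/

theorem eval_chartPoly_zero (α : ℝ) (c : ℂ) :
    (chartPoly α 0).eval c = c * ((1 - c) * (1 + α * c)) := by
  simp only [chartPoly, if_true, Polynomial.eval_mul, Polynomial.eval_add,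
    Polynomial.eval_sub, Polynomial.eval_X, Polynomial.eval_C, Polynomial.eval_one,
    Polynomial.eval_pow]
  ring

theorem eval_chartPoly_one (α : ℝ) (c : ℂ) :
    (chartPoly α 1).eval c = c * ((c - 1) * (c + α)) := by
  simp only [chartPoly, one_ne_zero, if_false, Polynomial.eval_mul, Polynomial.eval_add,
    Polynomial.eval_sub, Polynomial.eval_X, Polynomial.eval_C, Polynomial.eval_pow]
  ring

namespace IsModel

variable {α : ℝ} {E : Scheme.{0}} {ρ : E ⟶ Quartic α} {g : E ⟶ Conic}

theorem isSmoothRationalCurve_fiber (hM : IsModel α ρ g) {j : Fin 2} {c : ℂ}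
    (hc : (chartPoly α j).eval c ≠ 0) :
    IsSmoothRationalCurve (fiberStr (ρ ≫ Quartic.str α) g (conicPoint j c)) := by
  obtain ⟨n, v, H⟩ := hM.exists_isConicFibre j c
  exact H.isSmoothRationalCurve hc

theorem isPairOfRationalCurves_fiber (hM : IsModel α ρ g) {j : Fin 2} {c : ℂ}
    (hc : (chartPoly α j).eval c = 0) :
    IsPairOfRationalCurves (fiberStr (ρ ≫ Quartic.str α) g (conicPoint j c)) := by
  have := hM.exists_isConicFibre j c
  rw [hc] at this
  obtain ⟨n, v, H⟩ := this
  exact H.isPairOfRationalCurves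

theorem conicPoint_mem_singularValues_iff (hM : IsModel α ρ g) (j : Fin 2) (c : ℂ) :
    conicPoint j c ∈ singularValues (ρ ≫ Quartic.str α) g ↔ (chartPoly α j).eval c = 0 := by
  have := hM.exists_isConicFibre j c
  constructor
  · intro h
    by_contra hc
    obtain ⟨n, v, H⟩ := this
    exact h.2 (H.smooth hc)
  · intro hc
    rw [hc] at this
    obtain ⟨n, v, H⟩ := this
    exact ⟨isClosed_conicPoint j c, H.not_smooth⟩

/-- The first chart contributes 0, 1 and -1/α. The roots 1 and -α of the second chart are the same
points in the inverse parameter, so only its origin, t = ∞, is new. -/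
theorem singularValues_eq (hM : IsModel α ρ g) (hα : α ≠ 0) :
    singularValues (ρ ≫ Quartic.str α) g =
      {conicPoint 0 0, conicPoint 0 1, conicPoint 0 (-α)⁻¹, conicPoint 1 0} := by
  have hα' : (α : ℂ) ≠ 0 := by exact_mod_cast hα
  ext y
  constructor
  · intro hy
    obtain ⟨j, c, rfl⟩ := exists_eq_conicPoint hy.1
    have hc := (hM.conicPoint_mem_singularValues_iff j c).mp hy
    obtain rfl | rfl : j = 0 ∨ j = 1 := by omega
    · rw [eval_chartPoly_zero, mul_eq_zero, mul_eq_zero] at hc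
      obtain rfl | h | h := hc
      · exact Or.inl rfl
      · obtain rfl : c = 1 := by linear_combination -h
        exact Or.inr (Or.inl rfl)
      · have : c = (-α : ℂ)⁻¹ := by
          refine eq_inv_of_mul_eq_one_left ?_
          linear_combination -h
        exact Or.inr (Or.inr (Or.inl (by rw [this])))
    · rw [eval_chartPoly_one, mul_eq_zero, mul_eq_zero] at hc
      obtain rfl | h | h := hc
      · exact Or.inr (Or.inr (Or.inr rfl))
      · obtain rfl : c = 1 := by linear_combination h
        exact Or.inr (Or.inl (by rw [conicPoint_one_eq one_ne_zero, inv_one]))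
      · obtain rfl : c = -α := by linear_combination h
        exact Or.inr (Or.inr (Or.inl (conicPoint_one_eq (neg_ne_zero.mpr hα'))))
  · rintro (rfl | rfl | rfl | rfl) <;> rw [hM.conicPoint_mem_singularValues_iff]
    · rw [eval_chartPoly_zero]; ring
    · rw [eval_chartPoly_zero]; ring
    · rw [eval_chartPoly_zero]; field_simp; ring
    · rw [eval_chartPoly_one]; ring

theorem ncard_singularValues (hM : IsModel α ρ g) (hα₁ : -1 < α) (hα₂ : α < 0) :
    (singularValues (ρ ≫ Quartic.str α) g).ncard = 4 := by
  have hα' : (α : ℂ) ≠ 0 := by exact_mod_cast hα₂.ne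
  -- The condition α > -1 keeps the roots 1 and -1/α apart.
  have hne : (-α : ℂ)⁻¹ ≠ 1 := by
    rw [ne_eq, inv_eq_one]
    intro h
    have : -α = 1 := by exact_mod_cast h
    linarith
  have hinj := conicPoint_injective 0
  rw [hM.singularValues_eq hα₂.ne, Set.ncard_insert_of_notMem, Set.ncard_insert_of_notMem,
    Set.ncard_pair (conicPoint_zero_ne _)]
  · rintro (h | h)
    · exact hne (hinj h).symm
    · exact conicPoint_zero_ne _ h
  · rintro (h | h | h)
    · exact zero_ne_one (hinj h)
    · exact inv_ne_zero (neg_ne_zero.mpr hα') (hinj h).symm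
    · exact conicPoint_zero_ne _ h

theorem exists_dense_isSmoothRationalCurve (hM : IsModel α ρ g) (hα₁ : -1 < α) (hα₂ : α < 0) :
    ∃ W : Conic.Opens, Dense (W : Set Conic) ∧ ∀ y ∈ W, IsClosed {y} →
      IsSmoothRationalCurve (fiberStr (ρ ≫ Quartic.str α) g y) := by
  have hcl : IsClosed (singularValues (ρ ≫ Quartic.str α) g) := by
    rw [← Set.biUnion_of_singleton (singularValues (ρ ≫ Quartic.str α) g)]
    exact Set.Finite.isClosed_biUnion
      (Set.finite_of_ncard_ne_zero (by rw [hM.ncard_singularValues hα₁ hα₂]; norm_num))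
      fun y hy => hy.1
  have hmem : ∀ j c, conicPoint j c ∉ singularValues (ρ ≫ Quartic.str α) g ↔
      (chartPoly α j).eval c ≠ 0 := fun j c => not_congr (hM.conicPoint_mem_singularValues_iff j c)
  -- The complement of the finitely many singular values is nonempty because it contains t = -1,
  -- where h = -2(1 - α) ≠ 0.
  refine ⟨⟨_, hcl.isOpen_compl⟩, dense_of_nonempty _ ⟨conicPoint 0 (-1), (hmem 0 (-1)).mpr ?_⟩,
    fun y hy hy' => ?_⟩
  · rw [eval_chartPoly_zero]
    have : (1 + α * (-1) : ℂ) ≠ 0 := by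
      intro h
      have : 1 + α * (-1) = 0 := by exact_mod_cast h
      linarith
    refine mul_ne_zero (by norm_num) (mul_ne_zero (by norm_num) this)
  · obtain ⟨j, c, rfl⟩ := exists_eq_conicPoint hy'
    exact hM.isSmoothRationalCurve_fiber ((hmem j c).mp hy)

end IsModel

end Minitwistor

theorem mainTheorem6 (α : ℝ) (hα₁ : -1 < α) (hα₂ : α < 0) :
    -- the chart `y₁ ≠ 0` is dense, so that the projection is a rational map `π : T ⤏ Λ`
    ∃ hd : Dense (chart α : Set (Quartic α)),
      -- the indeterminacy set of `π` is the singular locus of `T`, and it consists of two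
      -- ordinary double points
      (((ratProj α hd).domain : Set (Quartic α))ᶜ = singularLocus (Quartic.str α) ∧
        (singularLocus (Quartic.str α)).ncard = 2 ∧
        ∀ t ∈ singularLocus (Quartic.str α), IsOrdinaryDoublePoint t) ∧
      -- a minimal resolution `ρ : X ⟶ T` exists
      (∃ (X : Scheme.{0}) (ρ : X ⟶ Quartic α), IsMinimalResolution (Quartic.str α) ρ) ∧
      ∀ (X : Scheme.{0}) (ρ : X ⟶ Quartic α), IsMinimalResolution (Quartic.str α) ρ →
        -- the composition of `ρ` with `π` is (represented by) a morphism `g : X ⟶ Λ`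
        ∃ g : X ⟶ Conic,
          Dense (ρ ⁻¹ᵁ chart α : Set X) ∧
          (ρ ⁻¹ᵁ chart α).ι ≫ g = (ρ ∣_ chart α) ≫ chartProj α ∧
          -- general fibres of `g` are irreducible smooth rational curves
          (∃ W : Conic.Opens, Dense (W : Set Conic) ∧ ∀ y ∈ W, IsClosed {y} →
            IsSmoothRationalCurve (fiberStr (ρ ≫ Quartic.str α) g y)) ∧
          -- `g` has exactly four singular fibres, each a pair of rational curves
          (singularValues (ρ ≫ Quartic.str α) g).ncard = 4 ∧
          ∀ y ∈ singularValues (ρ ≫ Quartic.str α) g,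
            IsPairOfRationalCurves (fiberStr (ρ ≫ Quartic.str α) g y) := by
  have hd : Dense (chart α : Set (Quartic α)) := by
    rw [chart_eq]
    exact dense_surfOpen α 0
  refine ⟨hd, ⟨?_, ?_, ?_⟩, ⟨_, _, (isModel_image α).isMinimalResolution hα₁ hα₂⟩, ?_⟩
  · rw [compl_domain_eq α hd, singularLocus_eq hα₁ hα₂]
  · rw [singularLocus_eq hα₁ hα₂, ncard_range_vertex]
  · rw [singularLocus_eq hα₁ hα₂]
    rintro _ ⟨k, rfl⟩
    exact isOrdinaryDoublePoint_vertex α k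
  · intro X ρ hρ
    obtain ⟨g, hM⟩ := (isModel_image α).exists_of_isMinimalResolution hα₁ hα₂ hρ
    refine ⟨g, hM.dense_preimage_chart, hM.ι_comp_eq, hM.exists_dense_isSmoothRationalCurve hα₁ hα₂,
      hM.ncard_singularValues hα₁ hα₂, fun y hy => ?_⟩
    obtain ⟨j, c, rfl⟩ := exists_eq_conicPoint hy.1
    exact hM.isPairOfRationalCurves_fiber ((hM.conicPoint_mem_singularValues_iff j c).mp hy)
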